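/- **Model.** For a distribution $F$ on $\mathbb R^D$ carried by a set on which all inner products lie in $[0,1]$, $(X,A)\sim\mathrm{RDPG}(F)$ means that $X_1,\dots,X_n$ are i.i.d. with law $F$ and that, given $X$, the simple graph $A$ on $[n]$ has independent edges, $ij$ being an edge with probability $\langle X_i,X_j\rangle$. A 1-level HSBM (a stochastic blockmodel) is a finite mixture of point masses with positive weights, and for $\ell\ge2$ an $\ell$-level HSBM is a finite mixture $F=\sum_{i=1}^{R}\pi(i)F_i$ with $\pi(i)\in(0,1)$, $\sum_i\pi(i)=1$, each $F_i$ being an $h$-level HSBM with $h\le\ell-1$ and at least one of them an $(\ell-1)$-level one. The distributions occurring in this recursive decomposition are the sub-HSBMs $G$; those of level at least 2 are mixtures, of $R^G$ components $F^G_1,\dots,F^G_{R^G}$. The dimension $D^G$ of $G$ is the rank of the second moment matrix $\mathbb E[YY^\top]$, where $Y$ has the law $G$; $F^G_r$ has the dimension $D^G_r$. The vertex set of the subgraph belonging to $G$ is the set of the vertices drawn from $G$, and $H^G_1,\dots,H^G_{R^G}$ are the subgraphs belonging to the components. $H^G_i$ and $H^G_j$ are of the same motif if $F^G_i$ is the image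 of $F^G_j$ under an orthogonal transformation. Events $E_n$ occur asymptotically almost surely (a.a.s.) if for every $c>0$ there is $n_0$ such that $\mathbb P(E_n)\ge1-\eta$ whenever $n>n_0$ and $n^{-c}<\eta<1/2$. **Procedure.** The adjacency spectral embedding of a graph with adjacency matrix $A$ into $\mathbb R^d$ is $\widehat X=US^{1/2}$, where $S$ holds the $d$ largest eigenvalues of $|A|=(A^\top A)^{1/2}$ and $U$ corresponding orthonormal eigenvectors. Its rows are clustered into $R$ clusters as follows. Start with any $R$ rows as seeds. Run through all rows; at each row $x$ take a pair $\tilde y,\tilde z$ of different seeds with the largest inner product and replace $\tilde z$ by $x$ if $\max_{s}\langle x,s\rangle<\langle\tilde y,\tilde z\rangle$, keep the seeds if $\max_{s}\langle x,s\rangle>\langle\tilde y,\tilde z\rangle$, and do either in case of equality. Finally put every row into the cluster of a seed with which it has the largest inner product. The recursive procedure embeds the graph into $\mathbb R^{D}$, $D$ being its dimension, clusters it into as many clusters $\widehat H_r$ as the mixture has components, embeds each $\widehat H_r$ into $\mathbb R^{D_r}$, computes the dissimilarities below, and recurses on each $\widehat H_r$ whose model has level at least 2; the numbers $R^G$ and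 $D^G$ are known to it. With the Gaussian kernel $\kappa(x,y)=e^{-\|x-y\|^2/\sigma^2}$, $\sigma>0$ fixed, let, for point clouds $x_1,\dots,x_n$ and $y_1,\dots,y_m$, $$T(x,y)=\frac1{n(n-1)}\sum_{i\ne j}\kappa(x_i,x_j)-\frac2{mn}\sum_{i,k}\kappa(x_i,y_k)+\frac1{m(m-1)}\sum_{k\ne l}\kappa(y_k,y_l),$$ and $\overline T(x,y)=\inf_W T(x,Wy)$ over all orthogonal $W$ (clouds of lower dimension are padded with zeros to $\mathbb R^{D}$, the space that contains the latent positions of the whole model). **Theorem.** Let $\ell\ge2$ and let $(X,A)\sim\mathrm{RDPG}(F)$ on $n$ vertices, where $F$ is an $\ell$-level HSBM that does not depend on $n$. Assume that for every sub-HSBM $G$ of level at least 2, every inner product of latent positions from two different components of $G$ is smaller than every inner product of two (possibly equal) latent positions from one component of $G$. Then: 1. A.a.s., simultaneously for all sub-HSBMs $G$ of level at least 2, for all choices of initial seeds, of the order of the vertices, of eigenvectors and at ties, the procedure recovers the subgraphs exactly: after renumbering, $\widehat H^G_r=H^G_r$ for $r=1,\dots,R^G$. 2. For every $\varepsilon>0$,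 a.a.s., simultaneously for all such $G$ and all such choices, in addition there are orthogonal matrices $O_1,\dots,O_{R^G}$ with $|T(\widehat X_{\widehat H^G_i},\widehat X_{\widehat H^G_j})-T(O_iX_{H^G_i},O_jX_{H^G_j})|\le\varepsilon$ for all $i,j$, and $|\overline T(\widehat X_{\widehat H^G_i},\widehat X_{\widehat H^G_j})-\overline T(X_{H^G_i},X_{H^G_j})|\le\varepsilon$ for all $i,j$. 3. There is $t_0>0$ such that for every $t\in(0,t_0)$, a.a.s., simultaneously for all such $G$ and all such choices, in addition, for all $i,j$: $\overline T(\widehat X_{\widehat H^G_i},\widehat X_{\widehat H^G_j})<t$ if and only if $H^G_i$ and $H^G_j$ are of the same motif. -/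

import Mathlib

open MeasureTheory ProbabilityTheory

open scoped Classical

noncomputable section

/-- Euclidean space `ℝ^d`. -/
abbrev Euc (d : ℕ) : Type := EuclideanSpace ℝ (Fin d)

/-! ### Random dot product graphs -/

/-- `(X, A) ∼ RDPG(F)` on `n` vertices: `F` lives on a set all of whose inner products are in
`[0,1]`, the rows `X 0, …, X (n-1)` are i.i.d. with law `F`, and the conditional law of the simple
graph `A` (a symmetric hollow `0/1` matrix) given `X` is
`ℙ[A = a ∣ X] = ∏_{i > j} ⟪X i, X j⟫ ^ a i j * (1 - ⟪X i, X j⟫) ^ (1 - a i j)`. -/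
structure IsRDPG {Ω : Type*} [MeasurableSpace Ω] (μ : Measure Ω) {D : ℕ} (F : Measure (Euc D))
    {n : ℕ} (X : Ω → Fin n → Euc D) (A : Ω → SimpleGraph (Fin n)) : Prop where
  inner_mem : ∃ S : Set (Euc D), F Sᶜ = 0 ∧ ∀ x ∈ S, ∀ y ∈ S, inner ℝ x y ∈ Set.Icc (0 : ℝ) 1
  measurable_pos : Measurable X
  measurable_graph : ∀ a : SimpleGraph (Fin n), MeasurableSet {ω | A ω = a}
  indep : iIndepFun (fun i ω => X ω i) μ
  law : ∀ i, μ.map (fun ω => X ω i) = F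
  cond : ∀ (a : SimpleGraph (Fin n)) (B : Set (Fin n → Euc D)), MeasurableSet B →
    μ {ω | X ω ∈ B ∧ A ω = a} =
      ∫⁻ ω in {ω | X ω ∈ B}, ENNReal.ofReal (∏ i : Fin n, ∏ j ∈ Finset.Iio i,
        if a.Adj i j then inner ℝ (X ω i) (X ω j) else 1 - inner ℝ (X ω i) (X ω j)) ∂μ

/-- Two latent position distributions give the same motif when they agree up to an orthogonal
transformation. -/
def SameMotif {D : ℕ} (F G : Measure (Euc D)) : Prop :=
  ∃ U : Euc D ≃ₗᵢ[ℝ] Euc D, F = G.map U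

/-- The events `E n` occur asymptotically almost surely: for every `c > 0` there is `n₀` such that
`ℙ(E n) ≥ 1 - η` whenever `n > n₀` and `n ^ (-c) < η < 1/2`. -/
def AAS {Ω : ℕ → Type*} [∀ n, MeasurableSpace (Ω n)] (μ : ∀ n, Measure (Ω n))
    (E : ∀ n, Set (Ω n)) : Prop :=
  ∀ c : ℝ, 0 < c → ∃ n₀ : ℕ, ∀ n : ℕ, n₀ < n → ∀ η : ℝ, (n : ℝ) ^ (-c) < η → η < 1 / 2 →
    ENNReal.ofReal (1 - η) ≤ μ n (E n)

/-! ### Hierarchical stochastic blockmodels -/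

/-- Parameters of a hierarchical stochastic blockmodel with latent positions in `ℝ^D`: either a
mixture of point masses (a stochastic blockmodel), or a mixture of hierarchical blockmodels. -/
inductive HSBM (D : ℕ) : Type
  | sbm (K : ℕ) (w : Fin K → ℝ) (ξ : Fin K → Euc D) : HSBM D
  | mix (R : ℕ) (w : Fin R → ℝ) (H : Fin R → HSBM D) : HSBM D

namespace HSBM

variable {D : ℕ}

/-- The latent position distribution. -/
def law : HSBM D → Measure (Euc D)
  | sbm _ w ξ => ∑ k, ENNReal.ofReal (w k) • Measure.dirac (ξ k)
  | mix _ w H => ∑ i, ENNReal.ofReal (w i) • (H i).law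

/-- The set of all latent positions, i.e. of the atoms of the distribution. -/
def positions : HSBM D → Set (Euc D)
  | sbm _ _ ξ => Set.range ξ
  | mix _ _ H => ⋃ i, (H i).positions

/-- `G.IsLevel ℓ`: the parameters are those of an `ℓ`-level HSBM. Level `1` is a stochastic
blockmodel; for `ℓ ≥ 2` the distribution is a mixture with weights in `(0,1)` whose components are
HSBMs of level at most `ℓ - 1`, at least one of them of level `ℓ - 1`. -/
def IsLevel : HSBM D → ℕ → Prop
  | sbm _ w _, ℓ => ℓ = 1 ∧ (∀ k, 0 < w k) ∧ ∑ k, w k = 1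
  | mix _ w H, ℓ => 2 ≤ ℓ ∧ (∀ i, 0 < w i ∧ w i < 1) ∧ ∑ i, w i = 1 ∧
      (∀ i, ∃ h, h ≤ ℓ - 1 ∧ (H i).IsLevel h) ∧ ∃ i, (H i).IsLevel (ℓ - 1)

/-- Multilevel affinity: in every mixture occurring in the hierarchy, every inner product between
latent positions of two different components is smaller than every inner product between latent
positions of one component (`p < q`, all sets being finite). -/
def Affinity : HSBM D → Prop
  | sbm _ _ _ => True
  | mix _ _ H =>
      (∀ j k, j ≠ k → ∀ u ∈ (H j).positions, ∀ v ∈ (H k).positions,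
        ∀ i, ∀ x ∈ (H i).positions, ∀ y ∈ (H i).positions, inner ℝ u v < inner ℝ x y) ∧
      ∀ i, (H i).Affinity

/-- The second moment matrix `Δ = 𝔼[X₁ X₁ᵀ]`. -/
def secondMoment (G : HSBM D) : Matrix (Fin D) (Fin D) ℝ :=
  fun a b => ∫ x, x a * x b ∂G.law

/-- The dimension of the model as a random dot product graph: the rank of `Δ`. -/
def dim (G : HSBM D) : ℕ := G.secondMoment.rank

/-- The vertices of `V` that belong to the subgraph with parameters `G`. -/
def members (G : HSBM D) {n : ℕ} (X : Fin n → Euc D) (V : Finset (Fin n)) : Finset (Fin n) :=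
  V.filter fun v => X v ∈ G.positions

end HSBM

/-! ### Adjacency spectral embedding -/

/-- The adjacency matrix of the subgraph of `a` induced on `V`. -/
def adjOn {n : ℕ} (a : SimpleGraph (Fin n)) (V : Finset (Fin n)) : Matrix V V ℝ :=
  fun u v => if a.Adj u v then 1 else 0

/-- `Xh` (with rows `Xh v`) is an adjacency spectral embedding of `A` into `ℝ^d`. Here
`M = |A| = (Aᵀ A)^{1/2}`, the vectors `b k` are an orthonormal eigenbasis of `M` with eigenvalues
`s 0 ≥ s 1 ≥ …`, and `Xh = U S^{1/2}` for the first `d` of them (with zero columns if there are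
fewer than `d` vertices). -/
def IsASE {V : Type*} [Fintype V] (A : Matrix V V ℝ) {d : ℕ} (Xh : V → Euc d) : Prop :=
  ∃ M : Matrix V V ℝ, M.PosSemidef ∧ M * M = A.transpose * A ∧
  ∃ (b : OrthonormalBasis (Fin (Fintype.card V)) ℝ (EuclideanSpace ℝ V))
    (s : Fin (Fintype.card V) → ℝ), Antitone s ∧
    (∀ k v, M.mulVec (fun u => b k u) v = s k * b k v) ∧
    ∀ v (j : Fin d), Xh v j =
      if h : (j : ℕ) < Fintype.card V then Real.sqrt (s ⟨j, h⟩) * b ⟨j, h⟩ v else 0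

/-! ### Seeded nearest neighbour subspace clustering -/

section Clustering

variable {V : Type*} {d R : ℕ}

/-- One step of the seed selection, at the vertex `v`. The current seeds are the rows
`Xh (s 0), …, Xh (s (R-1))`; `y ≠ z` is a pair of seeds with the largest inner product. If all
inner products of `Xh v` with seeds are below that value, `v` replaces `z`; if one of them is above
it, nothing changes; if the largest one equals it, both are allowed. -/
def SeedStep (Xh : V → Euc d) (v : V) (s s' : Fin R → V) : Prop :=
  ∃ y z : Fin R, y ≠ z ∧
    (∀ y' z' : Fin R, y' ≠ z' →
      inner ℝ (Xh (s y')) (Xh (s z')) ≤ inner ℝ (Xh (s y)) (Xh (s z))) ∧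
    (((∀ x, inner ℝ (Xh v) (Xh (s x)) ≤ inner ℝ (Xh (s y)) (Xh (s z))) ∧
        s' = Function.update s z v) ∨
      ((∃ x, inner ℝ (Xh (s y)) (Xh (s z)) ≤ inner ℝ (Xh v) (Xh (s x))) ∧ s' = s))

/-- The seed selection along a list of vertices, from the seeds `s` to the final seeds. -/
inductive SeedRun (Xh : V → Euc d) : List V → (Fin R → V) → (Fin R → V) → Prop
  | nil (s : Fin R → V) : SeedRun Xh [] s s
  | cons {v : V} {l : List V} {s s' s'' : Fin R → V} :
      SeedStep Xh v s s' → SeedRun Xh l s' s'' → SeedRun Xh (v :: l) s s''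

/-- `C 0, …, C (R-1)` is a possible output of the clustering of the rows of `Xh` into `R` clusters,
for some initial sample `s₀` of seeds, some order of the vertices and some choice at ties: `s` are
the final seeds, the cluster `C j` is initialized to `{s j}` and every vertex `v` is then added to a
cluster `τ v` whose seed has the largest inner product with `Xh v`. -/
def SeededClustering [Fintype V] (Xh : V → Euc d) (C : Fin R → Finset V) : Prop :=
  ∃ l : List V, l.Nodup ∧ (∀ v, v ∈ l) ∧ ∃ s₀ s : Fin R → V, SeedRun Xh l s₀ s ∧
    ∃ τ : V → Fin R,
      (∀ v j, inner ℝ (Xh v) (Xh (s j)) ≤ inner ℝ (Xh v) (Xh (s (τ v)))) ∧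
      ∀ j, C j = insert (s j) (Finset.univ.filter fun v => τ v = j)

end Clustering

/-- Embed the subgraph of `a` on `V` into `ℝ^d` and cluster it into `R` subgraphs `Hh r`. -/
def EmbedAndCluster {n : ℕ} (a : SimpleGraph (Fin n)) (V : Finset (Fin n)) (d : ℕ) {R : ℕ}
    (Hh : Fin R → Finset (Fin n)) : Prop :=
  ∃ (Xh : V → Euc d) (C : Fin R → Finset V), IsASE (adjOn a V) Xh ∧ SeededClustering Xh C ∧
    ∀ r, Hh r = (C r).map (Function.Embedding.subtype _)

/-! ### The test statistic -/

/-- Gaussian radial basis kernel with bandwidth `σ`. -/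
def rbf {D : ℕ} (σ : ℝ) (x y : Euc D) : ℝ := Real.exp (-‖x - y‖ ^ 2 / σ ^ 2)

/-- The statistic `T_{n,m}(X, Y)`. -/
def testT {D : ℕ} (σ : ℝ) {U V : Type*} [Fintype U] [Fintype V]
    (X : U → Euc D) (Y : V → Euc D) : ℝ :=
  let n : ℝ := Fintype.card U
  let m : ℝ := Fintype.card V
  1 / (n * (n - 1)) * (∑ i, ∑ j, if j ≠ i then rbf σ (X i) (X j) else 0)
    - 2 / (m * n) * (∑ i, ∑ k, rbf σ (X i) (Y k))
    + 1 / (m * (m - 1)) * (∑ k, ∑ l, if l ≠ k then rbf σ (Y k) (Y l) else 0)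

/-- The statistic after optimal orthogonal alignment of the two point clouds, which are determined
by the graphs only up to orthogonal transformations. -/
def alignedT {D : ℕ} (σ : ℝ) {U V : Type*} [Fintype U] [Fintype V]
    (X : U → Euc D) (Y : V → Euc D) : ℝ :=
  ⨅ W : Euc D ≃ₗᵢ[ℝ] Euc D, testT σ X (fun k => W (Y k))

/-- Zero padding `ℝ^d → ℝ^D`, used with `d ≤ D`, so that embeddings of different dimensions can be
compared. -/
def pad {d : ℕ} (D : ℕ) (x : Euc d) : Euc D :=
  WithLp.toLp 2 fun j : Fin D => if h : (j : ℕ) < d then x ⟨j, h⟩ else 0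

/-! ### The recursive procedure -/

namespace HSBM

variable {D n : ℕ}

/-- A property of one round of the procedure: `H r` are the parameters of the components of the
current mixture and `Hh r` the estimated subgraphs. -/
abbrev RoundProp (D n : ℕ) : Type :=
  (R : ℕ) → (H : Fin R → HSBM D) → (Hh : Fin R → Finset (Fin n)) → Prop

/-- Run the recursive procedure on the subgraph of `a` on `V`, whose model is `G`. In each round,
for every possible output of the embedding (into the dimension of the current model) and clustering
(into the number of components of the current mixture), the clusters are, after numbering them
suitably, exactly the true subgraphs; the round has the property `Q`; and the same is true of the
recursion on each of the clusters. -/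
def PerfectRun (Q : RoundProp D n) (X : Fin n → Euc D) (a : SimpleGraph (Fin n)) :
    HSBM D → Finset (Fin n) → Prop
  | sbm _ _ _, _ => True
  | mix R w H, V => ∀ C : Fin R → Finset (Fin n), EmbedAndCluster a V (mix R w H).dim C →
      ∃ e : Equiv.Perm (Fin R), (∀ r, C (e r) = (H r).members X V) ∧
        Q R H (fun r => C (e r)) ∧ ∀ r, PerfectRun Q X a (H r) (C (e r))

/-- `Xh r` is an adjacency spectral embedding of the estimated subgraph `Hh r` into the dimension of
its model `H r`. -/
def Embeddings (a : SimpleGraph (Fin n)) {R : ℕ} (H : Fin R → HSBM D)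
    (Hh : Fin R → Finset (Fin n)) (Xh : ∀ r, Hh r → Euc (H r).dim) : Prop :=
  ∀ r, IsASE (adjOn a (Hh r)) (Xh r)

/-- The dissimilarities `T` of the embedded estimated subgraphs are within `ε` of those of the true
latent positions, the latter being represented by suitable orthogonal images; and the aligned
dissimilarities are within `ε` of those of the true latent positions. -/
def Consistent (σ ε : ℝ) (X : Fin n → Euc D) (a : SimpleGraph (Fin n)) : RoundProp D n :=
  fun R H Hh => ∀ Xh : ∀ r, Hh r → Euc (H r).dim, Embeddings a H Hh Xh →
    (∃ O : Fin R → (Euc D ≃ₗᵢ[ℝ] Euc D), ∀ i j,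
      |testT σ (fun v => pad D (Xh i v)) (fun v => pad D (Xh j v))
        - testT σ (fun v : Hh i => O i (X v)) (fun v : Hh j => O j (X v))| ≤ ε) ∧
    ∀ i j,
      |alignedT σ (fun v => pad D (Xh i v)) (fun v => pad D (Xh j v))
        - alignedT σ (fun v : Hh i => X v) (fun v : Hh j => X v)| ≤ ε

/-- Thresholding the aligned dissimilarities at `t` gives exactly the partition of the subgraphs
into motifs. -/
def MotifsDetected (σ t : ℝ) (a : SimpleGraph (Fin n)) : RoundProp D n :=
  fun R H Hh => ∀ Xh : ∀ r, Hh r → Euc (H r).dim, Embeddings a H Hh Xh →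
    ∀ i j : Fin R,
      alignedT σ (fun v => pad D (Xh i v)) (fun v => pad D (Xh j v)) < t ↔
        SameMotif (H i).law (H j).law

end HSBM

end

set_option linter.unusedSectionVars false

/-! All randomness is confined to one event, `IsTypical`: every position is an atom, every atom
carries about the expected number of vertices, and for any two vertices and any atom the number of
common neighbours sitting at that atom is near its conditional mean. Hoeffding's inequality and a
union bound make the failure probability at most a constant times n² times an exponential in -n,
which beats every n^(-c). On this event everything is deterministic, hence valid for all seeds,
orders, eigenvectors and ties. Counting common neighbours atom by atom is what makes the recursion
work: the vertex set of a sub-model is a union of atom classes, so the one event controls all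
induced subgraphs, and no conditioning on earlier rounds is needed.

For a sub-model let P be the Gram matrix of its latent positions and M = |A|. The square M² = AᵀA is
the matrix of codegrees; off the diagonal it is entrywise close to P², and after division by n² the
diagonal contributes only O(1/n). So (M/n)² and (P/n)² are close as operators, and because both
roots are positive, M/n and P/n are close too (`norm_sub_le_of_sq_close`). Weyl's inequalities then
compare P/n with the truncation N of M/n at the rank of P, which is the dimension of the model.
Clustering needs entries rather than norms. The vectors f = √n e_v are unbounded, but (M/n)² f is
bounded and close to (P/n)² f, since its entries are rescaled codegrees. As N (M/n)² = N³, also N³ f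
is close to (P/n)³ f, and since N and P/n are bounded below on their ranges the extra powers can be
removed (`abs_inner_sub_le_of_close`). Thus all inner products of embedded rows are uniformly close
to the latent ones (`abs_inner_ase_sub_le`, `IsNode.gram`).

Affinity leaves a gap around a threshold separating inner products within components from those
between them; closeness up to this gap makes the seeded clustering exact
(`SeededClustering.exact_recovery`). Closeness of Gram matrices also gives closeness of the clouds
up to an orthogonal map (`exists_delta_isometry_pad`), and T is Lipschitz in the points, whence
consistency. The Gaussian kernel is strictly positive definite (`sum_rbf_pos`), so the population
version of T vanishes only for equal laws; compactness of the orthogonal group bounds it below for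
different motifs (`exists_pos_le_populationT`), and this yields the threshold t₀. Exact recovery
hands the vertex sets of the sub-models to the next round, and the hierarchy is a finite tree, so
induction finishes the proof (`IsNode.perfectRun`). -/

noncomputable section

/-! ### Perturbation of positive operators and of their truncations. -/

section SpectralPerturbation

variable {E : Type*} [NormedAddCommGroup E] [InnerProductSpace ℝ E] [FiniteDimensional ℝ E]

/-- For positive operators, closeness of the squares implies closeness of the operators. -/
theorem norm_sub_le_of_sq_close {M P : E →ₗ[ℝ] E} (hM : M.IsSymmetric) (hP : P.IsSymmetric)
    (hM0 : ∀ x, 0 ≤ inner ℝ (M x) x) (hP0 : ∀ x, 0 ≤ inner ℝ (P x) x) {η : ℝ} (hη : 0 ≤ η)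
    (h : ∀ x, |‖M x‖ ^ 2 - ‖P x‖ ^ 2| ≤ η ^ 2 * ‖x‖ ^ 2) (x : E) : ‖M x - P x‖ ≤ η * ‖x‖ := by
  have hT : (M - P).IsSymmetric := hM.sub hP
  set b := hT.eigenvectorBasis rfl with hb
  set l := hT.eigenvalues rfl with hl
  have hTb : ∀ i, M (b i) - P (b i) = l i • b i := fun i => by
    simpa using hT.apply_eigenvectorBasis rfl i
  -- At a unit eigenvector of M - P with eigenvalue l, the difference ‖M b‖² - ‖P b‖² equals l ⟪(M +
  -- P) b, b⟫. Positivity of both operators gives |l| ≤ ⟪(M + P) b, b⟫, so l² is at most the assumed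
  -- bound.
  have hli : ∀ i, (l i) ^ 2 ≤ η ^ 2 := by
    intro i
    have hn : ‖b i‖ = 1 := b.orthonormal.1 i
    have h1 := h (b i)
    have hMe : M (b i) = P (b i) + l i • b i := by rw [← hTb i]; abel
    have e1 : inner ℝ (M (b i)) (b i) = inner ℝ (P (b i)) (b i) + l i := by
      rw [hMe, inner_add_left, inner_smul_left, real_inner_self_eq_norm_sq, hn]; simp
    have e2 : ‖M (b i)‖ ^ 2 - ‖P (b i)‖ ^ 2
        = l i * (inner ℝ (M (b i)) (b i) + inner ℝ (P (b i)) (b i)) := by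
      rw [e1, hMe, norm_add_sq_real, inner_smul_right, norm_smul, hn, mul_one,
        Real.norm_eq_abs, sq_abs]; ring
    rw [hn, e2, abs_mul, one_pow, mul_one] at h1
    have a1 := hM0 (b i)
    have a2 := hP0 (b i)
    have : |l i| ≤ |inner ℝ (M (b i)) (b i) + inner ℝ (P (b i)) (b i)| := by
      rw [abs_of_nonneg (add_nonneg a1 a2), abs_le]; constructor <;> linarith
    calc (l i) ^ 2 = |l i| * |l i| := by rw [← sq, sq_abs]
      _ ≤ _ := mul_le_mul_of_nonneg_left this (abs_nonneg _)
      _ ≤ _ := h1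
  have key : ‖(M - P) x‖ ^ 2 ≤ (η * ‖x‖) ^ 2 := by
    rw [← b.sum_sq_inner_right ((M - P) x), mul_pow, ← b.sum_sq_inner_right x, Finset.mul_sum]
    refine Finset.sum_le_sum fun i _ => ?_
    rw [← hT (b i) x, LinearMap.sub_apply, hTb i, inner_smul_left, mul_pow]
    exact mul_le_mul_of_nonneg_right (hli i) (sq_nonneg _)
  exact (pow_le_pow_iff_left₀ (norm_nonneg _) (by positivity) two_ne_zero).1 key

variable {m : ℕ} (b : OrthonormalBasis (Fin m) ℝ E) (s : Fin m → ℝ)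

theorem inner_basis_apply {M : E →ₗ[ℝ] E} (hM : M.IsSymmetric) (hb : ∀ k, M (b k) = s k • b k)
    (k : Fin m) (x : E) : inner ℝ (b k) (M x) = s k * inner ℝ (b k) x := by
  rw [← hM (b k) x, hb, inner_smul_left]; simp

theorem inner_apply_self_eq_sum {M : E →ₗ[ℝ] E} (hM : M.IsSymmetric)
    (hb : ∀ k, M (b k) = s k • b k) (x : E) :
    inner ℝ (M x) x = ∑ k, s k * inner ℝ (b k) x ^ 2 := by
  rw [← b.sum_inner_mul_inner]
  refine Finset.sum_congr rfl fun k _ => ?_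
  rw [real_inner_comm, inner_basis_apply b s hM hb]; ring

/-- Lower Weyl inequality. -/
theorem le_eigenvalue_of_close {M P : E →ₗ[ℝ] E} (hM : M.IsSymmetric)
    (hb : ∀ k, M (b k) = s k • b k) (hs : Antitone s) {η c : ℝ}
    (hMP : ∀ x, ‖M x - P x‖ ≤ η * ‖x‖)
    (hPc : ∀ y ∈ LinearMap.range P, c * ‖y‖ ^ 2 ≤ inner ℝ (P y) y)
    (k : Fin m) (hk : (k : ℕ) < Module.finrank ℝ (LinearMap.range P)) : c - η ≤ s k := by
  -- Dimension count: the range of P has dimension above k, hence contains a nonzero y orthogonal to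
  -- the k eigenvectors preceding `b k`. On such y the form of M is at most s k.
  let φ : LinearMap.range P →ₗ[ℝ] (Fin k → ℝ) :=
    LinearMap.pi fun i => (innerₛₗ ℝ (b ⟨i, i.2.trans k.2⟩)).comp (Submodule.subtype _)
  have hker : LinearMap.ker φ ≠ ⊥ := LinearMap.ker_ne_bot_of_finrank_lt (by simpa using hk)
  obtain ⟨y, hy, hy0⟩ := Submodule.exists_mem_ne_zero_of_ne_bot hker
  have hyn : 0 < ‖(y : E)‖ ^ 2 := by
    have : (y : E) ≠ 0 := by simpa using hy0
    positivity
  have hz : ∀ i : Fin m, i < k → inner ℝ (b i) (y : E) = 0 := by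
    intro i hi
    have := congrFun (LinearMap.mem_ker.1 hy) ⟨i, hi⟩
    simpa [φ] using this
  have h1 : inner ℝ (M y) (y : E) ≤ s k * ‖(y : E)‖ ^ 2 := by
    rw [inner_apply_self_eq_sum b s hM hb, ← b.sum_sq_inner_right (y : E), Finset.mul_sum]
    refine Finset.sum_le_sum fun i _ => ?_
    rcases lt_or_ge i k with hi | hi
    · rw [hz i hi]; simp
    · exact mul_le_mul_of_nonneg_right (hs hi) (sq_nonneg _)
  have h2 := hPc y y.2
  have h3 : inner ℝ (P y - M y) (y : E) ≤ η * ‖(y : E)‖ ^ 2 := by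
    refine (real_inner_le_norm _ _).trans ?_
    rw [norm_sub_rev, sq, ← mul_assoc]
    exact mul_le_mul_of_nonneg_right (hMP _) (norm_nonneg _)
  rw [inner_sub_left] at h3
  have : (c - η) * ‖(y : E)‖ ^ 2 ≤ s k * ‖(y : E)‖ ^ 2 := by linarith
  exact le_of_mul_le_mul_right this hyn

/-- Upper Weyl inequality. -/
theorem eigenvalue_le_of_close {M P : E →ₗ[ℝ] E} (hM : M.IsSymmetric)
    (hb : ∀ k, M (b k) = s k • b k) (hs : Antitone s) {η : ℝ}
    (hMP : ∀ x, ‖M x - P x‖ ≤ η * ‖x‖)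
    (k : Fin m) (hk : Module.finrank ℝ (LinearMap.range P) ≤ k) : s k ≤ η := by
  -- The dual count: the first k + 1 eigenvectors span more dimensions than P has rank, so P kills a
  -- nonzero vector of their span, where the form of M is at least s k.
  let ψ : (Fin (k + 1) → ℝ) →ₗ[ℝ] E :=
    Fintype.linearCombination ℝ fun i : Fin (k + 1) => b ⟨i, by omega⟩
  let φ : (Fin (k + 1) → ℝ) →ₗ[ℝ] LinearMap.range P := P.rangeRestrict.comp ψ
  have hker : LinearMap.ker φ ≠ ⊥ := LinearMap.ker_ne_bot_of_finrank_lt (by simp; omega)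
  obtain ⟨a, ha, ha0⟩ := Submodule.exists_mem_ne_zero_of_ne_bot hker
  have hψ : ψ a = ∑ i : Fin (k + 1), a i • b ⟨i, by omega⟩ := by
    simp [ψ, Fintype.linearCombination_apply]
  have hin : ∀ i : Fin (k + 1), inner ℝ (b ⟨i, by omega⟩) (ψ a) = a i := by
    intro i
    rw [hψ, inner_sum, Finset.sum_eq_single i]
    · simp [inner_smul_right]
    · intro j _ hj
      rw [inner_smul_right, b.orthonormal.2, mul_zero]
      simpa [Fin.ext_iff] using fun h => hj (Fin.ext h.symm)
    · simp
  have hy0 : ψ a ≠ 0 := by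
    intro h0
    apply ha0
    ext i
    rw [← hin i, h0]; simp
  have hz : ∀ i : Fin m, k < i → inner ℝ (b i) (ψ a) = 0 := by
    intro i hi
    rw [hψ, inner_sum]
    refine Finset.sum_eq_zero fun j _ => ?_
    rw [inner_smul_right, b.orthonormal.2, mul_zero]
    intro h
    have := congrArg Fin.val h
    simp at this
    have h2 := j.2
    have : (k : ℕ) < i := hi
    omega
  have hPy : P (ψ a) = 0 := by
    have := congrArg Subtype.val (LinearMap.mem_ker.1 ha)
    simpa [φ] using this
  have hyn : 0 < ‖ψ a‖ ^ 2 := by positivity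
  have h1 : s k * ‖ψ a‖ ^ 2 ≤ inner ℝ (M (ψ a)) (ψ a) := by
    rw [inner_apply_self_eq_sum b s hM hb, ← b.sum_sq_inner_right (ψ a), Finset.mul_sum]
    refine Finset.sum_le_sum fun i _ => ?_
    rcases lt_or_ge k i with hi | hi
    · rw [hz i hi]; simp
    · exact mul_le_mul_of_nonneg_right (hs hi) (sq_nonneg _)
  have h3 : inner ℝ (M (ψ a)) (ψ a) ≤ η * ‖ψ a‖ ^ 2 := by
    refine (real_inner_le_norm _ _).trans ?_
    rw [sq, ← mul_assoc]
    refine mul_le_mul_of_nonneg_right ?_ (norm_nonneg _)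
    simpa [hPy] using hMP (ψ a)
  exact le_of_mul_le_mul_right (h1.trans h3) hyn

/-- The part of an operator with eigenbasis `b` and eigenvalues `s` that belongs to the first `d`
eigenvectors. -/
def topPart (d : ℕ) : E →ₗ[ℝ] E :=
  ∑ k : Fin m, (if (k : ℕ) < d then s k else 0) • (innerₛₗ ℝ (b k)).smulRight (b k)

theorem inner_topPart (d : ℕ) (k : Fin m) (x : E) :
    inner ℝ (b k) (topPart b s d x) = (if (k : ℕ) < d then s k else 0) * inner ℝ (b k) x := by
  rw [topPart, LinearMap.sum_apply, inner_sum, Finset.sum_eq_single k]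
  · rw [LinearMap.smul_apply, LinearMap.smulRight_apply]
    simp only [innerₛₗ_apply_apply, inner_smul_right, real_inner_self_eq_norm_sq,
      b.orthonormal.1 k]
    ring
  · intro j _ hj
    rw [LinearMap.smul_apply, LinearMap.smulRight_apply]
    simp only [inner_smul_right, b.orthonormal.2 hj.symm, mul_zero]
  · simp

theorem topPart_isSymmetric (d : ℕ) : (topPart b s d).IsSymmetric := by
  intro x y
  rw [← b.sum_inner_mul_inner, ← b.sum_inner_mul_inner x]
  refine Finset.sum_congr rfl fun k _ => ?_
  rw [inner_topPart, real_inner_comm, inner_topPart, real_inner_comm x]; ring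

theorem ext_inner_orthonormalBasis {x y : E} (h : ∀ k, inner ℝ (b k) x = inner ℝ (b k) y) :
    x = y := by
  apply b.repr.injective
  ext k
  simp [b.repr_apply_apply, h]

/-- Everything is diagonal in b: either side multiplies the k-th coordinate by s k ^ 3 for k < d and
by 0 otherwise. This gives access to the cube of the truncation at a vector f from M² f alone. -/
theorem topPart_apply_sq {M : E →ₗ[ℝ] E} (hM : M.IsSymmetric) (hb : ∀ k, M (b k) = s k • b k)
    (d : ℕ) (x : E) : topPart b s d (M (M x))
      = topPart b s d (topPart b s d (topPart b s d x)) := by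
  apply ext_inner_orthonormalBasis b
  intro k
  simp only [inner_topPart, inner_basis_apply b s hM hb]
  split_ifs <;> ring

theorem norm_sub_topPart_le {M : E →ₗ[ℝ] E} (hM : M.IsSymmetric)
    (hb : ∀ k, M (b k) = s k • b k) (hs0 : ∀ k, 0 ≤ s k) {d : ℕ} {η : ℝ} (hη : 0 ≤ η)
    (h : ∀ k : Fin m, d ≤ k → s k ≤ η) (x : E) : ‖M x - topPart b s d x‖ ≤ η * ‖x‖ := by
  have key : ‖M x - topPart b s d x‖ ^ 2 ≤ (η * ‖x‖) ^ 2 := by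
    rw [← b.sum_sq_inner_right, mul_pow, ← b.sum_sq_inner_right x, Finset.mul_sum]
    refine Finset.sum_le_sum fun k _ => ?_
    rw [inner_sub_right, inner_topPart, inner_basis_apply b s hM hb, ← sub_mul, mul_pow]
    refine mul_le_mul_of_nonneg_right ?_ (sq_nonneg _)
    split_ifs with hk
    · simpa using sq_nonneg η
    · rw [sub_zero]
      exact pow_le_pow_left₀ (hs0 k) (h k (not_lt.1 hk)) 2
  exact (pow_le_pow_iff_left₀ (norm_nonneg _) (by positivity) two_ne_zero).1 key

theorem le_norm_topPart {d : ℕ} {a : ℝ} (ha : 0 ≤ a) (h : ∀ k : Fin m, (k : ℕ) < d → a ≤ s k)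
    {x : E} (hx : x ∈ LinearMap.range (topPart b s d)) :
    a * ‖x‖ ≤ ‖topPart b s d x‖ := by
  obtain ⟨y, rfl⟩ := hx
  have key : (a * ‖topPart b s d y‖) ^ 2 ≤ ‖topPart b s d (topPart b s d y)‖ ^ 2 := by
    rw [← b.sum_sq_inner_right, mul_pow, ← b.sum_sq_inner_right (topPart b s d y),
      Finset.mul_sum]
    refine Finset.sum_le_sum fun k _ => ?_
    simp only [inner_topPart]
    split_ifs with hk
    · rw [mul_pow (s k) (s k * _)]
      exact mul_le_mul_of_nonneg_right (pow_le_pow_left₀ ha (h k hk) 2) (sq_nonneg _)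
    · simp
  exact (pow_le_pow_iff_left₀ (by positivity) (norm_nonneg _) two_ne_zero).1 key

/-- An operator that is bounded below on its range maps the range onto itself. -/
theorem exists_mem_range_apply_eq {N : E →ₗ[ℝ] E} {a : ℝ} (ha : 0 < a)
    (hN : ∀ x ∈ LinearMap.range N, a * ‖x‖ ≤ ‖N x‖) {y : E} (hy : y ∈ LinearMap.range N) :
    ∃ u ∈ LinearMap.range N, N u = y := by
  let f : LinearMap.range N →ₗ[ℝ] LinearMap.range N :=
    (N.comp (Submodule.subtype _)).codRestrict _ fun x => ⟨x, rfl⟩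
  have hf : Function.Injective f := by
    rw [← LinearMap.ker_eq_bot, LinearMap.ker_eq_bot']
    intro x hx
    have h0 : N x = 0 := congrArg Subtype.val hx
    have := hN x x.2
    rw [h0, norm_zero] at this
    have : ‖(x : E)‖ ≤ 0 := by
      by_contra hh
      push Not at hh
      nlinarith
    ext
    simpa using this
  obtain ⟨u, hu⟩ := LinearMap.surjective_of_injective hf ⟨y, hy⟩
  exact ⟨u, u.2, congrArg Subtype.val hu⟩

/-- Two close operators, both bounded below on their ranges, can be inverted approximately. -/
theorem norm_sub_le_of_apply_close {N P : E →ₗ[ℝ] E} {a e ε : ℝ} (ha : 0 < a) (ha1 : a ≤ 1)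
    (hε : 0 ≤ ε) (hε1 : ε ≤ 1)
    (hN : ∀ x ∈ LinearMap.range N, a * ‖x‖ ≤ ‖N x‖) (hP : ∀ x ∈ LinearMap.range P, a * ‖x‖ ≤ ‖P x‖)
    (hP1 : ∀ x, ‖P x‖ ≤ ‖x‖) (hNP : ∀ x, ‖N x - P x‖ ≤ ε * ‖x‖)
    {x y : E} (hx : x ∈ LinearMap.range N) (hy : y ∈ LinearMap.range P)
    (hxy : ‖N x - P y‖ ≤ e) : ‖x - y‖ ≤ e / a + 4 * ε * ‖y‖ / a ^ 2 := by
  -- The difference x - y need not lie in either range. With y = P u, the point N u lies in the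
  -- range of N and is close to y, so the lower bound for N can be applied to x - N u.
  obtain ⟨u, hu, rfl⟩ := exists_mem_range_apply_eq ha hP hy
  have hu1 : ‖u‖ ≤ ‖P u‖ / a := by
    rw [le_div_iff₀ ha, mul_comm]; exact hP u hu
  set Y := ‖P u‖ with hY
  have hY0 : 0 ≤ Y := norm_nonneg _
  have h1 : ‖N u - P u‖ ≤ ε * (Y / a) := (hNP u).trans (mul_le_mul_of_nonneg_left hu1 hε)
  have hN2 : ∀ z, ‖N z‖ ≤ 2 * ‖z‖ := by
    intro z
    calc ‖N z‖ = ‖(N z - P z) + P z‖ := by rw [sub_add_cancel]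
      _ ≤ ‖N z - P z‖ + ‖P z‖ := norm_add_le _ _
      _ ≤ ε * ‖z‖ + ‖z‖ := add_le_add (hNP z) (hP1 z)
      _ ≤ 2 * ‖z‖ := by nlinarith [norm_nonneg z]
  have h2 : ‖N (x - N u)‖ ≤ e + ε * Y + 2 * (ε * (Y / a)) := by
    have : N (x - N u) = (N x - P (P u)) - (N (P u) - P (P u)) - N (N u - P u) := by
      simp only [map_sub]; abel
    rw [this]
    refine (norm_sub_le _ _).trans (add_le_add ((norm_sub_le _ _).trans
      (add_le_add hxy (hNP _))) ((hN2 _).trans (by linarith)))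
  have h3 := hN (x - N u) (Submodule.sub_mem _ hx ⟨u, rfl⟩)
  have hYa : Y ≤ Y / a := by rw [le_div_iff₀ ha]; nlinarith
  have h4 : ‖x - N u‖ ≤ (e + 3 * (ε * (Y / a))) / a := by
    rw [le_div_iff₀ ha, mul_comm]
    have : ε * Y ≤ ε * (Y / a) := mul_le_mul_of_nonneg_left hYa hε
    linarith
  have hYa2 : Y / a ≤ Y / a / a := by
    rw [le_div_iff₀ ha]; nlinarith [div_nonneg hY0 ha.le]
  calc ‖x - P u‖ ≤ ‖x - N u‖ + ‖N u - P u‖ := norm_sub_le_norm_sub_add_norm_sub _ _ _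
    _ ≤ (e + 3 * (ε * (Y / a))) / a + ε * (Y / a / a) :=
      add_le_add h4 (h1.trans (mul_le_mul_of_nonneg_left hYa2 hε))
    _ = e / a + 4 * ε * Y / a ^ 2 := by field_simp; ring

/-- Entrywise perturbation bound for a truncation `N`, where `f` and `g` are vectors that need not
be bounded but become so after applying the operators once. -/
theorem abs_inner_sub_le_of_close {N P B : E →ₗ[ℝ] E} {a η : ℝ} (ha : 0 < a) (ha1 : a ≤ 1)
    (hη : 0 ≤ η) (hη1 : 2 * η ≤ 1) (hNs : N.IsSymmetric) (hPs : P.IsSymmetric)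
    (hN : ∀ x ∈ LinearMap.range N, a * ‖x‖ ≤ ‖N x‖) (hP : ∀ x ∈ LinearMap.range P, a * ‖x‖ ≤ ‖P x‖)
    (hP1 : ∀ x, ‖P x‖ ≤ ‖x‖) (hNP : ∀ x, ‖N x - P x‖ ≤ 2 * η * ‖x‖)
    (hNB : ∀ x, N (B x) = N (N (N x))) {f g : E}
    (hBf : ‖B f‖ ≤ 1) (hPf : ‖P f‖ ≤ 1) (hf : ‖B f - P (P f)‖ ≤ η)
    (hBg : ‖B g‖ ≤ 1) (hPg : ‖P g‖ ≤ 1) (hg : ‖B g - P (P g)‖ ≤ η) :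
    |inner ℝ f (N g) - inner ℝ f (P g)| ≤ 600 * η / a ^ 7 := by
  have ha0 := ha.le
  have hpow : ∀ i j : ℕ, i ≤ j → η / a ^ i ≤ η / a ^ j := fun i j hij =>
    div_le_div_of_nonneg_left hη (pow_pos ha _) (pow_le_pow_of_le_one ha0 ha1 hij)
  -- The cube N³ h = N (B h) is compared with P³ h; two approximate inversions then remove two
  -- powers, each at the cost of a factor depending only on a.
  have main : ∀ h : E, ‖B h‖ ≤ 1 → ‖P h‖ ≤ 1 → ‖B h - P (P h)‖ ≤ η →
      ‖N h - P h‖ ≤ 19 * η / a ^ 3 := by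
    intro h hB hPh hh
    have s1 : ‖N (N (N h)) - P (P (P h))‖ ≤ 3 * η := by
      have : N (N (N h)) - P (P (P h)) = (N (B h) - P (B h)) + P (B h - P (P h)) := by
        rw [hNB, map_sub]; abel
      rw [this]
      refine (norm_add_le _ _).trans ?_
      have i1 := hNP (B h)
      have i2 := hP1 (B h - P (P h))
      nlinarith
    have s2 := norm_sub_le_of_apply_close ha ha1 (by positivity) hη1 hN hP hP1 hNP
      (x := N (N h)) (y := P (P h)) ⟨_, rfl⟩ ⟨_, rfl⟩ s1
    have hPP : ‖P (P h)‖ ≤ 1 := (hP1 _).trans hPh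
    have s2' : ‖N (N h) - P (P h)‖ ≤ 11 * (η / a ^ 2) := by
      refine s2.trans ?_
      have := hpow 1 2 (by norm_num)
      have e1 : 4 * (2 * η) * ‖P (P h)‖ / a ^ 2 ≤ 8 * (η / a ^ 2) := by
        rw [mul_div_assoc', div_le_div_iff_of_pos_right (by positivity)]
        nlinarith
      have e2 : 3 * η / a = 3 * (η / a ^ 1) := by rw [pow_one]; ring
      linarith
    have s3 := norm_sub_le_of_apply_close ha ha1 (by positivity) hη1 hN hP hP1 hNP
      (x := N h) (y := P h) ⟨_, rfl⟩ ⟨_, rfl⟩ s2'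
    refine s3.trans ?_
    have := hpow 2 3 (by norm_num)
    have e1 : 4 * (2 * η) * ‖P h‖ / a ^ 2 ≤ 8 * (η / a ^ 2) := by
      rw [mul_div_assoc', div_le_div_iff_of_pos_right (by positivity)]
      nlinarith
    have e2 : 11 * (η / a ^ 2) / a = 11 * (η / a ^ 3) := by field_simp
    have e3 : 19 * η / a ^ 3 = 19 * (η / a ^ 3) := by ring
    linarith
  -- Cauchy-Schwarz against f itself would be useless, as f has no norm bound. Writing N g = N z and
  -- P g = P w with bounded preimages z and w lets symmetry move the operators onto f.
  obtain ⟨w, hw, hPw⟩ := exists_mem_range_apply_eq ha hP (y := P g) ⟨g, rfl⟩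
  obtain ⟨z, hz, hNz⟩ := exists_mem_range_apply_eq ha hN (y := N g) ⟨g, rfl⟩
  have hw1 : ‖w‖ ≤ 1 / a := by
    rw [le_div_iff₀ ha, mul_comm]
    exact (hP w hw).trans (hPw ▸ hPg)
  have s4 : ‖N z - P w‖ ≤ 19 * η / a ^ 3 := by rw [hNz, hPw]; exact main g hBg hPg hg
  have s5 := norm_sub_le_of_apply_close ha ha1 (by positivity) hη1 hN hP hP1 hNP hz hw s4
  have s5' : ‖z - w‖ ≤ 27 * (η / a ^ 4) := by
    refine s5.trans ?_
    have e1 : 4 * (2 * η) * ‖w‖ / a ^ 2 ≤ 8 * (η / a ^ 3) := by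
      calc 4 * (2 * η) * ‖w‖ / a ^ 2 ≤ 4 * (2 * η) * (1 / a) / a ^ 2 := by gcongr
        _ = _ := by field_simp; ring
    have e2 : 19 * η / a ^ 3 / a = 19 * (η / a ^ 4) := by field_simp
    have := hpow 3 4 (by norm_num)
    linarith
  have hz1 : ‖z‖ ≤ 28 / a ^ 4 := by
    have e1 : ‖z‖ ≤ ‖z - w‖ + ‖w‖ := by
      simpa using norm_add_le (z - w) w
    have e2 : 27 * (η / a ^ 4) ≤ 27 / a ^ 4 := by
      rw [mul_div_assoc', div_le_div_iff_of_pos_right (by positivity)]; linarith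
    have e3 : 1 / a ≤ 1 / a ^ 4 := by
      refine div_le_div_of_nonneg_left zero_le_one (by positivity) ?_
      simpa using pow_le_pow_of_le_one ha0 ha1 (show 1 ≤ 4 by norm_num)
    have e4 : (28 : ℝ) / a ^ 4 = 27 / a ^ 4 + 1 / a ^ 4 := by ring
    linarith
  have e : inner ℝ f (N g) - inner ℝ f (P g) = inner ℝ (N f - P f) z + inner ℝ (P f) (z - w) := by
    rw [← hNz, ← hPw, ← hNs f z, ← hPs f w, inner_sub_left, inner_sub_right]; ring
  rw [e]
  refine (abs_add_le _ _).trans ?_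
  have t1 : |inner ℝ (N f - P f) z| ≤ 19 * η / a ^ 3 * (28 / a ^ 4) :=
    (abs_real_inner_le_norm _ _).trans (mul_le_mul (main f hBf hPf hf) hz1 (norm_nonneg _)
      (by positivity))
  have t2 : |inner ℝ (P f) (z - w)| ≤ 1 * (27 * (η / a ^ 4)) :=
    (abs_real_inner_le_norm _ _).trans (mul_le_mul hPf s5' (norm_nonneg _) zero_le_one)
  -- The total is 532 + 27 = 559, which is rounded up to 600.
  have e1 : 19 * η / a ^ 3 * (28 / a ^ 4) = 532 * (η / a ^ 7) := by field_simp; ring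
  have e2 : 600 * η / a ^ 7 = 600 * (η / a ^ 7) := by ring
  have e3 := hpow 4 7 (by norm_num)
  have e4 : 0 ≤ η / a ^ 7 := by positivity
  linarith

/-- Perturbation bound for the truncation of `M` at the rank of `P`, when `M ^ 2` is close to
`P ^ 2`. -/
theorem abs_inner_topPart_sub_le {M P : E →ₗ[ℝ] E} (hM : M.IsSymmetric) (hPs : P.IsSymmetric)
    (hM0 : ∀ x, 0 ≤ inner ℝ (M x) x) (hP0 : ∀ x, 0 ≤ inner ℝ (P x) x)
    (hb : ∀ k, M (b k) = s k • b k) (hs : Antitone s) {η c : ℝ}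
    (hc : 0 < c) (hc1 : c ≤ 1) (hη : 0 ≤ η) (hηc : 2 * η ≤ c)
    (h : ∀ x, |‖M x‖ ^ 2 - ‖P x‖ ^ 2| ≤ η ^ 2 * ‖x‖ ^ 2)
    (hPc : ∀ y ∈ LinearMap.range P, c * ‖y‖ ^ 2 ≤ inner ℝ (P y) y) (hP1 : ∀ x, ‖P x‖ ≤ ‖x‖)
    {f g : E}
    (hBf : ‖M (M f)‖ ≤ 1) (hPf : ‖P f‖ ≤ 1) (hf : ‖M (M f) - P (P f)‖ ≤ η)
    (hBg : ‖M (M g)‖ ≤ 1) (hPg : ‖P g‖ ≤ 1) (hg : ‖M (M g) - P (P g)‖ ≤ η) :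
    |inner ℝ f (topPart b s (Module.finrank ℝ (LinearMap.range P)) g) - inner ℝ f (P g)|
      ≤ 600 * η / (c / 2) ^ 7 := by
  have hMP := norm_sub_le_of_sq_close hM hPs hM0 hP0 hη h
  have hs0 : ∀ k, 0 ≤ s k := by
    intro k
    have := hM0 (b k)
    rw [hb, inner_smul_left, real_inner_self_eq_norm_sq, b.orthonormal.1 k] at this
    simpa using this
  -- Weyl gives c - η, and 2 η ≤ c turns this into c / 2, the common lower bound on both ranges.
  have hlow : ∀ k : Fin m, (k : ℕ) < Module.finrank ℝ (LinearMap.range P) → c / 2 ≤ s k :=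
    fun k hk => le_trans (by linarith) (le_eigenvalue_of_close b s hM hb hs hMP hPc k hk)
  have hup : ∀ k : Fin m, Module.finrank ℝ (LinearMap.range P) ≤ k → s k ≤ η :=
    fun k hk => eigenvalue_le_of_close b s hM hb hs hMP k hk
  refine abs_inner_sub_le_of_close (B := M ∘ₗ M) (by positivity) (by linarith) hη (by linarith)
    (topPart_isSymmetric b s _) hPs (fun x hx => le_norm_topPart b s (by positivity) hlow hx)
    ?_ hP1 ?_ (fun x => topPart_apply_sq b s hM hb _ x) hBf hPf hf hBg hPg hg
  · intro x hx
    have h1 := hPc x hx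
    have h2 := real_inner_le_norm (P x) x
    rcases (norm_nonneg x).eq_or_lt with h0 | h0
    · rw [← h0]; simp
    · have : c * ‖x‖ * ‖x‖ ≤ ‖P x‖ * ‖x‖ := by nlinarith
      have := le_of_mul_le_mul_right this h0
      nlinarith
  · intro x
    have h1 := norm_sub_topPart_le b s hM hb hs0 hη hup x
    rw [norm_sub_rev] at h1
    calc _ ≤ _ := norm_sub_le_norm_sub_add_norm_sub _ (M x) _
      _ ≤ η * ‖x‖ + η * ‖x‖ := add_le_add h1 (hMP x)
      _ = _ := by ring

end SpectralPerturbation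

/-! ### Gram matrices and entrywise consistency of the adjacency spectral embedding. -/

section Gram

variable {V : Type*} [Fintype V]

theorem toEuclideanLin_apply_coord (Q : Matrix V V ℝ) (x : EuclideanSpace ℝ V) (u : V) :
    Matrix.toEuclideanLin Q x u = ∑ v, Q u v * x v := by
  simp [Matrix.toLpLin_apply, Matrix.mulVec, dotProduct]

theorem toEuclideanLin_mul_apply (Q R : Matrix V V ℝ) (x : EuclideanSpace ℝ V) :
    Matrix.toEuclideanLin (Q * R) x = Matrix.toEuclideanLin Q (Matrix.toEuclideanLin R x) := by
  simp [Matrix.toLpLin_apply]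

theorem norm_sq_toEuclideanLin {Q : Matrix V V ℝ} (hQ : (Matrix.toEuclideanLin Q).IsSymmetric)
    (x : EuclideanSpace ℝ V) :
    ‖Matrix.toEuclideanLin Q x‖ ^ 2 = ∑ u, ∑ v, (Q * Q) u v * x v * x u := by
  rw [← real_inner_self_eq_norm_sq, ← hQ, ← toEuclideanLin_mul_apply, PiLp.inner_apply]
  refine Finset.sum_congr rfl fun u _ => ?_
  rw [toEuclideanLin_apply_coord]
  simp [Finset.mul_sum, mul_comm, mul_left_comm]

theorem toEuclideanLin_single (Q : Matrix V V ℝ) (r : ℝ) (v u : V) :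
    Matrix.toEuclideanLin Q (EuclideanSpace.single v r) u = Q u v * r := by
  rw [toEuclideanLin_apply_coord, Finset.sum_eq_single v]
  · simp
  · intro w _ hw; simp [hw]
  · simp

/-- A quadratic form whose matrix has small off-diagonal and moderate diagonal entries is small. -/
theorem abs_quadratic_le {Q : Matrix V V ℝ} {n : ℕ} (hn : 0 < n) (hV : Fintype.card V ≤ n)
    {ε : ℝ} (hε : 0 ≤ ε) (hQ : ∀ u v, |Q u v| ≤ ε / n + if u = v then 1 / (n : ℝ) else 0)
    (x : EuclideanSpace ℝ V) :
    |∑ u, ∑ v, Q u v * x v * x u| ≤ (ε + 1 / n) * ‖x‖ ^ 2 := by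
  have hn' : (0 : ℝ) < n := by exact_mod_cast hn
  have hx : ‖x‖ ^ 2 = ∑ u, x u ^ 2 := by simp [EuclideanSpace.norm_sq_eq]
  have h1 : |∑ u, ∑ v, Q u v * x v * x u|
      ≤ ∑ u, ∑ v, (ε / n * (|x u| * |x v|) + if u = v then 1 / (n : ℝ) * x u ^ 2 else 0) := by
    refine (Finset.abs_sum_le_sum_abs _ _).trans (Finset.sum_le_sum fun u _ => ?_)
    refine (Finset.abs_sum_le_sum_abs _ _).trans (Finset.sum_le_sum fun v _ => ?_)
    rw [abs_mul, abs_mul, mul_assoc]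
    refine (mul_le_mul_of_nonneg_right (hQ u v) (by positivity)).trans (le_of_eq ?_)
    by_cases huv : u = v
    · subst huv
      simp only [if_true]
      rw [← sq_abs]; ring
    · simp only [huv, if_false]; ring
  refine h1.trans ?_
  simp only [Finset.sum_add_distrib, Finset.sum_ite_eq, Finset.mem_univ, if_true]
  rw [add_mul, hx, Finset.mul_sum (a := 1 / (n : ℝ))]
  refine add_le_add ?_ le_rfl
  have h2 : ∑ u, ∑ v, ε / n * (|x u| * |x v|) = ε / n * (∑ u, |x u|) ^ 2 := by
    rw [sq, Finset.sum_mul_sum, Finset.mul_sum]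
    exact Finset.sum_congr rfl fun u _ => by rw [Finset.mul_sum]
  have h3 : (∑ u, |x u|) ^ 2 ≤ n * ∑ u, x u ^ 2 := by
    have := sq_sum_le_card_mul_sum_sq (s := Finset.univ) (f := fun u => |x u|)
    simp only [sq_abs, Finset.card_univ] at this
    refine this.trans (mul_le_mul_of_nonneg_right (by exact_mod_cast hV) ?_)
    exact Finset.sum_nonneg fun _ _ => sq_nonneg _
  rw [h2]
  calc ε / n * (∑ u, |x u|) ^ 2 ≤ ε / n * (n * ∑ u, x u ^ 2) :=
        mul_le_mul_of_nonneg_left h3 (by positivity)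
    _ = _ := by field_simp

/-- The Gram matrix of the rows of U S^{1/2} is U S Uᵀ, the truncation of M; dividing the
eigenvalues by n is undone by the two factors √n. Zero columns contribute nothing, so d may exceed
the number of vertices. -/
theorem inner_ase_eq {d : ℕ} (b : OrthonormalBasis (Fin (Fintype.card V)) ℝ (EuclideanSpace ℝ V))
    (s : Fin (Fintype.card V) → ℝ) (hs : ∀ k, 0 ≤ s k) {Xh : V → Euc d}
    (hXh : ∀ v (j : Fin d), Xh v j =
      if h : (j : ℕ) < Fintype.card V then Real.sqrt (s ⟨j, h⟩) * b ⟨j, h⟩ v else 0)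
    (u v : V) {n : ℕ} (hn : 0 < n) :
    inner ℝ (Xh u) (Xh v) = inner ℝ (EuclideanSpace.single u (Real.sqrt n))
      (topPart b (fun k => (n : ℝ)⁻¹ * s k) d (EuclideanSpace.single v (Real.sqrt n))) := by
  have hn' : (0 : ℝ) < n := by exact_mod_cast hn
  set G : ℕ → ℝ := fun i => if h : i < Fintype.card V then s ⟨i, h⟩ * b ⟨i, h⟩ u * b ⟨i, h⟩ v else 0
    with hG
  have hL : inner ℝ (Xh u) (Xh v) = ∑ i ∈ Finset.range d, G i := by
    rw [← Fin.sum_univ_eq_sum_range G d, PiLp.inner_apply]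
    refine Finset.sum_congr rfl fun j _ => ?_
    rw [hXh, hXh, hG]
    by_cases h : (j : ℕ) < Fintype.card V
    · simp only [h, dif_pos]
      have := Real.mul_self_sqrt (hs ⟨j, h⟩)
      simp only [RCLike.inner_apply, conj_trivial]
      calc _ = (√(s ⟨j, h⟩) * √(s ⟨j, h⟩)) * b ⟨j, h⟩ u * b ⟨j, h⟩ v := by ring
        _ = _ := by rw [this]
    · simp [h]
  have hR : inner ℝ (EuclideanSpace.single u (Real.sqrt n))
      (topPart b (fun k => (n : ℝ)⁻¹ * s k) d (EuclideanSpace.single v (Real.sqrt n)))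
      = ∑ i ∈ Finset.range (Fintype.card V), if i < d then G i else 0 := by
    rw [← Fin.sum_univ_eq_sum_range (fun i => if i < d then G i else 0), ← b.sum_inner_mul_inner]
    refine Finset.sum_congr rfl fun k _ => ?_
    rw [inner_topPart]
    simp only [EuclideanSpace.inner_single_left, EuclideanSpace.inner_single_right, conj_trivial, hG,
      k.2, dif_pos]
    split_ifs
    · have : √(n : ℝ) * √(n : ℝ) = n := Real.mul_self_sqrt hn'.le
      calc _ = (√(n : ℝ) * √(n : ℝ)) * (n : ℝ)⁻¹ * (s k * b k u * b k v) := by ring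
        _ = _ := by rw [this]; field_simp
    · simp
  rw [hL, hR, ← Finset.sum_filter]
  symm
  apply Finset.sum_subset
  · intro i hi
    simp only [Finset.mem_filter, Finset.mem_range] at hi ⊢
    exact hi.2
  · intro i hi hi'
    simp only [Finset.mem_filter, Finset.mem_range] at hi hi'
    have : ¬ i < Fintype.card V := fun h => hi' ⟨h, hi⟩
    simp [hG, this]

variable {D : ℕ}

/-- The Gram matrix of a point cloud. -/
def gramMatrix (X : V → Euc D) : Matrix V V ℝ := fun u v => inner ℝ (X u) (X v)

theorem toEuclideanLin_gramMatrix (X : V → Euc D) (x : EuclideanSpace ℝ V) (u : V) :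
    Matrix.toEuclideanLin (gramMatrix X) x u = inner ℝ (X u) (∑ v, x v • X v) := by
  rw [toEuclideanLin_apply_coord, inner_sum]
  exact Finset.sum_congr rfl fun v _ => by rw [inner_smul_right, gramMatrix, mul_comm]

theorem inner_toEuclideanLin_gramMatrix (X : V → Euc D) (x y : EuclideanSpace ℝ V) :
    inner ℝ (Matrix.toEuclideanLin (gramMatrix X) x) y
      = inner ℝ (∑ v, x v • X v) (∑ v, y v • X v) := by
  rw [PiLp.inner_apply, inner_sum]
  refine Finset.sum_congr rfl fun u _ => ?_
  rw [toEuclideanLin_gramMatrix, inner_smul_right, real_inner_comm (X u)]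
  simp

/-- The Gram matrix is TᵀT for T x = ∑ x v • X v, so it has the kernel, and therefore the rank, of
T. -/
theorem finrank_range_gramMatrix (X : V → Euc D) {r : ℝ} (hr : r ≠ 0) :
    Module.finrank ℝ (LinearMap.range (Matrix.toEuclideanLin (r • gramMatrix X)))
      = Module.finrank ℝ (Submodule.span ℝ (Set.range X)) := by
  let T : EuclideanSpace ℝ V →ₗ[ℝ] Euc D :=
    (Fintype.linearCombination ℝ X).comp (WithLp.linearEquiv 2 ℝ (V → ℝ)).toLinearMap
  have hT : ∀ x, T x = ∑ v, x v • X v := fun x => by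
    simp [T, Fintype.linearCombination_apply]
  have hTr : LinearMap.range T = Submodule.span ℝ (Set.range X) := by
    rw [← Fintype.range_linearCombination, LinearMap.range_comp_of_range_eq_top]
    exact LinearEquiv.range _
  have hker : LinearMap.ker (Matrix.toEuclideanLin (r • gramMatrix X)) = LinearMap.ker T := by
    ext x
    rw [LinearMap.mem_ker, LinearMap.mem_ker, map_smul, LinearMap.smul_apply, smul_eq_zero,
      or_iff_right hr]
    constructor
    · intro h
      have := inner_toEuclideanLin_gramMatrix X x x
      rw [h, inner_zero_left, ← hT] at this
      exact inner_self_eq_zero.1 this.symm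
    · intro h
      ext u
      rw [toEuclideanLin_gramMatrix, ← hT, h]; simp
  have h1 := LinearMap.finrank_range_add_finrank_ker (Matrix.toEuclideanLin (r • gramMatrix X))
  have h2 := LinearMap.finrank_range_add_finrank_ker T
  rw [hker] at h1
  rw [hTr] at h2
  omega

/-- Entrywise consistency of the adjacency spectral embedding: if the codegrees of the graph are
close to those of the latent Gram matrix, then the inner products of the rows of the embedding are
close to those of the latent positions. -/
theorem abs_inner_ase_sub_le {n d : ℕ} (hn : 0 < n) (hV : Fintype.card V ≤ n)
    {A : Matrix V V ℝ} {X : V → Euc D} {Xh : V → Euc d} (hA : IsASE A Xh)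
    (h01 : ∀ u v, inner ℝ (X u) (X v) ∈ Set.Icc (0 : ℝ) 1)
    (hd : d = Module.finrank ℝ (Submodule.span ℝ (Set.range X)))
    {c : ℝ} (hc : 0 < c) (hc1 : c ≤ 1)
    (hcoer : ∀ x ∈ Submodule.span ℝ (Set.range X),
      c * n * ‖x‖ ^ 2 ≤ ∑ v, inner ℝ (X v) x ^ 2)
    (hAA : ∀ u v, (A.transpose * A) u v ∈ Set.Icc (0 : ℝ) n) {ε η : ℝ} (hε : 0 ≤ ε) (hε1 : ε ≤ 1)
    (hoff : ∀ u v, u ≠ v →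
      |(A.transpose * A) u v - ∑ w, inner ℝ (X u) (X w) * inner ℝ (X w) (X v)| ≤ ε * n)
    (hη : 0 ≤ η) (hη2 : ε + 1 / n ≤ η ^ 2) (hηc : 2 * η ≤ c) (u v : V) :
    |inner ℝ (Xh u) (Xh v) - inner ℝ (X u) (X v)| ≤ 600 * η / (c / 2) ^ 7 := by
  obtain ⟨M, hM, hMM, b, s, hs, hb, hXh⟩ := hA
  have hn' : (0 : ℝ) < n := by exact_mod_cast hn
  have hV' : (Fintype.card V : ℝ) ≤ n := by exact_mod_cast hV
  have hsn : √(n : ℝ) * √(n : ℝ) = n := Real.mul_self_sqrt hn'.le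
  set M' := Matrix.toEuclideanLin ((n : ℝ)⁻¹ • M) with hM'
  set P' := Matrix.toEuclideanLin ((n : ℝ)⁻¹ • gramMatrix X) with hP'
  have hMpos : M'.IsPositive := Matrix.isPositive_toEuclideanLin_iff.2 (hM.smul (by positivity))
  have hPs : P'.IsSymmetric := by
    rw [hP', ← Matrix.isSymmetric_toEuclideanLin_iff.symm]
    ext i j
    simp [gramMatrix, real_inner_comm]
  have hPin : ∀ x y, inner ℝ (P' x) y
      = (n : ℝ)⁻¹ * inner ℝ (∑ v, x v • X v) (∑ v, y v • X v) := by
    intro x y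
    rw [hP', map_smul, LinearMap.smul_apply, inner_smul_left, inner_toEuclideanLin_gramMatrix]
    simp
  have hb' : ∀ k, M' (b k) = ((n : ℝ)⁻¹ * s k) • b k := by
    intro k
    rw [hM', map_smul, LinearMap.smul_apply, mul_smul]
    congr 1
    ext w
    rw [toEuclideanLin_apply_coord]
    exact hb k w
  have hs0 : ∀ k, 0 ≤ s k := by
    intro k
    have := hMpos.2 (b k)
    rw [hb', inner_smul_left, real_inner_self_eq_norm_sq, b.orthonormal.1 k] at this
    have h2 : 0 ≤ (n : ℝ)⁻¹ * s k := by simpa using this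
    exact nonneg_of_mul_nonneg_right h2 (by positivity)
  have hQM : ((n : ℝ)⁻¹ • M) * ((n : ℝ)⁻¹ • M) = ((n : ℝ) ^ 2)⁻¹ • (A.transpose * A) := by
    rw [smul_mul_smul_comm, hMM]; congr 1; field_simp
  have hQP : ((n : ℝ)⁻¹ • gramMatrix X) * ((n : ℝ)⁻¹ • gramMatrix X)
      = ((n : ℝ) ^ 2)⁻¹ • (gramMatrix X * gramMatrix X) := by
    rw [smul_mul_smul_comm]; congr 1; field_simp
  have hGG : ∀ u v, (gramMatrix X * gramMatrix X) u v ∈ Set.Icc (0 : ℝ) n := by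
    intro u v
    rw [Matrix.mul_apply]
    constructor
    · exact Finset.sum_nonneg fun w _ => mul_nonneg (h01 _ _).1 (h01 _ _).1
    · refine le_trans (Finset.sum_le_sum (g := fun _ => (1 : ℝ)) fun w _ =>
        mul_le_one₀ (h01 _ _).2 (h01 _ _).1 (h01 _ _).2) ?_
      simpa using hV'
  -- The difference of the normalised squares. Its diagonal need not be small relative to 1 / n:
  -- codegrees of a vertex with itself are degrees, and only the trivial bound n is used for them.
  set Q : Matrix V V ℝ := ((n : ℝ) ^ 2)⁻¹ • (A.transpose * A - gramMatrix X * gramMatrix X) with hQ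
  have hQle : ∀ u v, |Q u v| ≤ ε / n + if u = v then 1 / (n : ℝ) else 0 := by
    intro u v
    have e : Q u v = ((n : ℝ) ^ 2)⁻¹ * ((A.transpose * A) u v - (gramMatrix X * gramMatrix X) u v) :=
      rfl
    rw [e, abs_mul, abs_of_nonneg (by positivity)]
    by_cases huv : u = v
    · simp only [huv, if_true]
      have h1 := hAA v v
      have h2 := hGG v v
      have h3 : |(A.transpose * A) v v - (gramMatrix X * gramMatrix X) v v| ≤ n := by
        rw [abs_le]; constructor <;> linarith [h1.1, h1.2, h2.1, h2.2]
      calc _ ≤ ((n : ℝ) ^ 2)⁻¹ * n := mul_le_mul_of_nonneg_left h3 (by positivity)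
        _ = 1 / n := by field_simp
        _ ≤ _ := le_add_of_nonneg_left (by positivity)
    · simp only [huv, if_false, add_zero]
      calc _ ≤ ((n : ℝ) ^ 2)⁻¹ * (ε * n) := by
            refine mul_le_mul_of_nonneg_left ?_ (by positivity)
            rw [Matrix.mul_apply (M := gramMatrix X)]
            exact hoff u v huv
        _ = _ := by field_simp
  have hMMx : ∀ x, M' (M' x) = Matrix.toEuclideanLin (((n : ℝ) ^ 2)⁻¹ • (A.transpose * A)) x := by
    intro x; rw [hM', ← toEuclideanLin_mul_apply, hQM]
  have hPPx : ∀ x, P' (P' x)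
      = Matrix.toEuclideanLin (((n : ℝ) ^ 2)⁻¹ • (gramMatrix X * gramMatrix X)) x := by
    intro x; rw [hP', ← toEuclideanLin_mul_apply, hQP]
  -- With this scaling the form of P' at f u and f v is exactly the latent inner product.
  set f : V → EuclideanSpace ℝ V := fun v => EuclideanSpace.single v (√(n : ℝ)) with hf
  have sq_le : ∀ {x : EuclideanSpace ℝ V} {r : ℝ}, 0 ≤ r → ∑ u, x u ^ 2 ≤ r ^ 2 → ‖x‖ ≤ r := by
    intro x r hr h
    rw [← pow_le_pow_iff_left₀ (norm_nonneg _) hr two_ne_zero, EuclideanSpace.norm_sq_eq]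
    simpa using h
  have hBf : ∀ v, ‖M' (M' (f v))‖ ≤ 1 := by
    intro v
    refine sq_le zero_le_one ?_
    calc ∑ u, (M' (M' (f v))) u ^ 2 ≤ ∑ u : V, (1 / n : ℝ) := by
          refine Finset.sum_le_sum fun u _ => ?_
          rw [hMMx, hf, toEuclideanLin_single, mul_pow, sq √(n : ℝ), hsn, Matrix.smul_apply,
            smul_eq_mul, mul_pow]
          have h1 : (A.transpose * A) u v ^ 2 ≤ (n : ℝ) ^ 2 :=
            pow_le_pow_left₀ (hAA u v).1 (hAA u v).2 2
          calc _ ≤ (((n : ℝ) ^ 2)⁻¹) ^ 2 * (n : ℝ) ^ 2 * n := by gcongr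
            _ = _ := by field_simp
      _ ≤ 1 ^ 2 := by
          simp only [Finset.sum_const, Finset.card_univ, nsmul_eq_mul, one_pow]
          rw [mul_one_div, div_le_one hn']; exact hV'
  have hPf : ∀ v, ‖P' (f v)‖ ≤ 1 := by
    intro v
    refine sq_le zero_le_one ?_
    calc ∑ u, (P' (f v)) u ^ 2 ≤ ∑ u : V, (1 / n : ℝ) := by
          refine Finset.sum_le_sum fun u _ => ?_
          rw [hP', hf, toEuclideanLin_single, mul_pow, sq √(n : ℝ), hsn, Matrix.smul_apply,
            smul_eq_mul, mul_pow]
          have h1 : gramMatrix X u v ^ 2 ≤ (1 : ℝ) ^ 2 :=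
            pow_le_pow_left₀ (h01 u v).1 (h01 u v).2 2
          calc _ ≤ ((n : ℝ)⁻¹) ^ 2 * 1 ^ 2 * n := by gcongr
            _ = _ := by field_simp
      _ ≤ 1 ^ 2 := by
          simp only [Finset.sum_const, Finset.card_univ, nsmul_eq_mul, one_pow]
          rw [mul_one_div, div_le_one hn']; exact hV'
  have hff : ∀ v, ‖M' (M' (f v)) - P' (P' (f v))‖ ≤ η := by
    intro v
    refine sq_le hη ?_
    calc ∑ u, (M' (M' (f v)) - P' (P' (f v))) u ^ 2
        ≤ ∑ u : V, (ε / n + if u = v then 1 / (n : ℝ) else 0) := by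
          refine Finset.sum_le_sum fun u _ => ?_
          have e : M' (M' (f v)) - P' (P' (f v)) = Matrix.toEuclideanLin Q (f v) := by
            rw [hMMx, hPPx, ← LinearMap.sub_apply, ← map_sub, ← smul_sub]
          rw [e, hf, toEuclideanLin_single, mul_pow, sq √(n : ℝ), hsn, ← sq_abs]
          have h1 := hQle u v
          set r := ε / n + if u = v then 1 / (n : ℝ) else 0 with hr
          have hQ1 : |Q u v| ≤ 1 / n := by
            by_cases huv : u = v
            · subst huv
              rw [hQ, Matrix.smul_apply, Matrix.sub_apply, smul_eq_mul, abs_mul,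
                abs_of_nonneg (by positivity)]
              have h1 := hAA u u
              have h2 := hGG u u
              have h3 : |(A.transpose * A) u u - (gramMatrix X * gramMatrix X) u u| ≤ n := by
                rw [abs_le]; constructor <;> linarith [h1.1, h1.2, h2.1, h2.2]
              calc _ ≤ ((n : ℝ) ^ 2)⁻¹ * n := mul_le_mul_of_nonneg_left h3 (by positivity)
                _ = 1 / n := by field_simp
            · refine h1.trans ?_
              simp only [hr, huv, if_false, add_zero]
              gcongr
          -- One factor is estimated by r and the other by 1 / n, which absorbs the n from the
          -- squared norm of f v; summing r over a column is then affordable.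
          calc |Q u v| ^ 2 * n = |Q u v| * |Q u v| * n := by ring
            _ ≤ r * (1 / n) * n := by gcongr
            _ = r := by field_simp
      _ ≤ η ^ 2 := by
          rw [Finset.sum_add_distrib]
          simp only [Finset.sum_const, Finset.card_univ, nsmul_eq_mul, Finset.sum_ite_eq',
            Finset.mem_univ, if_true]
          refine le_trans (add_le_add ?_ le_rfl) hη2
          calc (Fintype.card V : ℝ) * (ε / n) ≤ n * (ε / n) := by gcongr
            _ = ε := by field_simp
  have key := abs_inner_topPart_sub_le b (fun k => (n : ℝ)⁻¹ * s k) hMpos.1 hPs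
    (fun x => hMpos.2 x) (fun x => by rw [hPin, real_inner_self_eq_norm_sq]; positivity) hb'
    (fun i j hij => mul_le_mul_of_nonneg_left (hs hij) (by positivity)) hc hc1 hη hηc
    ?_ ?_ ?_ (hBf u) (hPf u) (hff u) (hBf v) (hPf v) (hff v)
  · rw [hP', finrank_range_gramMatrix X (by positivity), ← hd] at key
    rw [inner_ase_eq b s hs0 hXh u v hn]
    have e : inner ℝ (f u) (P' (f v)) = inner ℝ (X u) (X v) := by
      rw [hf, EuclideanSpace.inner_single_left, hP', toEuclideanLin_single]
      simp only [conj_trivial, Matrix.smul_apply, smul_eq_mul, gramMatrix]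
      calc _ = (√(n : ℝ) * √(n : ℝ)) * (n : ℝ)⁻¹ * inner ℝ (X u) (X v) := by ring
        _ = _ := by rw [hsn]; field_simp
    rw [← e]
    exact key
  · intro x
    rw [hM', hP', norm_sq_toEuclideanLin hMpos.1, norm_sq_toEuclideanLin hPs, hQM, hQP,
      ← Finset.sum_sub_distrib]
    simp_rw [← Finset.sum_sub_distrib, ← sub_mul]
    refine (abs_quadratic_le hn hV hε hQle x |> le_trans (le_of_eq ?_)).trans
      (mul_le_mul_of_nonneg_right hη2 (sq_nonneg _))
    simp only [hQ, Matrix.smul_apply, Matrix.sub_apply, smul_eq_mul, mul_sub]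
  -- Coercivity on the range: y has the entries ⟪X v, x⟫ with x in the span, so ‖y‖² = ⟪t, x⟫.
  -- Cauchy-Schwarz and `hcoer` give c n ‖y‖² ≤ ‖t‖², and ‖t‖² is n times the form of P' at y.
  · rintro y ⟨z, rfl⟩
    set y := P' z with hy
    set x := (n : ℝ)⁻¹ • ∑ v, z v • X v with hx
    set t := ∑ v, y v • X v with ht
    have hyv : ∀ v, y v = inner ℝ (X v) x := by
      intro v
      rw [hy, hP', map_smul, LinearMap.smul_apply, hx, inner_smul_right,
        ← toEuclideanLin_gramMatrix]
      rfl
    have hxs : x ∈ Submodule.span ℝ (Set.range X) :=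
      Submodule.smul_mem _ _ (Submodule.sum_mem _ fun v _ =>
        Submodule.smul_mem _ _ (Submodule.subset_span ⟨v, rfl⟩))
    have hyn : ‖y‖ ^ 2 = ∑ v, y v ^ 2 := by simp [EuclideanSpace.norm_sq_eq]
    have h1 : c * n * ‖x‖ ^ 2 ≤ ‖y‖ ^ 2 := by
      rw [hyn]; simp_rw [hyv]; exact hcoer x hxs
    have h2 : ‖y‖ ^ 2 ≤ ‖t‖ * ‖x‖ := by
      rw [hyn]
      refine le_trans (le_of_eq ?_) (real_inner_le_norm t x)
      rw [ht, sum_inner]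
      refine Finset.sum_congr rfl fun v _ => ?_
      rw [inner_smul_left, ← hyv]; simp [sq]
    rw [hPin, real_inner_self_eq_norm_sq, ← ht]
    rw [le_inv_mul_iff₀ hn']
    by_cases hy0 : ‖y‖ ^ 2 = 0
    · rw [hy0]; simp
    · have hy1 : 0 < ‖y‖ ^ 2 := lt_of_le_of_ne (sq_nonneg _) (Ne.symm hy0)
      have h3 : (‖y‖ ^ 2) ^ 2 ≤ ‖t‖ ^ 2 * ‖x‖ ^ 2 := by
        rw [← mul_pow]; exact pow_le_pow_left₀ (sq_nonneg _) h2 2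
      have h4 : (n * (c * ‖y‖ ^ 2)) * ‖y‖ ^ 2 ≤ ‖t‖ ^ 2 * ‖y‖ ^ 2 := by
        calc _ = c * n * (‖y‖ ^ 2) ^ 2 := by ring
          _ ≤ c * n * (‖t‖ ^ 2 * ‖x‖ ^ 2) := by gcongr
          _ = ‖t‖ ^ 2 * (c * n * ‖x‖ ^ 2) := by ring
          _ ≤ _ := mul_le_mul_of_nonneg_left h1 (sq_nonneg _)
      exact le_of_mul_le_mul_right h4 hy1
  · intro x
    refine sq_le (norm_nonneg _) ?_
    have hxn : ‖x‖ ^ 2 = ∑ v, x v ^ 2 := by simp [EuclideanSpace.norm_sq_eq]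
    calc ∑ u, (P' x) u ^ 2 ≤ ∑ u : V, (1 / n : ℝ) * ‖x‖ ^ 2 := by
          refine Finset.sum_le_sum fun u _ => ?_
          rw [hP', toEuclideanLin_apply_coord]
          refine (Finset.sum_mul_sq_le_sq_mul_sq _ _ _).trans ?_
          rw [hxn]
          refine mul_le_mul_of_nonneg_right ?_ (Finset.sum_nonneg fun _ _ => sq_nonneg _)
          calc ∑ i, ((n : ℝ)⁻¹ • gramMatrix X) u i ^ 2 ≤ ∑ i : V, ((n : ℝ)⁻¹) ^ 2 := by
                refine Finset.sum_le_sum fun i _ => ?_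
                rw [Matrix.smul_apply, smul_eq_mul, mul_pow]
                refine mul_le_of_le_one_right (by positivity) ?_
                exact pow_le_one₀ (h01 u i).1 (h01 u i).2
            _ ≤ 1 / n := by
                simp only [Finset.sum_const, Finset.card_univ, nsmul_eq_mul]
                calc (Fintype.card V : ℝ) * (n : ℝ)⁻¹ ^ 2 ≤ n * (n : ℝ)⁻¹ ^ 2 := by gcongr
                  _ = _ := by field_simp
      _ ≤ ‖x‖ ^ 2 := by
          simp only [Finset.sum_const, Finset.card_univ, nsmul_eq_mul]
          calc (Fintype.card V : ℝ) * (1 / n * ‖x‖ ^ 2) ≤ n * (1 / n * ‖x‖ ^ 2) := by gcongr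
            _ = _ := by field_simp

end Gram

/-! ### Exactness of the seeded clustering under a separating threshold. -/

section Clustering

variable {V : Type*} {d R : ℕ} {Xh : V → Euc d} {comp : V → Fin R} {θ : ℝ}

/-- If the largest inner product of two seeds is below θ, the R seeds lie in different components,
so all R components are represented (`hsurj`). Consequently a seed is discarded only if its partner
lies in the same component, and a vertex is passed over only if its component already has a seed.
This is the invariant of the seed selection: no component is ever lost, and that of the current
vertex is present afterwards. -/
theorem SeedStep.represented
    (hin : ∀ u v, comp u = comp v → θ < inner ℝ (Xh u) (Xh v))
    (hout : ∀ u v, comp u ≠ comp v → inner ℝ (Xh u) (Xh v) < θ)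
    {v : V} {s s' : Fin R → V} (h : SeedStep Xh v s s') :
    (∀ i, ∃ j, comp (s' j) = comp (s i)) ∧ ∃ j, comp (s' j) = comp v := by
  obtain ⟨y, z, hyz, hmax, h⟩ := h
  have hsurj : inner ℝ (Xh (s y)) (Xh (s z)) < θ → ∀ r, ∃ x, comp (s x) = r := by
    intro hlt
    have hinj : Function.Injective (fun i => comp (s i)) := by
      intro i j hij
      by_contra hne
      exact absurd (hin _ _ hij) (not_lt.2 ((hmax i j hne).trans hlt.le))
    exact Finite.surjective_of_injective hinj
  rcases h with ⟨hle, rfl⟩ | ⟨⟨x, hx⟩, rfl⟩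
  · have hsame : comp (s y) = comp (s z) := by
      by_contra hne
      obtain ⟨x, hx⟩ := hsurj (hout _ _ hne) (comp v)
      exact absurd ((hin v (s x) hx.symm).trans_le (hle x)) (not_lt.2 (hout _ _ hne).le)
    refine ⟨fun i => ?_, z, by simp⟩
    by_cases hi : i = z
    · exact ⟨y, by simp [Function.update_of_ne hyz, hsame, hi]⟩
    · exact ⟨i, by simp [Function.update_of_ne hi]⟩
  · refine ⟨fun i => ⟨i, rfl⟩, ?_⟩
    by_contra hno
    push Not at hno
    obtain ⟨x', hx'⟩ := hsurj (hx.trans_lt (hout _ _ fun h => hno x h.symm)) (comp v)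
    exact hno x' hx'

theorem SeedRun.represented
    (hin : ∀ u v, comp u = comp v → θ < inner ℝ (Xh u) (Xh v))
    (hout : ∀ u v, comp u ≠ comp v → inner ℝ (Xh u) (Xh v) < θ)
    {l : List V} {s s' : Fin R → V} (h : SeedRun Xh l s s') :
    (∀ i, ∃ j, comp (s' j) = comp (s i)) ∧ ∀ v ∈ l, ∃ j, comp (s' j) = comp v := by
  induction h with
  | nil s => exact ⟨fun i => ⟨i, rfl⟩, by simp⟩
  | cons hstep _ ih =>
    obtain ⟨h1, j, h2⟩ := hstep.represented hin hout
    refine ⟨fun i => ?_, fun w hw => ?_⟩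
    · obtain ⟨j, hj⟩ := h1 i
      obtain ⟨k, hk⟩ := ih.1 j
      exact ⟨k, hk.trans hj⟩
    · rcases List.mem_cons.1 hw with rfl | hw
      · obtain ⟨k, hk⟩ := ih.1 j
        exact ⟨k, hk.trans h2⟩
      · exact ih.2 w hw

/-- If a threshold separates inner products within components from those between components, the
clustering recovers the components. -/
theorem SeededClustering.exact_recovery [Fintype V]
    (hin : ∀ u v, comp u = comp v → θ < inner ℝ (Xh u) (Xh v))
    (hout : ∀ u v, comp u ≠ comp v → inner ℝ (Xh u) (Xh v) < θ)
    (hcomp : Function.Surjective comp) {C : Fin R → Finset V} (h : SeededClustering Xh C) :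
    ∃ e : Equiv.Perm (Fin R), ∀ r, C (e r) = Finset.univ.filter fun v => comp v = r := by
  obtain ⟨l, -, hl, s₀, s, hrun, τ, hτ, hC⟩ := h
  have hsurj : Function.Surjective fun j => comp (s j) := by
    intro r
    obtain ⟨v, rfl⟩ := hcomp r
    exact (hrun.represented hin hout).2 v (hl v)
  -- There are as many seeds as components, so each component has exactly one final seed; the
  -- renumbering is the inverse of this bijection.
  have hbij : Function.Bijective fun j => comp (s j) := ⟨Finite.injective_iff_surjective.2 hsurj, hsurj⟩
  have hτ' : ∀ v, comp (s (τ v)) = comp v := by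
    intro v
    by_contra hne
    obtain ⟨j, hj⟩ := hsurj (comp v)
    have h1 := hτ v j
    exact absurd ((hin v (s j) hj.symm).trans_le h1) (not_lt.2 (hout _ _ (Ne.symm hne)).le)
  let e := (Equiv.ofBijective _ hbij).symm
  have he : ∀ r, comp (s (e r)) = r := fun r => (Equiv.ofBijective _ hbij).apply_symm_apply r
  refine ⟨e, fun r => ?_⟩
  ext v
  rw [hC]
  simp only [Finset.mem_insert, Finset.mem_filter, Finset.mem_univ, true_and]
  constructor
  -- The seed that initializes a cluster belongs to the component anyway, so the insertion adds
  -- nothing.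
  · rintro (rfl | h)
    · exact he r
    · rw [← hτ' v, h, he]
  · intro h
    right
    apply hbij.1
    change comp (s (τ v)) = comp (s (e r))
    rw [hτ', he, h]

end Clustering

/-! ### Recovering point clouds from inner products, up to orthogonal maps. -/

section Procrustes

variable {D : ℕ} {K : Type*} [Fintype K]

theorem inner_linearCombination (x : K → Euc D) (a : K → ℝ) :
    inner ℝ (Fintype.linearCombination ℝ x a) (Fintype.linearCombination ℝ x a)
      = ∑ i, ∑ j, a i * a j * inner ℝ (x i) (x j) := by
  simp only [Fintype.linearCombination_apply, sum_inner, inner_sum, inner_smul_left,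
    inner_smul_right, conj_trivial]
  refine Finset.sum_congr rfl fun i _ => ?_
  rw [Finset.mul_sum]
  exact Finset.sum_congr rfl fun j _ => by rw [real_inner_comm]; ring

/-- Two point clouds with the same Gram matrix differ by an orthogonal transformation. -/
theorem exists_isometry_of_inner_eq (x y : K → Euc D)
    (h : ∀ i j, inner ℝ (y i) (y j) = inner ℝ (x i) (x j)) :
    ∃ O : Euc D ≃ₗᵢ[ℝ] Euc D, ∀ i, O (x i) = y i := by
  set Tx := Fintype.linearCombination ℝ x with hTx
  set Ty := Fintype.linearCombination ℝ y with hTy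
  have hnorm : ∀ a, ‖Ty a‖ = ‖Tx a‖ := by
    intro a
    rw [← sq_eq_sq₀ (norm_nonneg _) (norm_nonneg _), ← real_inner_self_eq_norm_sq,
      ← real_inner_self_eq_norm_sq, inner_linearCombination, inner_linearCombination]
    simp_rw [h]
  -- By `hnorm` the map sending ∑ a i • x i to ∑ a i • y i is a well-defined isometry on the span of
  -- x; the section g realises it, and it extends to the whole space.
  obtain ⟨g, hg⟩ := Tx.rangeRestrict.exists_rightInverse_of_surjective (LinearMap.range_rangeRestrict _)
  have hg' : ∀ z, Tx (g z) = z := fun z => congrArg Subtype.val (LinearMap.congr_fun hg z)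
  let L : LinearMap.range Tx →ₗᵢ[ℝ] Euc D :=
    { toLinearMap := Ty.comp g
      norm_map' := fun z => by
        rw [LinearMap.comp_apply, hnorm, hg']; rfl }
  refine ⟨L.extend.toLinearIsometryEquiv rfl, fun i => ?_⟩
  have hxi : Tx (Pi.single i 1) = x i := by
    simp [hTx, Fintype.linearCombination_apply, Pi.single_apply, Finset.sum_ite_eq']
  have hyi : Ty (Pi.single i 1) = y i := by
    simp [hTy, Fintype.linearCombination_apply, Pi.single_apply, Finset.sum_ite_eq']
  have hmem : x i ∈ LinearMap.range Tx := ⟨_, hxi⟩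
  rw [LinearIsometry.coe_toLinearIsometryEquiv]
  have := L.extend_apply ⟨x i, hmem⟩
  rw [this]
  change Ty (g ⟨x i, hmem⟩) = y i
  rw [← hyi, ← sub_eq_zero, ← map_sub, ← norm_eq_zero, hnorm, map_sub, hg', hxi]
  simp

/-- Stability of the reconstruction of a point cloud from its Gram matrix. -/
theorem exists_delta_isometry (x : K → Euc D) {ε : ℝ} (hε : 0 < ε) :
    ∃ δ : ℝ, 0 < δ ∧ ∀ y : K → Euc D,
      (∀ i j, |inner ℝ (y i) (y j) - inner ℝ (x i) (x j)| ≤ δ) →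
      ∃ O : Euc D ≃ₗᵢ[ℝ] Euc D, ∀ i, ‖y i - O (x i)‖ ≤ ε := by
  -- Compactness: counterexamples for δ = 1 / (m + 1) are bounded, their squared norms being Gram
  -- entries. A limit point has exactly the Gram matrix of x, hence is an orthogonal image of x, to
  -- which the counterexamples come arbitrarily close.
  by_contra hcon
  push Not at hcon
  choose y hy hO using fun m : ℕ => hcon (1 / ((m : ℝ) + 1)) (by positivity)
  have hbdd : ∀ m, y m ∈ Metric.closedBall (0 : K → Euc D) (∑ i, (‖x i‖ ^ 2 + 1)) := by
    intro m
    rw [mem_closedBall_zero_iff, pi_norm_le_iff_of_nonneg (by positivity)]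
    intro i
    have h1 := (abs_le.1 (hy m i i)).2
    rw [real_inner_self_eq_norm_sq, real_inner_self_eq_norm_sq] at h1
    have h2 : 1 / ((m : ℝ) + 1) ≤ 1 := by
      rw [div_le_one (by positivity)]; linarith [(Nat.cast_nonneg m : (0 : ℝ) ≤ m)]
    have hS : ‖x i‖ ^ 2 + 1 ≤ ∑ i, (‖x i‖ ^ 2 + 1) :=
      Finset.single_le_sum (f := fun i => ‖x i‖ ^ 2 + 1) (fun _ _ => by positivity)
        (Finset.mem_univ i)
    have hS1 : 1 ≤ ∑ i, (‖x i‖ ^ 2 + 1) := le_trans (by nlinarith [sq_nonneg ‖x i‖]) hS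
    nlinarith [norm_nonneg (y m i)]
  obtain ⟨z, -, φ, hφ, hz⟩ := tendsto_subseq_of_bounded Metric.isBounded_closedBall hbdd
  have hzi : ∀ i, Filter.Tendsto (fun m => y (φ m) i) Filter.atTop (nhds (z i)) := fun i =>
    (tendsto_pi_nhds.1 hz) i
  have hzin : ∀ i j, inner ℝ (z i) (z j) = inner ℝ (x i) (x j) := by
    intro i j
    have h1 : Filter.Tendsto (fun m => inner ℝ (y (φ m) i) (y (φ m) j)) Filter.atTop
        (nhds (inner ℝ (z i) (z j))) := (hzi i).inner (hzi j)
    have h2 : Filter.Tendsto (fun m => inner ℝ (y (φ m) i) (y (φ m) j)) Filter.atTop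
        (nhds (inner ℝ (x i) (x j))) := by
      rw [tendsto_iff_norm_sub_tendsto_zero]
      refine squeeze_zero (fun _ => norm_nonneg _) (fun m => hy (φ m) i j) ?_
      exact tendsto_one_div_add_atTop_nhds_zero_nat.comp hφ.tendsto_atTop
    exact tendsto_nhds_unique h1 h2
  obtain ⟨O, hOx⟩ := exists_isometry_of_inner_eq x z hzin
  have hev : ∀ᶠ m in Filter.atTop, ∀ i, ‖y (φ m) i - z i‖ < ε := by
    rw [Filter.eventually_all]
    intro i
    have := (tendsto_iff_norm_sub_tendsto_zero.1 (hzi i)).eventually (gt_mem_nhds hε)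
    exact this
  obtain ⟨m, hm⟩ := hev.exists
  obtain ⟨i, hi⟩ := hO (φ m) O
  rw [hOx] at hi
  exact absurd (hm i) (not_lt.2 hi.le)

theorem inner_pad {d : ℕ} (hd : d ≤ D) (x y : Euc d) :
    inner ℝ (pad D x) (pad D y) = inner ℝ x y := by
  set G : ℕ → ℝ := fun i => if h : i < d then y ⟨i, h⟩ * x ⟨i, h⟩ else 0 with hG
  have h1 : inner ℝ (pad D x) (pad D y) = ∑ i ∈ Finset.range D, G i := by
    rw [← Fin.sum_univ_eq_sum_range G D, PiLp.inner_apply]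
    refine Finset.sum_congr rfl fun j _ => ?_
    by_cases h : (j : ℕ) < d <;> simp [pad, hG, h]
  have h2 : inner ℝ x y = ∑ i ∈ Finset.range d, G i := by
    rw [← Fin.sum_univ_eq_sum_range G d, PiLp.inner_apply]
    exact Finset.sum_congr rfl fun j _ => by simp [hG]
  rw [h1, h2]
  symm
  refine Finset.sum_subset (Finset.range_subset_range.2 hd) fun i _ hi => ?_
  simp only [Finset.mem_range] at hi
  simp [hG, hi]

/-- An embedding whose inner products are close to those of finitely many latent positions is close
to an orthogonal image of the latent positions. -/
theorem exists_delta_isometry_pad (x : K → Euc D) {ε : ℝ} (hε : 0 < ε) :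
    ∃ δ : ℝ, 0 < δ ∧ ∀ {V : Type} (k : V → K) (_ : Function.Surjective k) {d : ℕ} (_ : d ≤ D)
      (Xh : V → Euc d),
      (∀ u v, |inner ℝ (Xh u) (Xh v) - inner ℝ (x (k u)) (x (k v))| ≤ δ) →
      ∃ O : Euc D ≃ₗᵢ[ℝ] Euc D, ∀ v, ‖pad D (Xh v) - O (x (k v))‖ ≤ ε := by
  obtain ⟨δ, hδ, h⟩ := exists_delta_isometry x (half_pos hε)
  -- The bound ε² / 16 puts rows with the same label within ε / 2, since their squared distance is
  -- at most four times the Gram error. One representative per label then suffices, and the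
  -- tolerance is independent of the number of rows.
  refine ⟨min δ (ε ^ 2 / 16), by positivity, fun {V} k hk {d} hd Xh hX => ?_⟩
  obtain ⟨r, hr⟩ := hk.hasRightInverse
  have hX' : ∀ u v, |inner ℝ (pad D (Xh u)) (pad D (Xh v)) - inner ℝ (x (k u)) (x (k v))|
      ≤ min δ (ε ^ 2 / 16) := fun u v => by rw [inner_pad hd]; exact hX u v
  obtain ⟨O, hO⟩ := h (fun i => pad D (Xh (r i))) fun i j => by
    have := (hX' (r i) (r j)).trans (min_le_left _ _)
    rwa [hr, hr] at this
  refine ⟨O, fun v => ?_⟩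
  have h1 : ‖pad D (Xh v) - pad D (Xh (r (k v)))‖ ≤ ε / 2 := by
    rw [← pow_le_pow_iff_left₀ (norm_nonneg _) (by positivity) two_ne_zero, norm_sub_sq_real,
      ← real_inner_self_eq_norm_sq, ← real_inner_self_eq_norm_sq]
    have a1 := abs_le.1 ((hX' v v).trans (min_le_right _ _))
    have a2 := abs_le.1 ((hX' v (r (k v))).trans (min_le_right _ _))
    have a3 := abs_le.1 ((hX' (r (k v)) (r (k v))).trans (min_le_right _ _))
    rw [hr] at a2 a3
    nlinarith [a1.1, a1.2, a2.1, a2.2, a3.1, a3.2]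
  calc _ ≤ ‖pad D (Xh v) - pad D (Xh (r (k v)))‖ + ‖pad D (Xh (r (k v))) - O (x (k v))‖ :=
        norm_sub_le_norm_sub_add_norm_sub _ _ _
    _ ≤ ε / 2 + ε / 2 := add_le_add h1 (hO (k v))
    _ = ε := by ring

end Procrustes

/-! ### Lipschitz stability and orthogonal invariance of the test statistics. -/

section TestStatistic

variable {D : ℕ} {σ : ℝ}

theorem rbf_nonneg (x y : Euc D) : 0 ≤ rbf σ x y := (Real.exp_pos _).le

theorem rbf_le_one (x y : Euc D) : rbf σ x y ≤ 1 := by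
  rw [rbf, Real.exp_le_one_iff, neg_div, neg_nonpos]
  positivity

theorem rbf_isometry (W : Euc D ≃ₗᵢ[ℝ] Euc D) (x y : Euc D) : rbf σ (W x) (W y) = rbf σ x y := by
  rw [rbf, rbf, ← map_sub, W.norm_map]

theorem abs_exp_neg_sub_le {a b : ℝ} (ha : 0 ≤ a) (hb : 0 ≤ b) :
    |Real.exp (-a) - Real.exp (-b)| ≤ |a - b| := by
  wlog hab : a ≤ b generalizing a b
  · rw [abs_sub_comm, abs_sub_comm a]; exact this hb ha (le_of_not_ge hab)
  have h1 : Real.exp (-b) ≤ Real.exp (-a) := Real.exp_le_exp.2 (by linarith)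
  rw [abs_of_nonneg (by linarith), abs_sub_comm, abs_of_nonneg (by linarith)]
  have h2 : Real.exp (-b) = Real.exp (-a) * Real.exp (-(b - a)) := by
    rw [← Real.exp_add]; congr 1; ring
  have h3 := Real.add_one_le_exp (-(b - a))
  have h4 : Real.exp (-a) ≤ 1 := Real.exp_le_one_iff.2 (by linarith)
  rw [h2]
  nlinarith [Real.exp_pos (-a)]

theorem abs_rbf_sub_le (hσ : 0 < σ) {x y x' y' : Euc D} {ε : ℝ} (hx : ‖x‖ ≤ 2) (hy : ‖y‖ ≤ 2)
    (hx' : ‖x'‖ ≤ 2) (hy' : ‖y'‖ ≤ 2) (h1 : ‖x - x'‖ ≤ ε) (h2 : ‖y - y'‖ ≤ ε) :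
    |rbf σ x y - rbf σ x' y'| ≤ 16 / σ ^ 2 * ε := by
  rw [rbf, rbf, neg_div, neg_div]
  refine (abs_exp_neg_sub_le (by positivity) (by positivity)).trans ?_
  rw [← sub_div, abs_div, abs_of_nonneg (sq_nonneg σ), div_mul_eq_mul_div]
  refine div_le_div_of_nonneg_right ?_ (sq_nonneg σ)
  have e1 : ‖x - y‖ ≤ 4 := (norm_sub_le _ _).trans (by linarith)
  have e2 : ‖x' - y'‖ ≤ 4 := (norm_sub_le _ _).trans (by linarith)
  have e3 : |‖x - y‖ - ‖x' - y'‖| ≤ 2 * ε := by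
    refine (abs_norm_sub_norm_le _ _).trans ?_
    have : x - y - (x' - y') = (x - x') - (y - y') := by abel
    rw [this]
    exact (norm_sub_le _ _).trans (by linarith)
  have e4 : ‖x - y‖ ^ 2 - ‖x' - y'‖ ^ 2 = (‖x - y‖ - ‖x' - y'‖) * (‖x - y‖ + ‖x' - y'‖) := by ring
  rw [e4, abs_mul, abs_of_nonneg (a := ‖x - y‖ + ‖x' - y'‖) (by positivity)]
  calc _ ≤ 2 * ε * 8 := by
        refine mul_le_mul e3 (by linarith) (by positivity) ((abs_nonneg _).trans e3)
    _ = 16 * ε := by ring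

variable {U V : Type*} [Fintype U] [Fintype V]

theorem card_mul_pred_nonneg (n : ℕ) : (0 : ℝ) ≤ (n : ℝ) * ((n : ℝ) - 1) := by
  rcases Nat.eq_zero_or_pos n with h | h
  · simp [h]
  · have : (1 : ℝ) ≤ n := by exact_mod_cast h
    exact mul_nonneg (by linarith) (by linarith)

/-- Averages over ordered pairs of distinct indices. -/
theorem abs_offDiag_average_le {a : U → U → ℝ} {ρ : ℝ} (hρ : 0 ≤ ρ) (h : ∀ i j, |a i j| ≤ ρ) :
    |1 / ((Fintype.card U : ℝ) * ((Fintype.card U : ℝ) - 1)) *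
      ∑ i, ∑ j, if j ≠ i then a i j else 0| ≤ ρ := by
  have h0 := card_mul_pred_nonneg (Fintype.card U)
  rw [abs_mul, abs_of_nonneg (by positivity)]
  have h1 : |∑ i, ∑ j, if j ≠ i then a i j else 0|
      ≤ ((Fintype.card U : ℝ) * ((Fintype.card U : ℝ) - 1)) * ρ := by
    calc _ ≤ ∑ i : U, ∑ j : U, if j ≠ i then ρ else 0 := by
          refine (Finset.abs_sum_le_sum_abs _ _).trans (Finset.sum_le_sum fun i _ => ?_)
          refine (Finset.abs_sum_le_sum_abs _ _).trans (Finset.sum_le_sum fun j _ => ?_)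
          split_ifs
          · exact h i j
          · simp
      _ = _ := by
          have : ∀ i : U, (∑ j : U, if j ≠ i then ρ else 0) = ((Fintype.card U : ℝ) - 1) * ρ := by
            intro i
            have e : ∀ j : U, (if j ≠ i then ρ else 0) = ρ - if j = i then ρ else 0 := by
              intro j; by_cases hj : j = i <;> simp [hj]
            simp_rw [e, Finset.sum_sub_distrib, Finset.sum_ite_eq', Finset.mem_univ, if_true]
            simp; ring
          simp_rw [this]
          simp; ring
  -- With at most one point the normaliser is 1 / 0 = 0, and the average vanishes.
  rcases h0.eq_or_lt with h2 | h2
  · rw [← h2]; simpa using hρ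
  · calc _ ≤ 1 / ((Fintype.card U : ℝ) * ((Fintype.card U : ℝ) - 1)) *
          (((Fintype.card U : ℝ) * ((Fintype.card U : ℝ) - 1)) * ρ) :=
        mul_le_mul_of_nonneg_left h1 (by positivity)
      _ = ρ := by rw [← mul_assoc, one_div_mul_cancel h2.ne', one_mul]

theorem abs_prod_average_le {a : U → V → ℝ} {ρ : ℝ} (hρ : 0 ≤ ρ) (h : ∀ i k, |a i k| ≤ ρ) :
    |2 / ((Fintype.card V : ℝ) * (Fintype.card U : ℝ)) * ∑ i, ∑ k, a i k| ≤ 2 * ρ := by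
  rw [abs_mul, abs_of_nonneg (by positivity)]
  have h1 : |∑ i, ∑ k, a i k| ≤ ((Fintype.card V : ℝ) * (Fintype.card U : ℝ)) * ρ := by
    calc _ ≤ ∑ i : U, ∑ k : V, ρ := by
          refine (Finset.abs_sum_le_sum_abs _ _).trans (Finset.sum_le_sum fun i _ => ?_)
          exact (Finset.abs_sum_le_sum_abs _ _).trans (Finset.sum_le_sum fun k _ => h i k)
      _ = _ := by simp; ring
  rcases (show (0 : ℝ) ≤ (Fintype.card V : ℝ) * (Fintype.card U : ℝ) by positivity).eq_or_lt
    with h2 | h2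
  · rw [← h2]; simpa using hρ
  · calc _ ≤ 2 / ((Fintype.card V : ℝ) * (Fintype.card U : ℝ)) *
          (((Fintype.card V : ℝ) * (Fintype.card U : ℝ)) * ρ) :=
        mul_le_mul_of_nonneg_left h1 (by positivity)
      _ = 2 * ρ := by rw [← mul_assoc, div_mul_cancel₀ _ h2.ne']

theorem abs_testT_sub_le {D' : ℕ} {X : U → Euc D} {Y : V → Euc D} {X' : U → Euc D'} {Y' : V → Euc D'}
    {ρ : ℝ} (hρ : 0 ≤ ρ) (hXX : ∀ i j, |rbf σ (X i) (X j) - rbf σ (X' i) (X' j)| ≤ ρ)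
    (hXY : ∀ i j, |rbf σ (X i) (Y j) - rbf σ (X' i) (Y' j)| ≤ ρ)
    (hYY : ∀ i j, |rbf σ (Y i) (Y j) - rbf σ (Y' i) (Y' j)| ≤ ρ) :
    |testT σ X Y - testT σ X' Y'| ≤ 4 * ρ := by
  have h1 := abs_offDiag_average_le hρ hXX
  have h2 := abs_prod_average_le hρ hXY
  have h3 := abs_offDiag_average_le hρ hYY
  have e1 : ∀ (a a' : U → U → ℝ), (∑ i, ∑ j, if j ≠ i then a i j - a' i j else 0)
      = (∑ i, ∑ j, if j ≠ i then a i j else 0) - ∑ i, ∑ j, if j ≠ i then a' i j else 0 := by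
    intro a a'
    simp_rw [← Finset.sum_sub_distrib]
    refine Finset.sum_congr rfl fun i _ => Finset.sum_congr rfl fun j _ => ?_
    split_ifs <;> simp
  have e3 : ∀ (a a' : V → V → ℝ), (∑ i, ∑ j, if j ≠ i then a i j - a' i j else 0)
      = (∑ i, ∑ j, if j ≠ i then a i j else 0) - ∑ i, ∑ j, if j ≠ i then a' i j else 0 := by
    intro a a'
    simp_rw [← Finset.sum_sub_distrib]
    refine Finset.sum_congr rfl fun i _ => Finset.sum_congr rfl fun j _ => ?_
    split_ifs <;> simp
  rw [e1, mul_sub] at h1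
  rw [e3, mul_sub] at h3
  simp_rw [Finset.sum_sub_distrib] at h2
  rw [mul_sub] at h2
  rw [abs_le] at h1 h2 h3 ⊢
  simp only [testT]
  constructor <;> linarith [h1.1, h1.2, h2.1, h2.2, h3.1, h3.2]

theorem testT_isometry (W : Euc D ≃ₗᵢ[ℝ] Euc D) (X : U → Euc D) (Y : V → Euc D) :
    testT σ (fun u => W (X u)) (fun v => W (Y v)) = testT σ X Y := by
  simp only [testT, rbf_isometry]

/-- Only the cross term is negative. Some lower bound is needed so that the infimum over orthogonal
maps is a genuine one. -/
theorem neg_two_le_testT (X : U → Euc D) (Y : V → Euc D) : -2 ≤ testT σ X Y := by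
  have h2 := abs_le.1 (abs_prod_average_le (a := fun i k => rbf σ (X i) (Y k)) zero_le_one
    fun i k => by rw [abs_of_nonneg (rbf_nonneg _ _)]; exact rbf_le_one _ _)
  have h1 : 0 ≤ 1 / ((Fintype.card U : ℝ) * ((Fintype.card U : ℝ) - 1)) *
      ∑ i, ∑ j, if j ≠ i then rbf σ (X i) (X j) else 0 := by
    refine mul_nonneg (one_div_nonneg.2 (card_mul_pred_nonneg _)) (Finset.sum_nonneg fun i _ =>
      Finset.sum_nonneg fun j _ => ?_)
    split_ifs
    · exact rbf_nonneg _ _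
    · exact le_rfl
  have h3 : 0 ≤ 1 / ((Fintype.card V : ℝ) * ((Fintype.card V : ℝ) - 1)) *
      ∑ i, ∑ j, if j ≠ i then rbf σ (Y i) (Y j) else 0 := by
    refine mul_nonneg (one_div_nonneg.2 (card_mul_pred_nonneg _)) (Finset.sum_nonneg fun i _ =>
      Finset.sum_nonneg fun j _ => ?_)
    split_ifs
    · exact rbf_nonneg _ _
    · exact le_rfl
  simp only [testT]
  linarith [h2.1, h2.2]

theorem bddBelow_testT (X : U → Euc D) (Y : V → Euc D) :
    BddBelow (Set.range fun W : Euc D ≃ₗᵢ[ℝ] Euc D => testT σ X fun k => W (Y k)) :=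
  ⟨-2, by rintro _ ⟨W, rfl⟩; exact neg_two_le_testT _ _⟩

theorem abs_iInf_sub_iInf_le {ι : Type*} [Nonempty ι] {f g : ι → ℝ} (hf : BddBelow (Set.range f))
    (hg : BddBelow (Set.range g)) {ε : ℝ} (h : ∀ i, |f i - g i| ≤ ε) :
    |(⨅ i, f i) - ⨅ i, g i| ≤ ε := by
  rw [abs_le]
  constructor
  · have : (⨅ i, g i) - ε ≤ ⨅ i, f i := le_ciInf fun i => by
      linarith [ciInf_le hg i, (abs_le.1 (h i)).1]
    linarith
  · have : (⨅ i, f i) - ε ≤ ⨅ i, g i := le_ciInf fun i => by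
      linarith [ciInf_le hf i, (abs_le.1 (h i)).2]
    linarith

/-- The substitution W ↦ O⁻¹ W O' permutes the orthogonal group, and T does not change when O is
applied to both clouds. This disposes of the indeterminacy of the embeddings. -/
theorem alignedT_isometry (O O' : Euc D ≃ₗᵢ[ℝ] Euc D) (X : U → Euc D) (Y : V → Euc D) :
    alignedT σ (fun u => O (X u)) (fun v => O' (Y v)) = alignedT σ X Y := by
  refine Function.Surjective.iInf_congr (fun W => (O'.trans W).trans O.symm) ?_ fun W => ?_
  · intro W
    exact ⟨(O'.symm.trans W).trans O, by ext1 x; simp⟩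
  · rw [← testT_isometry O]
    simp

/-- Stability of the test statistics under perturbation and orthogonal transformations of the point
clouds. -/
theorem testT_stable (hσ : 0 < σ) {X Xh : U → Euc D} {Y Yh : V → Euc D} {O O' : Euc D ≃ₗᵢ[ℝ] Euc D}
    {ε : ℝ} (hε0 : 0 ≤ ε) (hε : ε ≤ 1) (hX1 : ∀ u, ‖X u‖ ≤ 1) (hY1 : ∀ v, ‖Y v‖ ≤ 1)
    (hX : ∀ u, ‖Xh u - O (X u)‖ ≤ ε) (hY : ∀ v, ‖Yh v - O' (Y v)‖ ≤ ε) :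
    |testT σ Xh Yh - testT σ (fun u => O (X u)) (fun v => O' (Y v))| ≤ 64 / σ ^ 2 * ε ∧
      |alignedT σ Xh Yh - alignedT σ X Y| ≤ 64 / σ ^ 2 * ε := by
  have nX : ∀ u, ‖O (X u)‖ ≤ 2 := fun u => by rw [O.norm_map]; linarith [hX1 u]
  have nY : ∀ v, ‖O' (Y v)‖ ≤ 2 := fun v => by rw [O'.norm_map]; linarith [hY1 v]
  have nXh : ∀ u, ‖Xh u‖ ≤ 2 := fun u => by
    have := norm_le_norm_sub_add (Xh u) (O (X u))
    rw [O.norm_map] at this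
    linarith [hX1 u, hX u]
  have nYh : ∀ v, ‖Yh v‖ ≤ 2 := fun v => by
    have := norm_le_norm_sub_add (Yh v) (O' (Y v))
    rw [O'.norm_map] at this
    linarith [hY1 v, hY v]
  -- The estimate is uniform in W, so it passes to the infimum; W = id gives the bound for T itself.
  have key : ∀ W : Euc D ≃ₗᵢ[ℝ] Euc D,
      |testT σ Xh (fun v => W (Yh v)) - testT σ (fun u => O (X u)) (fun v => W (O' (Y v)))|
        ≤ 64 / σ ^ 2 * ε := by
    intro W
    have hW : ∀ v, ‖W (Yh v) - W (O' (Y v))‖ ≤ ε := fun v => by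
      rw [← map_sub, W.norm_map]; exact hY v
    have e : 64 / σ ^ 2 * ε = 4 * (16 / σ ^ 2 * ε) := by ring
    rw [e]
    have nW : ∀ v, ‖W (Yh v)‖ ≤ 2 := fun v => by rw [W.norm_map]; exact nYh v
    have nW' : ∀ v, ‖W (O' (Y v))‖ ≤ 2 := fun v => by rw [W.norm_map]; exact nY v
    exact abs_testT_sub_le (by positivity)
      (fun i j => abs_rbf_sub_le hσ (nXh i) (nXh j) (nX i) (nX j) (hX i) (hX j))
      (fun i j => abs_rbf_sub_le hσ (nXh i) (nW j) (nX i) (nW' j) (hX i) (hW j))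
      (fun i j => abs_rbf_sub_le hσ (nW i) (nW j) (nW' i) (nW' j) (hW i) (hW j))
  refine ⟨by simpa using key (LinearIsometryEquiv.refl ℝ _), ?_⟩
  rw [← alignedT_isometry O O' X Y]
  exact abs_iInf_sub_iInf_le (bddBelow_testT _ _) (bddBelow_testT _ _) key

end TestStatistic

/-! ### Strict positive definiteness of the Gaussian kernel. -/

section GaussianKernel

variable {D : ℕ} {σ : ℝ}

/-- A non-integrable function has integral 0 by convention, whereas the formula for the Gaussian
integral gives a positive value. -/
theorem integrable_exp_neg_mul_sq_norm {a : ℝ} (ha : 0 < a) :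
    Integrable (fun z : Euc D => Real.exp (-a * ‖z‖ ^ 2)) := by
  by_contra h
  have h1 := integral_undef h
  rw [GaussianFourier.integral_rexp_neg_mul_sq_norm ha] at h1
  have : 0 < (Real.pi / a) ^ ((Module.finrank ℝ (Euc D) : ℝ) / 2) :=
    Real.rpow_pos_of_pos (div_pos Real.pi_pos ha) _
  exact this.ne' h1

/-- The Gaussian kernel of half the width, used as a feature map into `L²`. -/
def gaussianFeature (σ : ℝ) (x z : Euc D) : ℝ := Real.exp (-(2 * ‖x - z‖ ^ 2) / σ ^ 2)

theorem continuous_gaussianFeature (x : Euc D) : Continuous (gaussianFeature σ x) := by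
  unfold gaussianFeature
  fun_prop

/-- By the parallelogram law, the product of Gaussians centred at x and y is a Gaussian centred at
the midpoint, multiplied by the kernel. Integration over z exhibits the kernel as an L² inner
product, up to a constant. -/
theorem gaussianFeature_mul (x y z : Euc D) : gaussianFeature σ x z * gaussianFeature σ y z
    = rbf σ x y * Real.exp (-(4 / σ ^ 2) * ‖z - (1 / 2 : ℝ) • (x + y)‖ ^ 2) := by
  rw [gaussianFeature, gaussianFeature, rbf, ← Real.exp_add, ← Real.exp_add]
  congr 1
  have h := parallelogram_law_with_norm ℝ (z - x) (z - y)
  have e1 : z - x + (z - y) = (2 : ℝ) • (z - (1 / 2 : ℝ) • (x + y)) := by module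
  have e2 : z - x - (z - y) = y - x := by abel
  rw [e1, e2, norm_smul, norm_sub_rev z x, norm_sub_rev z y, norm_sub_rev y x] at h
  have h' : ‖x - z‖ ^ 2 + ‖y - z‖ ^ 2
      = 2 * ‖z - (1 / 2 : ℝ) • (x + y)‖ ^ 2 + ‖x - y‖ ^ 2 / 2 := by
    rw [Real.norm_ofNat] at h; nlinarith
  calc _ = -(2 / σ ^ 2) * (‖x - z‖ ^ 2 + ‖y - z‖ ^ 2) := by ring
    _ = _ := by rw [h']; ring

theorem integrable_gaussianFeature_mul (hσ : 0 < σ) (x y : Euc D) :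
    Integrable fun z => gaussianFeature σ x z * gaussianFeature σ y z := by
  simp_rw [gaussianFeature_mul]
  exact ((integrable_exp_neg_mul_sq_norm (by positivity)).comp_sub_right _).const_mul _

theorem integral_gaussianFeature_mul (hσ : 0 < σ) (x y : Euc D) :
    ∫ z, gaussianFeature σ x z * gaussianFeature σ y z
      = rbf σ x y * (Real.pi / (4 / σ ^ 2)) ^ ((Module.finrank ℝ (Euc D) : ℝ) / 2) := by
  simp_rw [gaussianFeature_mul]
  rw [integral_const_mul, integral_sub_right_eq_self (fun z => Real.exp (-(4 / σ ^ 2) * ‖z‖ ^ 2)),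
    GaussianFourier.integral_rexp_neg_mul_sq_norm (by positivity)]

/-- The additive character `z ↦ exp (4 ⟪x, z⟫ / σ²)`. -/
def expInnerHom (σ : ℝ) (x : Euc D) : Multiplicative (Euc D) →* ℝ where
  toFun z := Real.exp (4 / σ ^ 2 * inner ℝ x z.toAdd)
  map_one' := by simp
  map_mul' z w := by rw [toAdd_mul, inner_add_right, mul_add, Real.exp_add]

/-- Distinct points thus give distinct characters, which are linearly independent by Dedekind's
theorem. -/
theorem expInnerHom_injective (hσ : 0 < σ) :
    Function.Injective (expInnerHom σ : Euc D → Multiplicative (Euc D) →* ℝ) := by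
  intro x y h
  refine ext_inner_right ℝ fun z => ?_
  have h1 : Real.exp (4 / σ ^ 2 * inner ℝ x z) = Real.exp (4 / σ ^ 2 * inner ℝ y z) :=
    DFunLike.congr_fun h (Multiplicative.ofAdd z)
  exact mul_left_cancel₀ (by positivity) (Real.exp_injective h1)

theorem gaussianFeature_eq (x z : Euc D) : gaussianFeature σ x z
    = Real.exp (-(2 * ‖z‖ ^ 2) / σ ^ 2) * (Real.exp (-(2 * ‖x‖ ^ 2) / σ ^ 2)
      * expInnerHom σ x (Multiplicative.ofAdd z)) := by
  change _ = _ * (_ * Real.exp (4 / σ ^ 2 * inner ℝ x z))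
  rw [gaussianFeature, ← Real.exp_add, ← Real.exp_add, norm_sub_sq_real]
  congr 1
  ring

/-- The Gaussian kernel is strictly positive definite. -/
theorem sum_rbf_pos (hσ : 0 < σ) (T : Finset (Euc D)) (c : Euc D → ℝ) (hc : ∃ x ∈ T, c x ≠ 0) :
    0 < ∑ x ∈ T, ∑ y ∈ T, c x * c y * rbf σ x y := by
  set C := (Real.pi / (4 / σ ^ 2)) ^ ((Module.finrank ℝ (Euc D) : ℝ) / 2) with hC
  have hC0 : 0 < C := Real.rpow_pos_of_pos (by positivity) _
  set h : Euc D → ℝ := fun z => ∑ x ∈ T, c x * gaussianFeature σ x z with hh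
  have hcont : Continuous h := continuous_finsetSum _ fun x _ =>
    continuous_const.mul (continuous_gaussianFeature x)
  have hsq : ∀ z, h z ^ 2
      = ∑ x ∈ T, ∑ y ∈ T, c x * c y * (gaussianFeature σ x z * gaussianFeature σ y z) := by
    intro z
    rw [sq, hh, Finset.sum_mul_sum]
    exact Finset.sum_congr rfl fun x _ => Finset.sum_congr rfl fun y _ => by ring
  have hi : ∀ x ∈ T, ∀ y ∈ T, Integrable fun z =>
      c x * c y * (gaussianFeature σ x z * gaussianFeature σ y z) := fun x _ y _ =>
    (integrable_gaussianFeature_mul hσ x y).const_mul _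
  have hmean : Integrable fun z => h z ^ 2 := by
    simp_rw [hsq]
    exact integrable_finsetSum _ fun x hx => integrable_finsetSum _ fun y hy => hi x hx y hy
  have hval : ∫ z, h z ^ 2 = C * ∑ x ∈ T, ∑ y ∈ T, c x * c y * rbf σ x y := by
    simp_rw [hsq]
    rw [integral_finsetSum _ fun x hx => integrable_finsetSum _ fun y hy => hi x hx y hy,
      Finset.mul_sum]
    refine Finset.sum_congr rfl fun x hx => ?_
    rw [integral_finsetSum _ fun y hy => hi x hx y hy, Finset.mul_sum]
    refine Finset.sum_congr rfl fun y _ => ?_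
    rw [integral_const_mul, integral_gaussianFeature_mul hσ, ← hC]; ring
  -- Were the integral zero, the continuous h would vanish identically. Dividing out the Gaussian
  -- factor in z common to all features would leave a linear relation between distinct characters
  -- with a nonzero coefficient.
  have hne : 0 < ∫ z, h z ^ 2 := by
    refine lt_of_le_of_ne (integral_nonneg fun z => sq_nonneg _) fun h0 => ?_
    have h1 := (integral_eq_zero_iff_of_nonneg (fun z => sq_nonneg (h z)) hmean).1 h0.symm
    have h2 : (fun z => h z ^ 2) = 0 :=
      (Continuous.ae_eq_iff_eq volume (hcont.pow 2) continuous_zero).1 h1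
    have h3 : ∀ z, h z = 0 := fun z => by simpa using congrFun h2 z
    have hli := (linearIndependent_monoidHom (Multiplicative (Euc D)) ℝ).comp _
      (expInnerHom_injective (D := D) hσ)
    obtain ⟨x, hx, hcx⟩ := hc
    have := linearIndependent_iff'.1 hli T (fun x => c x * Real.exp (-(2 * ‖x‖ ^ 2) / σ ^ 2)) ?_ x hx
    · exact hcx ((mul_eq_zero.1 this).resolve_right (Real.exp_pos _).ne')
    · ext z
      have h4 := h3 z.toAdd
      simp only [hh, gaussianFeature_eq] at h4
      have h5 : Real.exp (-(2 * ‖z.toAdd‖ ^ 2) / σ ^ 2) * (∑ x ∈ T,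
          c x * Real.exp (-(2 * ‖x‖ ^ 2) / σ ^ 2) * expInnerHom σ x z) = 0 := by
        rw [← h4, Finset.mul_sum]
        exact Finset.sum_congr rfl fun x _ => by rw [ofAdd_toAdd]; ring
      have h6 := (mul_eq_zero.1 h5).resolve_left (Real.exp_pos _).ne'
      simpa [Finset.sum_apply] using h6
  rw [hval] at hne
  exact (mul_pos_iff_of_pos_left hC0).1 hne

end GaussianKernel

/-! ### The population discrepancy of finitely supported laws. -/

section Population

variable {D : ℕ} {σ : ℝ}

/-- A probability measure carried by a finite set. -/
structure FinitelySupported (F : Measure (Euc D)) (S : Finset (Euc D)) : Prop where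
  prob : IsProbabilityMeasure F
  compl : F (↑S)ᶜ = 0

namespace FinitelySupported

variable {F G : Measure (Euc D)} {S T : Finset (Euc D)}

theorem mono (h : FinitelySupported F S) (hST : S ⊆ T) : FinitelySupported F T :=
  ⟨h.prob, measure_mono_null (Set.compl_subset_compl.2 (Finset.coe_subset.2 hST)) h.compl⟩

theorem integral_eq (h : FinitelySupported F S) (f : Euc D → ℝ) :
    ∫ x, f x ∂F = ∑ x ∈ S, F.real {x} * f x := by
  have := h.prob
  have hr : F.restrict ↑S = F := Measure.restrict_eq_self_of_ae_mem (mem_ae_iff.2 h.compl)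
  conv_lhs => rw [← hr]
  rw [setIntegral_finset]
  · simp
  · exact IntegrableOn.finset

theorem sum_real (h : FinitelySupported F S) : ∑ x ∈ S, F.real {x} = 1 := by
  have := h.prob
  simpa using (h.integral_eq fun _ => 1).symm

theorem measure_eq (h : FinitelySupported F S) (A : Set (Euc D)) :
    F A = ∑ x ∈ S.filter (· ∈ A), F {x} := by
  rw [sum_measure_singleton]
  refine measure_congr ?_
  have h1 : ∀ᵐ x ∂F, x ∈ (S : Set (Euc D)) := mem_ae_iff.2 h.compl
  filter_upwards [h1] with x hx
  apply propext
  change x ∈ A ↔ x ∈ (↑(S.filter (· ∈ A)) : Set (Euc D))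
  simp only [Finset.coe_filter, Set.mem_ofPred_eq]
  exact ⟨fun ha => ⟨hx, ha⟩, fun ha => ha.2⟩

theorem ext (hF : FinitelySupported F S) (hG : FinitelySupported G S)
    (h : ∀ x ∈ S, F.real {x} = G.real {x}) : F = G := by
  have := hF.prob
  have := hG.prob
  ext A _
  rw [hF.measure_eq, hG.measure_eq]
  refine Finset.sum_congr rfl fun x hx => ?_
  have := h x (Finset.mem_filter.1 hx).1
  rwa [measureReal_def, measureReal_def, ENNReal.toReal_eq_toReal_iff' (by simp) (by simp)] at this

theorem map (h : FinitelySupported F S) {L : Euc D → Euc D} (hL : Measurable L) :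
    FinitelySupported (F.map L) (S.image L) := by
  have := h.prob
  refine ⟨Measure.isProbabilityMeasure_map hL.aemeasurable, ?_⟩
  rw [Measure.map_apply hL (Finset.measurableSet _).compl]
  refine measure_mono_null ?_ h.compl
  intro x hx hxS
  exact hx (Finset.mem_coe.2 (Finset.mem_image_of_mem L hxS))

/-- No measurability of f is required: any function is a.e. strongly measurable for a measure
carried by a finite set. -/
theorem integral_map (h : FinitelySupported F S) {L : Euc D → Euc D} (hL : Measurable L)
    (f : Euc D → ℝ) : ∫ x, f x ∂(F.map L) = ∫ x, f (L x) ∂F := by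
  have hr : F.restrict ↑S = F := Measure.restrict_eq_self_of_ae_mem (mem_ae_iff.2 h.compl)
  refine MeasureTheory.integral_map hL.aemeasurable ?_
  have h' := h.map hL
  have := h'.prob
  have hr' : (F.map L).restrict ↑(S.image L) = F.map L :=
    Measure.restrict_eq_self_of_ae_mem (mem_ae_iff.2 h'.compl)
  rw [← hr']
  exact (IntegrableOn.finset (f := f)).aestronglyMeasurable

end FinitelySupported

/-- The squared maximum mean discrepancy of `F` and the image of `G` under `L`. -/
def populationT (σ : ℝ) (F G : Measure (Euc D)) (L : Euc D → Euc D) : ℝ :=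
  (∫ x, ∫ y, rbf σ x y ∂F ∂F) - 2 * (∫ x, ∫ y, rbf σ x (L y) ∂G ∂F)
    + ∫ x, ∫ y, rbf σ (L x) (L y) ∂G ∂G

variable {F G : Measure (Euc D)} {S T : Finset (Euc D)}

/-- Bilinear expansion turns the discrepancy into the quadratic form of the kernel at the signed
weights of F minus the image of G, where strict positive definiteness applies. -/
theorem populationT_eq_sum (hF : FinitelySupported F S) (hG : FinitelySupported G T)
    {L : Euc D → Euc D} (hL : Measurable L) :
    populationT σ F G L = ∑ x ∈ S ∪ T.image L, ∑ y ∈ S ∪ T.image L,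
      (F.real {x} - (G.map L).real {x}) * (F.real {y} - (G.map L).real {y}) * rbf σ x y := by
  set U := S ∪ T.image L
  have hF' : FinitelySupported F U := hF.mono Finset.subset_union_left
  have hG' : FinitelySupported (G.map L) U := (hG.map hL).mono Finset.subset_union_right
  have e2 : ∀ x, ∫ y, rbf σ x (L y) ∂G = ∫ y, rbf σ x y ∂(G.map L) := fun x =>
    (hG.integral_map hL fun y => rbf σ x y).symm
  have e3 : ∫ x, ∫ y, rbf σ (L x) (L y) ∂G ∂G
      = ∫ x, ∫ y, rbf σ x y ∂(G.map L) ∂(G.map L) := by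
    simp_rw [e2]
    exact (hG.integral_map hL fun x => ∫ y, rbf σ x y ∂(G.map L)).symm
  rw [populationT, e3]
  simp_rw [e2, hF'.integral_eq, hG'.integral_eq, Finset.mul_sum]
  have hswap : ∑ x ∈ U, ∑ y ∈ U, (G.map L).real {x} * F.real {y} * rbf σ x y
      = ∑ x ∈ U, ∑ y ∈ U, F.real {x} * (G.map L).real {y} * rbf σ x y := by
    rw [Finset.sum_comm]
    refine Finset.sum_congr rfl fun x _ => Finset.sum_congr rfl fun y _ => ?_
    rw [rbf, rbf, norm_sub_rev]; ring
  have hexp : ∑ x ∈ U, ∑ y ∈ U,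
      (F.real {x} - (G.map L).real {x}) * (F.real {y} - (G.map L).real {y}) * rbf σ x y
      = (∑ x ∈ U, ∑ y ∈ U, F.real {x} * F.real {y} * rbf σ x y)
        - (∑ x ∈ U, ∑ y ∈ U, F.real {x} * (G.map L).real {y} * rbf σ x y)
        - (∑ x ∈ U, ∑ y ∈ U, (G.map L).real {x} * F.real {y} * rbf σ x y)
        + ∑ x ∈ U, ∑ y ∈ U, (G.map L).real {x} * (G.map L).real {y} * rbf σ x y := by
    simp_rw [← Finset.sum_sub_distrib, ← Finset.sum_add_distrib]
    exact Finset.sum_congr rfl fun x _ => Finset.sum_congr rfl fun y _ => by ring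
  rw [hexp, hswap]
  simp_rw [← mul_assoc]
  have h2 : ∑ x ∈ U, ∑ y ∈ U, 2 * F.real {x} * (G.map L).real {y} * rbf σ x y
      = 2 * ∑ x ∈ U, ∑ y ∈ U, F.real {x} * (G.map L).real {y} * rbf σ x y := by
    simp_rw [Finset.mul_sum, ← mul_assoc]
  rw [h2]
  ring

theorem populationT_eq_zero (hF : FinitelySupported F S) (hG : FinitelySupported G T)
    {L : Euc D → Euc D} (hL : Measurable L) (h : F = G.map L) : populationT σ F G L = 0 := by
  rw [populationT_eq_sum hF hG hL, ← h]
  simp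

theorem populationT_pos (hσ : 0 < σ) (hF : FinitelySupported F S) (hG : FinitelySupported G T)
    {L : Euc D → Euc D} (hL : Measurable L) (h : F ≠ G.map L) : 0 < populationT σ F G L := by
  rw [populationT_eq_sum hF hG hL]
  apply sum_rbf_pos hσ
  by_contra hcon
  push Not at hcon
  exact h ((hF.mono Finset.subset_union_left).ext ((hG.map hL).mono Finset.subset_union_right)
    fun x hx => sub_eq_zero.1 (hcon x hx))

/-- Distributions of different motif are uniformly separated. -/
theorem exists_pos_le_populationT (hσ : 0 < σ) (hF : FinitelySupported F S)
    (hG : FinitelySupported G T) (h : ¬ SameMotif F G) :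
    ∃ t : ℝ, 0 < t ∧ ∀ W : Euc D ≃ₗᵢ[ℝ] Euc D, t ≤ populationT σ F G W := by
  -- The linear isometries form a compact set of operators and the discrepancy is continuous in the
  -- operator. The minimum is attained at an orthogonal map, where it is positive because the motifs
  -- differ.
  let K : Set (Euc D →L[ℝ] Euc D) := {L | ∀ x, ‖L x‖ = ‖x‖}
  have hKc : IsCompact K := by
    refine Metric.isCompact_of_isClosed_isBounded ?_ ?_
    · have : K = ⋂ x, {L : Euc D →L[ℝ] Euc D | ‖L x‖ = ‖x‖} := by ext; simp [K]
      rw [this]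
      refine isClosed_iInter fun x => isClosed_eq ?_ continuous_const
      fun_prop
    · refine (Metric.isBounded_closedBall (x := (0 : Euc D →L[ℝ] Euc D)) (r := 1)).subset ?_
      intro L hL
      rw [mem_closedBall_zero_iff]
      exact L.opNorm_le_bound zero_le_one fun x => by rw [hL x, one_mul]
  have hcont : Continuous fun L : Euc D →L[ℝ] Euc D => populationT σ F G L := by
    simp only [populationT, hF.integral_eq, hG.integral_eq, rbf]
    fun_prop
  have hne : K.Nonempty := ⟨ContinuousLinearMap.id ℝ _, fun x => rfl⟩
  obtain ⟨L, hLK, hL⟩ := hKc.exists_isMinOn hne hcont.continuousOn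
  let Li : Euc D →ₗᵢ[ℝ] Euc D := ⟨L.toLinearMap, hLK⟩
  let Le : Euc D ≃ₗᵢ[ℝ] Euc D := Li.toLinearIsometryEquiv rfl
  have hLe : (Le : Euc D → Euc D) = L := by
    ext1 x; rfl
  refine ⟨populationT σ F G L, populationT_pos hσ hF hG L.measurable ?_, fun W => ?_⟩
  · intro hFG
    exact h ⟨Le, by rw [hLe]; exact hFG⟩
  · have hmem : (W.toContinuousLinearEquiv : Euc D →L[ℝ] Euc D) ∈ K := fun x => W.norm_map x
    have h1 := isMinOn_iff.1 hL _ hmem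
    have h2 : ((W.toContinuousLinearEquiv : Euc D →L[ℝ] Euc D) : Euc D → Euc D) = W := rfl
    rwa [h2] at h1

end Population

/-! ### Sample statistics against population values. -/

section Sampling

variable {D : ℕ} {σ : ℝ} {F G : Measure (Euc D)} {S T : Finset (Euc D)}
  {U V : Type*} [Fintype U] [Fintype V]

/-- The average of `f` over the vertices. -/
def sampleMean (f : U → ℝ) : ℝ := (∑ u, f u) / Fintype.card U

theorem abs_average_le [Nonempty U] {f : U → ℝ} {r : ℝ} (h : ∀ u, |f u| ≤ r) : |sampleMean f| ≤ r := by
  have hc : (0 : ℝ) < Fintype.card U := by exact_mod_cast Fintype.card_pos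
  rw [sampleMean, abs_div, abs_of_pos hc, div_le_iff₀ hc]
  refine (Finset.abs_sum_le_sum_abs _ _).trans ((Finset.sum_le_sum fun u _ => h u).trans ?_)
  simp [mul_comm]

/-- The point cloud `X` has approximately the distribution `F`: its points are atoms and the total
deviation of the frequencies is at most `e`. -/
structure ApproxSample (F : Measure (Euc D)) (S : Finset (Euc D)) (X : U → Euc D) (e : ℝ) : Prop where
  mem : ∀ u, X u ∈ S
  freq : ∑ x ∈ S, |sampleMean (fun u => if X u = x then (1 : ℝ) else 0) - F.real {x}| ≤ e

theorem ApproxSample.abs_average_sub_le {X : U → Euc D} {e : ℝ} (hX : ApproxSample F S X e)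
    (hF : FinitelySupported F S) {f : Euc D → ℝ} (hf : ∀ x, |f x| ≤ 1) :
    |sampleMean (fun u => f (X u)) - ∫ x, f x ∂F| ≤ e := by
  rw [hF.integral_eq]
  have h1 : sampleMean (fun u => f (X u))
      = ∑ x ∈ S, sampleMean (fun u => if X u = x then (1 : ℝ) else 0) * f x := by
    simp only [sampleMean]
    simp_rw [div_mul_eq_mul_div]
    rw [← Finset.sum_div]
    congr 1
    simp_rw [Finset.sum_mul]
    rw [Finset.sum_comm]
    refine Finset.sum_congr rfl fun u _ => ?_
    simp [hX.mem u]
  rw [h1, ← Finset.sum_sub_distrib]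
  refine ((Finset.abs_sum_le_sum_abs _ _).trans (Finset.sum_le_sum fun x _ => ?_)).trans hX.freq
  rw [← sub_mul, abs_mul]
  exact mul_le_of_le_one_right (abs_nonneg _) (hf x)

theorem abs_rbf_le_one (x y : Euc D) : |rbf σ x y| ≤ 1 := by
  rw [abs_of_nonneg (rbf_nonneg _ _)]; exact rbf_le_one _ _

theorem abs_integral_le_one {H : Measure (Euc D)} [IsProbabilityMeasure H] {f : Euc D → ℝ}
    (hf : ∀ x, |f x| ≤ 1) : |∫ x, f x ∂H| ≤ 1 := by
  simpa using norm_integral_le_of_norm_le_const (μ := H) (f := f) (C := 1) (.of_forall hf)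

/-- The sample mean is replaced by the integral in one variable at a time, at a cost of e for each.
-/
theorem abs_average_average_sub_le [Nonempty U] {X : U → Euc D} {Y : V → Euc D} {e : ℝ}
    (hX : ApproxSample F S X e) (hY : ApproxSample G T Y e)
    (hF : FinitelySupported F S) (hG : FinitelySupported G T)
    {k : Euc D → Euc D → ℝ} (hk : ∀ x y, |k x y| ≤ 1) :
    |sampleMean (fun u => sampleMean fun v => k (X u) (Y v)) - ∫ x, ∫ y, k x y ∂G ∂F| ≤ 2 * e := by
  have := hG.prob
  have h1 := hX.abs_average_sub_le hF (f := fun x => ∫ y, k x y ∂G)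
    fun x => abs_integral_le_one (hk x)
  have h2 : |sampleMean (fun u => (sampleMean fun v => k (X u) (Y v)) - ∫ y, k (X u) y ∂G)| ≤ e :=
    abs_average_le fun u => hY.abs_average_sub_le hG (hk _)
  have e1 : sampleMean (fun u => (sampleMean fun v => k (X u) (Y v)) - ∫ y, k (X u) y ∂G)
      = sampleMean (fun u => sampleMean fun v => k (X u) (Y v)) - sampleMean fun u => ∫ y, k (X u) y ∂G := by
    simp [sampleMean, Finset.sum_sub_distrib, sub_div]
  rw [e1] at h2
  calc _ ≤ _ := abs_sub_le _ (sampleMean fun u => ∫ y, k (X u) y ∂G) _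
    _ ≤ e + e := add_le_add h2 h1
    _ = 2 * e := by ring

/-- Comparison of averages over pairs of distinct indices with averages over all pairs. -/
theorem abs_offDiag_sub_average_le {X : U → Euc D} (hU : 2 ≤ Fintype.card U) :
    |1 / ((Fintype.card U : ℝ) * ((Fintype.card U : ℝ) - 1)) *
        (∑ i, ∑ j, if j ≠ i then rbf σ (X i) (X j) else 0)
      - sampleMean (fun u => sampleMean fun v => rbf σ (X u) (X v))|
      ≤ 1 / ((Fintype.card U : ℝ) - 1) := by
  have hN : (2 : ℝ) ≤ Fintype.card U := by exact_mod_cast hU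
  set N : ℝ := ((Fintype.card U : ℕ) : ℝ) with hNdef
  set Q := ∑ i, ∑ j, rbf σ (X i) (X j) with hQ
  have h1 : (∑ i, ∑ j, if j ≠ i then rbf σ (X i) (X j) else 0) = Q - N := by
    have e : ∀ i j : U, (if j ≠ i then rbf σ (X i) (X j) else 0)
        = rbf σ (X i) (X j) - if j = i then 1 else 0 := by
      intro i j
      by_cases hj : j = i
      · subst hj; simp [rbf]
      · simp [hj]
    simp_rw [e, Finset.sum_sub_distrib]
    simp [hQ, hNdef]
  have h2 : sampleMean (fun u => sampleMean fun v => rbf σ (X u) (X v)) = Q / N ^ 2 := by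
    simp only [sampleMean, ← Finset.sum_div, hQ]
    rw [div_div, ← hNdef, sq]
  have hQ0 : 0 ≤ Q := Finset.sum_nonneg fun _ _ => Finset.sum_nonneg fun _ _ => rbf_nonneg _ _
  have hQ1 : Q ≤ N ^ 2 := by
    calc Q ≤ ∑ i : U, ∑ j : U, (1 : ℝ) := Finset.sum_le_sum fun _ _ => Finset.sum_le_sum
            fun _ _ => rbf_le_one _ _
      _ = N ^ 2 := by simp [hNdef, sq]
  rw [h1, h2]
  have h3 : 1 / (N * (N - 1)) * (Q - N) - Q / N ^ 2 = (Q / N ^ 2 - 1) / (N - 1) := by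
    have : N - 1 ≠ 0 := by linarith
    have : N ≠ 0 := by linarith
    field_simp
    ring
  have h4 : Q / N ^ 2 ≤ 1 := by rw [div_le_one (by positivity)]; exact hQ1
  have h5 : 0 ≤ Q / N ^ 2 := by positivity
  rw [h3, abs_div, abs_of_pos (show 0 < N - 1 by linarith)]
  refine div_le_div_of_nonneg_right ?_ (by linarith)
  rw [abs_le]; constructor <;> linarith

/-- Each of the two outer terms costs e for the omitted diagonal and 2 e for the double average; the
cross term costs twice 2 e. The bound is uniform in W, as taking the infimum requires. -/
theorem abs_testT_sub_populationT_le {X : U → Euc D} {Y : V → Euc D} {e : ℝ}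
    (hX : ApproxSample F S X e) (hY : ApproxSample G T Y e)
    (hF : FinitelySupported F S) (hG : FinitelySupported G T)
    (hU : 2 ≤ Fintype.card U) (hV : 2 ≤ Fintype.card V)
    (hUe : 1 / ((Fintype.card U : ℝ) - 1) ≤ e) (hVe : 1 / ((Fintype.card V : ℝ) - 1) ≤ e)
    (W : Euc D ≃ₗᵢ[ℝ] Euc D) :
    |testT σ X (fun v => W (Y v)) - populationT σ F G W| ≤ 10 * e := by
  have : Nonempty U := Fintype.card_pos_iff.1 (by omega)
  have : Nonempty V := Fintype.card_pos_iff.1 (by omega)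
  have a1 := abs_le.1 ((abs_offDiag_sub_average_le (σ := σ) (X := X) hU).trans hUe)
  have a2 := abs_le.1 (abs_average_average_sub_le hX hX hF hF (k := rbf σ) abs_rbf_le_one)
  have b1 := abs_le.1 ((abs_offDiag_sub_average_le (σ := σ) (X := fun v => W (Y v)) hV).trans hVe)
  have b2 := abs_le.1 (abs_average_average_sub_le hY hY hG hG
    (k := fun x y => rbf σ (W x) (W y)) fun _ _ => abs_rbf_le_one _ _)
  have c2 := abs_le.1 (abs_average_average_sub_le hX hY hF hG
    (k := fun x y => rbf σ x (W y)) fun _ _ => abs_rbf_le_one _ _)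
  have c1 : 2 / ((Fintype.card V : ℝ) * Fintype.card U) * (∑ i, ∑ k, rbf σ (X i) (W (Y k)))
      = 2 * sampleMean (fun u => sampleMean fun v => rbf σ (X u) (W (Y v))) := by
    simp only [sampleMean, ← Finset.sum_div]
    rw [div_div]; ring
  simp only [testT, populationT]
  rw [c1, abs_le]
  constructor <;> linarith [a1.1, a1.2, a2.1, a2.2, b1.1, b1.2, b2.1, b2.2, c2.1, c2.2]

theorem alignedT_le_of_sameMotif {X : U → Euc D} {Y : V → Euc D} {e : ℝ}
    (hX : ApproxSample F S X e) (hY : ApproxSample G T Y e)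
    (hF : FinitelySupported F S) (hG : FinitelySupported G T)
    (hU : 2 ≤ Fintype.card U) (hV : 2 ≤ Fintype.card V)
    (hUe : 1 / ((Fintype.card U : ℝ) - 1) ≤ e) (hVe : 1 / ((Fintype.card V : ℝ) - 1) ≤ e)
    (h : SameMotif F G) : alignedT σ X Y ≤ 10 * e := by
  obtain ⟨W, hW⟩ := h
  have h1 := (abs_le.1 (abs_testT_sub_populationT_le (σ := σ) hX hY hF hG hU hV hUe hVe W)).2
  rw [populationT_eq_zero hF hG W.continuous.measurable hW] at h1
  exact (ciInf_le (bddBelow_testT X Y) W).trans (by linarith)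

theorem le_alignedT {X : U → Euc D} {Y : V → Euc D} {e t : ℝ}
    (hX : ApproxSample F S X e) (hY : ApproxSample G T Y e)
    (hF : FinitelySupported F S) (hG : FinitelySupported G T)
    (hU : 2 ≤ Fintype.card U) (hV : 2 ≤ Fintype.card V)
    (hUe : 1 / ((Fintype.card U : ℝ) - 1) ≤ e) (hVe : 1 / ((Fintype.card V : ℝ) - 1) ≤ e)
    (h : ∀ W : Euc D ≃ₗᵢ[ℝ] Euc D, t ≤ populationT σ F G W) : t - 10 * e ≤ alignedT σ X Y := by
  refine le_ciInf fun W => ?_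
  have h1 := (abs_le.1 (abs_testT_sub_populationT_le (σ := σ) hX hY hF hG hU hV hUe hVe W)).1
  linarith [h W]

end Sampling

/-! ### Hoeffding's inequality. -/

section Concentration

/-- Two-sided Hoeffding inequality for independent variables with values in `[0,1]`. -/
theorem measure_abs_sum_sub_ge_le {Ω ι : Type*} [MeasurableSpace Ω] {ν : Measure Ω}
    [IsProbabilityMeasure ν] {Z : ι → Ω → ℝ} (hZ : iIndepFun Z ν) (hm : ∀ k, Measurable (Z k))
    (h01 : ∀ k ω, Z k ω ∈ Set.Icc (0 : ℝ) 1) {s : Finset ι} {n : ℕ} (hs : s.card ≤ n) (hn : 0 < n)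
    {ε : ℝ} (hε : 0 < ε) :
    ν {ω | ε * n < |∑ k ∈ s, (Z k ω - ν[Z k])|} ≤ ENNReal.ofReal (2 * Real.exp (-(2 * ε ^ 2) * n)) := by
  have hn' : (0 : ℝ) < n := by exact_mod_cast hn
  rcases s.eq_empty_or_nonempty with rfl | hne
  · have : {ω : Ω | ε * n < |∑ k ∈ (∅ : Finset ι), (Z k ω - ν[Z k])|} = ∅ := by
      ext ω
      simpa using (by positivity : 0 ≤ ε * n)
    rw [this]; simp
  have hs0 : (0 : ℝ) < s.card := by exact_mod_cast hne.card_pos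
  have hs' : (s.card : ℝ) ≤ n := by exact_mod_cast hs
  have hsub : ∀ k, HasSubgaussianMGF (fun ω => Z k ω - ν[Z k]) ((‖(1 : ℝ) - 0‖₊ / 2) ^ 2) ν :=
    fun k => hasSubgaussianMGF_of_mem_Icc (hm k).aemeasurable (.of_forall (h01 k))
  have hind : iIndepFun (fun k ω => Z k ω - ν[Z k]) ν :=
    hZ.comp (fun k z => z - ∫ ω, Z k ω ∂ν) fun k => by fun_prop
  have hind' : iIndepFun (fun k => -(fun ω => Z k ω - ν[Z k])) ν :=
    hind.comp (fun k z => -z) fun k => by fun_prop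
  -- Each variable has variance proxy 1 / 4, so the exponent is -2 (ε n)² / |s|, and |s| ≤ n.
  have hexp : Real.exp (-(ε * n) ^ 2 / (2 * ((∑ k ∈ s, (‖(1 : ℝ) - 0‖₊ / 2) ^ 2 : NNReal) : ℝ)))
      ≤ Real.exp (-(2 * ε ^ 2) * n) := by
    apply Real.exp_le_exp.2
    simp only [sub_zero, nnnorm_one, NNReal.coe_pow, NNReal.coe_div, NNReal.coe_one,
      NNReal.coe_ofNat, Finset.sum_const, nsmul_eq_mul, NNReal.coe_mul, NNReal.coe_natCast]
    rw [div_le_iff₀ (by positivity)]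
    nlinarith [mul_le_mul_of_nonneg_left hs' (show 0 ≤ ε ^ 2 * n by positivity)]
  have h1 := (HasSubgaussianMGF.measure_sum_ge_le_of_iIndepFun hind (s := s)
    (fun k _ => hsub k) (ε := ε * n) (by positivity)).trans hexp
  have h2 := (HasSubgaussianMGF.measure_sum_ge_le_of_iIndepFun hind' (s := s)
    (fun k _ => (hsub k).neg) (ε := ε * n) (by positivity)).trans hexp
  have h3 : {ω | ε * n < |∑ k ∈ s, (Z k ω - ν[Z k])|} ⊆
      {ω | ε * n ≤ ∑ k ∈ s, (Z k ω - ν[Z k])} ∪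
        {ω | ε * n ≤ ∑ k ∈ s, (-(fun ω => Z k ω - ν[Z k])) ω} := by
    intro ω hω
    have hω' : ε * n < |∑ k ∈ s, (Z k ω - ν[Z k])| := hω
    rcases lt_abs.1 hω' with h | h
    · exact Or.inl h.le
    · right
      change ε * n ≤ ∑ k ∈ s, -(Z k ω - ν[Z k])
      rw [Finset.sum_neg_distrib]; exact h.le
  have h4 := (measureReal_mono (μ := ν) h3).trans (measureReal_union_le _ _)
  rw [← ENNReal.ofReal_toReal (measure_ne_top ν _)]
  exact ENNReal.ofReal_le_ofReal (h4.trans (by linarith))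

end Concentration

/-! ### Graphs with independent edges and their codegrees. -/

section BernoulliGraph

/-- The Bernoulli law with parameter `q`. -/
def bernoulliLaw (q : ℝ) : Measure Bool :=
  ENNReal.ofReal q • Measure.dirac true + ENNReal.ofReal (1 - q) • Measure.dirac false

theorem bernoulliLaw_true (q : ℝ) : bernoulliLaw q {true} = ENNReal.ofReal q := by
  simp [bernoulliLaw]

theorem bernoulliLaw_false (q : ℝ) : bernoulliLaw q {false} = ENNReal.ofReal (1 - q) := by
  simp [bernoulliLaw]

theorem isProbabilityMeasure_bernoulliLaw {q : ℝ} (hq : q ∈ Set.Icc (0 : ℝ) 1) :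
    IsProbabilityMeasure (bernoulliLaw q) := by
  constructor
  simp only [bernoulliLaw, Measure.add_apply, Measure.smul_apply, measure_univ, smul_eq_mul, mul_one]
  rw [← ENNReal.ofReal_add hq.1 (by linarith [hq.2])]
  simp

variable {n : ℕ}

/-- The law of independent Bernoulli variables indexed by pairs of vertices. -/
def edgeLaw (p : Fin n → Fin n → ℝ) : Measure (Fin n × Fin n → Bool) :=
  Measure.pi fun e => bernoulliLaw (p e.1 e.2)

/-- The pair representing an edge, the larger vertex first. -/
def edgePair (i j : Fin n) : Fin n × Fin n := (max i j, min i j)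

theorem edgePair_eq_iff {i j k l : Fin n} :
    edgePair i j = edgePair k l ↔ (i = k ∧ j = l) ∨ (i = l ∧ j = k) := by
  simp only [edgePair, Prod.mk.injEq, max_def, min_def]
  grind

theorem edgePair_comm (i j : Fin n) : edgePair i j = edgePair j i := by
  simp [edgePair, max_comm, min_comm]

/-- The graph given by the edge variables. -/
def edgeGraph (θ : Fin n × Fin n → Bool) : SimpleGraph (Fin n) where
  Adj i j := i ≠ j ∧ θ (edgePair i j) = true
  symm := ⟨fun i j h => ⟨h.1.symm, by rw [edgePair_comm]; exact h.2⟩⟩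
  loopless := ⟨fun i h => h.1 rfl⟩

theorem edgeGraph_eq_iff (θ : Fin n × Fin n → Bool) (a : SimpleGraph (Fin n)) :
    edgeGraph θ = a ↔ ∀ e : Fin n × Fin n, e.2 < e.1 → (θ e = true ↔ a.Adj e.1 e.2) := by
  constructor
  · rintro rfl ⟨i, j⟩ hij
    have hij' : j < i := hij
    have : edgePair i j = (i, j) := by
      simp [edgePair, max_eq_left hij'.le, min_eq_right hij'.le]
    simp [edgeGraph, this, hij'.ne']
  · intro h
    have key : ∀ i j : Fin n, j < i → ((edgeGraph θ).Adj i j ↔ a.Adj i j) := by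
      intro i j hij
      have : edgePair i j = (i, j) := by
        simp [edgePair, max_eq_left hij.le, min_eq_right hij.le]
      rw [← h (i, j) hij]
      simp [edgeGraph, this, hij.ne']
    ext i j
    rcases lt_trichotomy i j with hij | rfl | hij
    · rw [SimpleGraph.adj_comm, key j i hij, SimpleGraph.adj_comm]
    · simp
    · exact key i j hij

variable {p : Fin n → Fin n → ℝ}

theorem isProbabilityMeasure_edgeLaw (hp : ∀ i j, p i j ∈ Set.Icc (0 : ℝ) 1) :
    IsProbabilityMeasure (edgeLaw p) := by
  have := fun e : Fin n × Fin n => isProbabilityMeasure_bernoulliLaw (hp e.1 e.2)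
  unfold edgeLaw
  infer_instance

/-- The coordinates (i, j) with i ≤ j are unconstrained and contribute factors 1, so the full
product measure reproduces the product over j < i from the definition of the model. -/
theorem edgeLaw_edgeGraph_eq (hp : ∀ i j, p i j ∈ Set.Icc (0 : ℝ) 1) (a : SimpleGraph (Fin n)) :
    edgeLaw p {θ | edgeGraph θ = a} = ENNReal.ofReal (∏ i : Fin n, ∏ j ∈ Finset.Iio i,
      if a.Adj i j then p i j else 1 - p i j) := by
  have hprob := fun e : Fin n × Fin n => isProbabilityMeasure_bernoulliLaw (hp e.1 e.2)
  have hset : {θ | edgeGraph θ = a} = Set.pi Set.univ fun e : Fin n × Fin n =>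
      if e.2 < e.1 then (if a.Adj e.1 e.2 then {true} else {false} : Set Bool) else Set.univ := by
    ext θ
    change edgeGraph θ = a ↔ _
    rw [edgeGraph_eq_iff, Set.mem_univ_pi]
    refine forall_congr' fun e => ?_
    by_cases he : e.2 < e.1 <;> by_cases ha : a.Adj e.1 e.2 <;> simp [he, ha]
  have hnn : ∀ i j, 0 ≤ (if a.Adj i j then p i j else 1 - p i j) := by
    intro i j
    split_ifs
    · exact (hp i j).1
    · linarith [(hp i j).2]
  rw [hset, edgeLaw, Measure.pi_pi, ENNReal.ofReal_prod_of_nonneg fun i _ =>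
    Finset.prod_nonneg fun j _ => hnn i j, Fintype.prod_prod_type]
  refine Finset.prod_congr rfl fun i _ => ?_
  rw [ENNReal.ofReal_prod_of_nonneg fun j _ => hnn i j]
  have h1 : Finset.Iio i = Finset.univ.filter fun j => j < i := by ext; simp
  rw [h1, Finset.prod_filter]
  refine Finset.prod_congr rfl fun j _ => ?_
  have h2 : bernoulliLaw (p i j) Set.univ = 1 := (hprob (i, j)).measure_univ
  by_cases hij : j < i <;> by_cases ha : a.Adj i j <;>
    simp only [hij, ha, if_true, if_false, bernoulliLaw_true, bernoulliLaw_false, h2]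

/-- The event that both `i k` and `k j` are edges. -/
def cherryEvent (i j k : Fin n) : Set (Fin n × Fin n → Bool) :=
  {θ | θ (edgePair i k) = true ∧ θ (edgePair k j) = true}

/-- For i ≠ j and k outside {i, j} the pairs {i, k} and {k, j} are all distinct, also for different
k, so the events depend on disjoint sets of independent coordinates. The product formula for all
finite s is their mutual independence. -/
theorem edgeLaw_biInter_cherryEvent (hp : ∀ i j, p i j ∈ Set.Icc (0 : ℝ) 1)
    (hsymm : ∀ i j, p i j = p j i) {i j : Fin n} (hij : i ≠ j)
    (s : Finset {k : Fin n // k ≠ i ∧ k ≠ j}) :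
    edgeLaw p (⋂ k ∈ s, cherryEvent i j k) = ∏ k ∈ s, ENNReal.ofReal (p i k * p k j) := by
  have hprob := fun e : Fin n × Fin n => isProbabilityMeasure_bernoulliLaw (hp e.1 e.2)
  have hcoord : iIndepFun (fun (e : Fin n × Fin n) (θ : Fin n × Fin n → Bool) => θ e) (edgeLaw p) :=
    iIndepFun_pi (X := fun _ => id) fun _ => aemeasurable_id
  let B : {k : Fin n // k ≠ i ∧ k ≠ j} → Finset (Fin n × Fin n) := fun k =>
    {edgePair i k, edgePair k j}
  have hset : (⋂ k ∈ s, cherryEvent i j k)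
      = ⋂ e ∈ s.biUnion B, {θ : Fin n × Fin n → Bool | θ e = true} := by
    ext θ
    simp only [Set.mem_iInter, Finset.mem_biUnion, cherryEvent, B, Finset.mem_insert,
      Finset.mem_singleton]
    constructor
    · rintro h e ⟨k, hk, rfl | rfl⟩
      · exact (h k hk).1
      · exact (h k hk).2
    · intro h k hk
      exact ⟨h _ ⟨k, hk, Or.inl rfl⟩, h _ ⟨k, hk, Or.inr rfl⟩⟩
  have hdisj : (s : Set {k : Fin n // k ≠ i ∧ k ≠ j}).PairwiseDisjoint B := by
    intro k _ l _ hkl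
    have hkl' : (k : Fin n) ≠ l := fun h => hkl (Subtype.ext h)
    have h1 := k.2
    have h2 := l.2
    simp only [Function.onFun, B, Finset.disjoint_left, Finset.mem_insert, Finset.mem_singleton]
    rintro e (rfl | rfl) <;> rw [edgePair_eq_iff, edgePair_eq_iff] <;> grind
  have hsingle : ∀ a b : Fin n, edgeLaw p {θ | θ (edgePair a b) = true} = ENNReal.ofReal (p a b) := by
    intro a b
    have : {θ : Fin n × Fin n → Bool | θ (edgePair a b) = true}
        = (fun θ => θ (edgePair a b)) ⁻¹' {true} := by ext; simp
    rw [this, ← Measure.map_apply (measurable_pi_apply _) (by measurability), edgeLaw,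
      (measurePreserving_eval (fun e : Fin n × Fin n => bernoulliLaw (p e.1 e.2)) _).map_eq,
      bernoulliLaw_true]
    congr 1
    simp only [edgePair]
    rcases le_total a b with h | h
    · rw [max_eq_right h, min_eq_left h, hsymm]
    · rw [max_eq_left h, min_eq_right h]
  rw [hset, hcoord.meas_biInter fun e _ => ⟨{true}, by measurability, by ext; simp⟩,
    Finset.prod_biUnion hdisj]
  refine Finset.prod_congr rfl fun k _ => ?_
  have hne : edgePair i (k : Fin n) ≠ edgePair k j := by
    have h1 := k.2
    rw [Ne, edgePair_eq_iff]
    grind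
  rw [Finset.prod_pair hne, hsingle, hsingle, ENNReal.ofReal_mul (hp _ _).1]

/-- Concentration of partial codegrees in a graph with independent edges. -/
theorem edgeLaw_codegree_le (hp : ∀ i j, p i j ∈ Set.Icc (0 : ℝ) 1) (hsymm : ∀ i j, p i j = p j i)
    {i j : Fin n} (hij : i ≠ j) (K : Finset (Fin n)) {ε : ℝ} (hε : 0 < ε) :
    edgeLaw p {θ | ε * n < |∑ k ∈ K.filter (fun k => k ≠ i ∧ k ≠ j),
      ((if (edgeGraph θ).Adj i k ∧ (edgeGraph θ).Adj k j then (1 : ℝ) else 0) - p i k * p k j)|}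
      ≤ ENNReal.ofReal (2 * Real.exp (-(2 * ε ^ 2) * n)) := by
  have hprob := isProbabilityMeasure_edgeLaw hp
  have hmeas : ∀ s : Set (Fin n × Fin n → Bool), MeasurableSet s := fun s => s.toFinite.measurableSet
  let ι := {k : Fin n // k ≠ i ∧ k ≠ j}
  have hev : ∀ k : ι, edgeLaw p (cherryEvent i j k) = ENNReal.ofReal (p i k * p k j) := by
    intro k
    simpa using edgeLaw_biInter_cherryEvent hp hsymm hij {k}
  have hset : iIndepSet (fun k : ι => cherryEvent i j (k : Fin n)) (edgeLaw p) := by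
    rw [iIndepSet_iff_meas_biInter fun k => hmeas _]
    intro s
    rw [edgeLaw_biInter_cherryEvent hp hsymm hij s]
    exact Finset.prod_congr rfl fun k _ => (hev k).symm
  have hind := hset.iIndepFun_indicator (β := ℝ) (m := inferInstance)
  have hmean : ∀ k : ι, ∫ θ, (cherryEvent i j (k : Fin n)).indicator (fun _ => (1 : ℝ)) θ ∂(edgeLaw p)
      = p i k * p k j := by
    intro k
    have : ∫ θ, (cherryEvent i j (k : Fin n)).indicator (fun _ => (1 : ℝ)) θ ∂(edgeLaw p)
        = (edgeLaw p).real (cherryEvent i j (k : Fin n)) := integral_indicator_one (hmeas _)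
    rw [this, measureReal_def, hev, ENNReal.toReal_ofReal (mul_nonneg (hp _ _).1 (hp _ _).1)]
  have hn : 0 < n := i.pos
  have key := measure_abs_sum_sub_ge_le hind (fun k => (measurable_const.indicator (hmeas _)))
    (fun k ω => by
      by_cases h : ω ∈ cherryEvent i j (k : Fin n) <;> simp [Set.indicator, h])
    (s := Finset.univ.filter fun k : ι => (k : Fin n) ∈ K) (n := n)
    ((Finset.card_le_univ _).trans (by
      simpa using Fintype.card_subtype_le fun k : Fin n => k ≠ i ∧ k ≠ j)) hn hε
  refine le_trans (measure_mono fun θ hθ => ?_) key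
  have hθ' : ε * n < |∑ k ∈ K.filter (fun k => k ≠ i ∧ k ≠ j),
      ((if (edgeGraph θ).Adj i k ∧ (edgeGraph θ).Adj k j then (1 : ℝ) else 0) - p i k * p k j)| := hθ
  change ε * n < |_|
  convert hθ' using 2
  refine Finset.sum_bij (fun k _ => (k : Fin n)) ?_ ?_ ?_ ?_
  · intro k hk
    simp only [Finset.mem_filter, Finset.mem_univ, true_and] at hk ⊢
    exact ⟨hk, k.2⟩
  · intro k _ l _ h
    exact Subtype.ext h
  · intro k hk
    simp only [Finset.mem_filter] at hk
    exact ⟨⟨k, hk.2⟩, by simpa using hk.1, rfl⟩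
  · intro k _
    rw [hmean]
    congr 1
    have h1 := k.2
    rw [Set.indicator_apply]
    refine if_congr ?_ rfl rfl
    simp [cherryEvent, edgeGraph, h1.1.symm, h1.2]

end BernoulliGraph

/-! ### Typical samples and their probability. -/

section GoodSample

variable {D : ℕ}

/-- The sampled positions and the graph are typical up to `ε`: all positions are atoms, the
frequencies of the atoms are close to their probabilities, and the number of common neighbours of
two vertices among the vertices with a given position is close to its conditional expectation. -/
structure IsTypical (F : Measure (Euc D)) (S : Finset (Euc D)) (ε : ℝ) {n : ℕ}
    (X : Fin n → Euc D) (a : SimpleGraph (Fin n)) : Prop where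
  mem : ∀ v, X v ∈ S
  count : ∀ x ∈ S, |((Finset.univ.filter fun v => X v = x).card : ℝ) - n * F.real {x}| ≤ ε * n
  codegree : ∀ x ∈ S, ∀ i j, i ≠ j →
    |∑ k ∈ (Finset.univ.filter fun v => X v = x).filter (fun k => k ≠ i ∧ k ≠ j),
      ((if a.Adj i k ∧ a.Adj k j then (1 : ℝ) else 0)
        - inner ℝ (X i) (X k) * inner ℝ (X k) (X j))| ≤ ε * n

variable {Ω : Type*} [MeasurableSpace Ω] {μ : Measure Ω} [IsProbabilityMeasure μ]
  {F : Measure (Euc D)} {S : Finset (Euc D)} {n : ℕ} {X : Ω → Fin n → Euc D}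
  {A : Ω → SimpleGraph (Fin n)}

theorem IsRDPG.measurable_apply (h : IsRDPG μ F X A) (i : Fin n) : Measurable fun ω => X ω i :=
  (measurable_pi_apply i).comp h.measurable_pos

theorem IsRDPG.measure_exists_not_mem (h : IsRDPG μ F X A) (hF : FinitelySupported F S) :
    μ {ω | ∃ v, X ω v ∉ S} = 0 := by
  have : {ω | ∃ v, X ω v ∉ S} = ⋃ v, (fun ω => X ω v) ⁻¹' (↑S)ᶜ := by ext; simp
  rw [this, measure_iUnion_null_iff]
  intro v
  rw [← Measure.map_apply (h.measurable_apply v) S.measurableSet.compl, h.law, hF.compl]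

theorem IsRDPG.measure_count_le (h : IsRDPG μ F X A) (hn : 0 < n) {ε : ℝ} (hε : 0 < ε)
    (x : Euc D) :
    μ {ω | ε * n < |((Finset.univ.filter fun v => X ω v = x).card : ℝ) - n * F.real {x}|}
      ≤ ENNReal.ofReal (2 * Real.exp (-(2 * ε ^ 2) * n)) := by
  have hm : Measurable (({x} : Set (Euc D)).indicator fun _ => (1 : ℝ)) :=
    measurable_const.indicator (measurableSet_singleton x)
  have hind : iIndepFun (fun i ω => ({x} : Set (Euc D)).indicator (fun _ => (1 : ℝ)) (X ω i)) μ :=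
    h.indep.comp (fun _ => ({x} : Set (Euc D)).indicator fun _ => (1 : ℝ)) fun _ => hm
  have hmean : ∀ i, ∫ ω, ({x} : Set (Euc D)).indicator (fun _ => (1 : ℝ)) (X ω i) ∂μ = F.real {x} := by
    intro i
    rw [← integral_map (h.measurable_apply i).aemeasurable hm.aestronglyMeasurable, h.law]
    exact integral_indicator_one (measurableSet_singleton x)
  have key := measure_abs_sum_sub_ge_le hind (fun i => hm.comp (h.measurable_apply i))
    (fun i ω => by by_cases hx : X ω i = x <;> simp [hx])
    (s := Finset.univ) (n := n) (by simp) hn hε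
  refine le_trans (measure_mono fun ω hω => ?_) key
  have hω' : ε * n < |((Finset.univ.filter fun v => X ω v = x).card : ℝ) - n * F.real {x}| := hω
  change ε * n < |_|
  convert hω' using 2
  simp_rw [hmean]
  rw [Finset.sum_sub_distrib]
  simp [Set.indicator_apply]

/-- Given X = y the graph has independent Bernoulli edges, and the bound for them is the same for
every y. Restricting to positions in S leaves finitely many y, over which the conditional bounds are
summed. -/
theorem IsRDPG.measure_codegree_le (h : IsRDPG μ F X A)
    (h01 : ∀ x ∈ S, ∀ y ∈ S, inner ℝ x y ∈ Set.Icc (0 : ℝ) 1) {ε : ℝ} (hε : 0 < ε)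
    (x : Euc D) {i j : Fin n} (hij : i ≠ j) :
    μ {ω | (∀ v, X ω v ∈ S) ∧
      ε * n < |∑ k ∈ (Finset.univ.filter fun v => X ω v = x).filter (fun k => k ≠ i ∧ k ≠ j),
      ((if (A ω).Adj i k ∧ (A ω).Adj k j then (1 : ℝ) else 0)
        - inner ℝ (X ω i) (X ω k) * inner ℝ (X ω k) (X ω j))|}
      ≤ ENNReal.ofReal (2 * Real.exp (-(2 * ε ^ 2) * n)) := by
  set r := ENNReal.ofReal (2 * Real.exp (-(2 * ε ^ 2) * n)) with hr
  let bad : (Fin n → Euc D) → SimpleGraph (Fin n) → Prop := fun y a =>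
    ε * n < |∑ k ∈ (Finset.univ.filter fun v => y v = x).filter (fun k => k ≠ i ∧ k ≠ j),
      ((if a.Adj i k ∧ a.Adj k j then (1 : ℝ) else 0) - inner ℝ (y i) (y k) * inner ℝ (y k) (y j))|
  let Y : Finset (Fin n → Euc D) := Fintype.piFinset fun _ => S
  have hmeasX : ∀ y : Fin n → Euc D, MeasurableSet {ω | X ω = y} := fun y =>
    h.measurable_pos (measurableSet_singleton y)
  have hone : ∀ y ∈ Y, μ {ω | X ω = y ∧ bad y (A ω)} ≤ μ {ω | X ω = y} * r := by
    intro y hy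
    have hyS : ∀ v, y v ∈ S := Fintype.mem_piFinset.1 hy
    set p : Fin n → Fin n → ℝ := fun i j => inner ℝ (y i) (y j) with hp
    have hp01 : ∀ i j, p i j ∈ Set.Icc (0 : ℝ) 1 := fun i j => h01 _ (hyS i) _ (hyS j)
    have hgraph : ∀ a, μ {ω | X ω = y ∧ A ω = a}
        = μ {ω | X ω = y} * edgeLaw p {θ | edgeGraph θ = a} := by
      intro a
      have h1 := h.cond a {y} (measurableSet_singleton y)
      simp only [Set.mem_singleton_iff] at h1
      rw [h1, edgeLaw_edgeGraph_eq hp01, mul_comm, ← setLIntegral_const]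
      refine setLIntegral_congr_fun (hmeasX y) fun ω hω => ?_
      have hω' : X ω = y := hω
      simp only [hω', hp]
    let s : Finset (SimpleGraph (Fin n)) := Finset.univ.filter fun a => bad y a
    calc μ {ω | X ω = y ∧ bad y (A ω)} ≤ μ (⋃ a ∈ s, {ω | X ω = y ∧ A ω = a}) := by
          refine measure_mono fun ω hω => ?_
          have hω' : X ω = y ∧ bad y (A ω) := hω
          simp only [Set.mem_iUnion]
          exact ⟨A ω, by simp [s, hω'.2], hω'.1, rfl⟩
      _ ≤ ∑ a ∈ s, μ {ω | X ω = y ∧ A ω = a} := measure_biUnion_finset_le _ _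
      _ = μ {ω | X ω = y} * ∑ a ∈ s, edgeLaw p {θ | edgeGraph θ = a} := by
          rw [Finset.mul_sum]
          exact Finset.sum_congr rfl fun a _ => hgraph a
      _ = μ {ω | X ω = y} * edgeLaw p {θ | bad y (edgeGraph θ)} := by
          rw [← measure_biUnion_finset]
          · congr 2
            ext θ
            simp [s]
          · intro a _ b _ hab
            rw [Function.onFun, Set.disjoint_left]
            intro θ h1 h2
            exact hab (Eq.trans (Eq.symm h1) h2)
          · exact fun a _ => (Set.toFinite _).measurableSet
      _ ≤ μ {ω | X ω = y} * r := by
          gcongr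
          exact edgeLaw_codegree_le hp01 (fun i j => real_inner_comm _ _) hij _ hε
  calc _ ≤ μ (⋃ y ∈ Y, {ω | X ω = y ∧ bad y (A ω)}) := by
        refine measure_mono fun ω hω => ?_
        simp only [Set.mem_iUnion]
        exact ⟨X ω, Fintype.mem_piFinset.2 hω.1, rfl, hω.2⟩
    _ ≤ ∑ y ∈ Y, μ {ω | X ω = y ∧ bad y (A ω)} := measure_biUnion_finset_le _ _
    _ ≤ ∑ y ∈ Y, μ {ω | X ω = y} * r := Finset.sum_le_sum hone
    _ = μ (⋃ y ∈ Y, {ω | X ω = y}) * r := by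
        rw [← Finset.sum_mul, measure_biUnion_finset]
        · intro a _ b _ hab
          rw [Function.onFun, Set.disjoint_left]
          intro θ h1 h2
          exact hab (Eq.trans (Eq.symm h1) h2)
        · exact fun y _ => hmeasX y
    _ ≤ 1 * r := by gcongr; exact prob_le_one
    _ = r := one_mul r

/-- Union bound over a null event, |S| events for the counts and at most |S| n² for the codegrees.
-/
theorem IsRDPG.measure_not_isTypical_le (h : IsRDPG μ F X A) (hF : FinitelySupported F S)
    (h01 : ∀ x ∈ S, ∀ y ∈ S, inner ℝ x y ∈ Set.Icc (0 : ℝ) 1) (hn : 0 < n) {ε : ℝ} (hε : 0 < ε) :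
    μ {ω | ¬ IsTypical F S ε (X ω) (A ω)}
      ≤ ENNReal.ofReal (4 * S.card * (n : ℝ) ^ 2 * Real.exp (-(2 * ε ^ 2) * n)) := by
  have hn1 : (1 : ℝ) ≤ n := by exact_mod_cast hn
  set e := Real.exp (-(2 * ε ^ 2) * n) with he
  have he0 : 0 < e := Real.exp_pos _
  let E₁ : Set Ω := ⋃ x ∈ S,
    {ω | ε * n < |((Finset.univ.filter fun v => X ω v = x).card : ℝ) - n * F.real {x}|}
  let I : Finset (Euc D × (Fin n × Fin n)) :=
    S ×ˢ (Finset.univ.filter fun q : Fin n × Fin n => q.1 ≠ q.2)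
  let E₂ : Set Ω := ⋃ q ∈ I, {ω | (∀ v, X ω v ∈ S) ∧
      ε * n < |∑ k ∈ (Finset.univ.filter fun v => X ω v = q.1).filter
        (fun k => k ≠ q.2.1 ∧ k ≠ q.2.2),
      ((if (A ω).Adj q.2.1 k ∧ (A ω).Adj k q.2.2 then (1 : ℝ) else 0)
        - inner ℝ (X ω q.2.1) (X ω k) * inner ℝ (X ω k) (X ω q.2.2))|}
  have hsub : {ω | ¬ IsTypical F S ε (X ω) (A ω)} ⊆ {ω | ∃ v, X ω v ∉ S} ∪ (E₁ ∪ E₂) := by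
    intro ω hω
    by_contra hcon
    simp only [Set.mem_union, not_or] at hcon
    obtain ⟨h1, h2, h3⟩ := hcon
    have h1' : ∀ v, X ω v ∈ S := by
      intro v
      by_contra hv
      exact h1 ⟨v, hv⟩
    refine hω ⟨h1', fun x hx => ?_, fun x hx i j hij => ?_⟩
    · by_contra hlt
      exact h2 (Set.mem_biUnion hx (not_le.1 hlt))
    · by_contra hlt
      refine h3 (Set.mem_biUnion (x := (x, (i, j))) ?_ ⟨h1', not_le.1 hlt⟩)
      simp [I, hx, hij]
  have hI : I.card ≤ S.card * n ^ 2 := by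
    rw [Finset.card_product]
    refine Nat.mul_le_mul_left _ ((Finset.card_le_univ _).trans ?_)
    simp [sq]
  have b1 : μ E₁ ≤ ∑ x ∈ S, ENNReal.ofReal (2 * e) :=
    (measure_biUnion_finset_le _ _).trans (Finset.sum_le_sum fun x _ => h.measure_count_le hn hε x)
  have b2 : μ E₂ ≤ ∑ q ∈ I, ENNReal.ofReal (2 * e) := by
    refine (measure_biUnion_finset_le _ _).trans (Finset.sum_le_sum fun q hq => ?_)
    refine h.measure_codegree_le h01 hε q.1 ?_
    simp only [I, Finset.mem_product, Finset.mem_filter] at hq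
    exact hq.2.2
  calc _ ≤ μ {ω | ∃ v, X ω v ∉ S} + (μ E₁ + μ E₂) :=
        (measure_mono hsub).trans ((measure_union_le _ _).trans
          (add_le_add le_rfl (measure_union_le _ _)))
    _ ≤ 0 + (∑ x ∈ S, ENNReal.ofReal (2 * e) + ∑ q ∈ I, ENNReal.ofReal (2 * e)) := by
        rw [h.measure_exists_not_mem hF]
        gcongr
    _ = ENNReal.ofReal (S.card * (2 * e) + I.card * (2 * e)) := by
        rw [zero_add, Finset.sum_const, Finset.sum_const, nsmul_eq_mul, nsmul_eq_mul,
          ENNReal.ofReal_add (by positivity) (by positivity),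
          ENNReal.ofReal_mul (p := (S.card : ℝ)) (by positivity),
          ENNReal.ofReal_mul (p := (I.card : ℝ)) (by positivity),
          ENNReal.ofReal_natCast, ENNReal.ofReal_natCast]
    _ ≤ _ := by
        apply ENNReal.ofReal_le_ofReal
        have hI' : (I.card : ℝ) ≤ S.card * (n : ℝ) ^ 2 := by exact_mod_cast hI
        have hS : (S.card : ℝ) ≤ S.card * (n : ℝ) ^ 2 :=
          le_mul_of_one_le_right (by positivity) (one_le_pow₀ hn1)
        nlinarith

end GoodSample

/-- Typical samples occur asymptotically almost surely. -/
theorem aas_of_isTypical {D : ℕ} {F : Measure (Euc D)} {S : Finset (Euc D)}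
    (hF : FinitelySupported F S) (h01 : ∀ x ∈ S, ∀ y ∈ S, inner ℝ x y ∈ Set.Icc (0 : ℝ) 1)
    {Ω : ℕ → Type*} [∀ n, MeasurableSpace (Ω n)] {μ : ∀ n, Measure (Ω n)}
    [∀ n, IsProbabilityMeasure (μ n)]
    {X : ∀ n, Ω n → Fin n → Euc D} {A : ∀ n, Ω n → SimpleGraph (Fin n)}
    (hXA : ∀ n, IsRDPG (μ n) F (X n) (A n)) {ε : ℝ} (hε : 0 < ε) (N : ℕ) {E : ∀ n, Set (Ω n)}
    (hE : ∀ n, N ≤ n → ∀ ω, IsTypical F S ε (X n ω) (A n ω) → ω ∈ E n) : AAS μ E := by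
  intro c hc
  -- The power 2 + c combines the n² of the union bound with the n^c needed to get below η > n^(-c).
  have hlim : Filter.Tendsto (fun x : ℝ => 4 * S.card * (x ^ (2 + c) * Real.exp (-(2 * ε ^ 2) * x)))
      Filter.atTop (nhds 0) := by
    simpa using (tendsto_rpow_mul_exp_neg_mul_atTop_nhds_zero (2 + c) (2 * ε ^ 2)
      (by positivity)).const_mul (4 * S.card : ℝ)
  have hev := (hlim.comp tendsto_natCast_atTop_atTop).eventually (gt_mem_nhds zero_lt_one)
  obtain ⟨n₁, hn₁⟩ := Filter.eventually_atTop.1 hev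
  refine ⟨max n₁ N, fun n hn η hη _ => ?_⟩
  have hn0 : 0 < n := lt_of_le_of_lt (Nat.zero_le _) hn
  have hn0' : (0 : ℝ) < n := by exact_mod_cast hn0
  have h1 : 4 * S.card * ((n : ℝ) ^ (2 + c) * Real.exp (-(2 * ε ^ 2) * n)) < 1 :=
    hn₁ n ((le_max_left _ _).trans hn.le)
  have h2 := (hXA n).measure_not_isTypical_le hF h01 hn0 hε
  have h3 : 4 * S.card * (n : ℝ) ^ 2 * Real.exp (-(2 * ε ^ 2) * n) ≤ η := by
    refine le_trans ?_ hη.le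
    rw [Real.rpow_neg hn0'.le, ← one_div, le_div_iff₀ (Real.rpow_pos_of_pos hn0' _)]
    refine le_trans (le_of_eq ?_) h1.le
    rw [Real.rpow_add hn0', Real.rpow_two]; ring
  have h4 : (1 : ENNReal) ≤ μ n (E n) + ENNReal.ofReal η := by
    calc (1 : ENNReal) = μ n Set.univ := measure_univ.symm
      _ ≤ μ n (E n ∪ {ω | ¬ IsTypical F S ε (X n ω) (A n ω)}) := by
          refine measure_mono fun ω _ => ?_
          by_cases hω : IsTypical F S ε (X n ω) (A n ω)
          · exact Or.inl (hE n ((le_max_right _ _).trans hn.le) ω hω)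
          · exact Or.inr hω
      _ ≤ _ := (measure_union_le _ _).trans (add_le_add le_rfl
          (h2.trans (ENNReal.ofReal_le_ofReal h3)))
  have hη0 : 0 ≤ η := (Real.rpow_nonneg hn0'.le _).trans hη.le
  rw [ENNReal.ofReal_sub _ hη0, ENNReal.ofReal_one]
  exact tsub_le_iff_right.2 h4

theorem exists_pos_forall_le {ι : Type*} [Finite ι] {f : ι → ℝ} (hf : ∀ i, 0 < f i) :
    ∃ t : ℝ, 0 < t ∧ ∀ i, t ≤ f i := by
  rcases isEmpty_or_nonempty ι with h | h
  · exact ⟨1, one_pos, fun i => h.elim i⟩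
  · obtain ⟨i, hi⟩ := Finite.exists_min f
    exact ⟨f i, hf i, hi⟩

/-! ### Laws, dimensions and sub-models of hierarchical blockmodels. -/

namespace HSBM

variable {D : ℕ}

theorem positions_finite : ∀ G : HSBM D, G.positions.Finite
  | sbm _ _ ξ => by simpa [positions] using Set.finite_range ξ
  | mix _ _ H => by simpa [positions] using Set.finite_iUnion fun i => positions_finite (H i)

/-- The finite set of latent positions. -/
def atoms (G : HSBM D) : Finset (Euc D) := G.positions_finite.toFinset

theorem mem_atoms {G : HSBM D} {x : Euc D} : x ∈ G.atoms ↔ x ∈ G.positions := by simp [atoms]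

theorem law_sbm_apply (K : ℕ) (w : Fin K → ℝ) (ξ : Fin K → Euc D) (B : Set (Euc D)) :
    (sbm K w ξ).law B = ∑ k, ENNReal.ofReal (w k) * Measure.dirac (ξ k) B := by
  simp [law]

theorem law_mix_apply (R : ℕ) (w : Fin R → ℝ) (H : Fin R → HSBM D) (B : Set (Euc D)) :
    (mix R w H).law B = ∑ i, ENNReal.ofReal (w i) * (H i).law B := by
  simp [law]

/-- All weights are positive, so every position is an atom. Positions may coincide; a single summand
already bounds the mass from below. -/
theorem isLevel_law (G : HSBM D) : ∀ ℓ, G.IsLevel ℓ →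
    IsProbabilityMeasure G.law ∧ G.law G.positionsᶜ = 0 ∧ ∀ x ∈ G.positions, 0 < G.law {x} := by
  induction G with
  | sbm K w ξ =>
    rintro ℓ ⟨-, hw, hsum⟩
    refine ⟨⟨?_⟩, ?_, ?_⟩
    · rw [law_sbm_apply]
      simp only [measure_univ, mul_one]
      rw [← ENNReal.ofReal_sum_of_nonneg fun k _ => (hw k).le, hsum, ENNReal.ofReal_one]
    · rw [law_sbm_apply]
      refine Finset.sum_eq_zero fun k _ => ?_
      rw [Measure.dirac_apply' _ (positions_finite _).measurableSet.compl]
      simp [positions]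
    · rintro x ⟨k, rfl⟩
      rw [law_sbm_apply]
      refine lt_of_lt_of_le ?_ (Finset.single_le_sum
        (f := fun j => ENNReal.ofReal (w j) * Measure.dirac (ξ j) {ξ k})
        (fun _ _ => zero_le) (Finset.mem_univ k))
      simpa using hw k
  | mix R w H ih =>
    rintro ℓ ⟨-, hw, hsum, hH, -⟩
    have ih' : ∀ i, IsProbabilityMeasure (H i).law ∧ (H i).law (H i).positionsᶜ = 0 ∧
        ∀ x ∈ (H i).positions, 0 < (H i).law {x} := fun i => by
      obtain ⟨h, -, hh⟩ := hH i
      exact ih i h hh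
    refine ⟨⟨?_⟩, ?_, ?_⟩
    · rw [law_mix_apply]
      have : ∀ i, (H i).law Set.univ = 1 := fun i => (ih' i).1.measure_univ
      simp only [this, mul_one]
      rw [← ENNReal.ofReal_sum_of_nonneg fun k _ => (hw k).1.le, hsum, ENNReal.ofReal_one]
    · rw [law_mix_apply]
      refine Finset.sum_eq_zero fun i _ => ?_
      rw [measure_mono_null _ (ih' i).2.1, mul_zero]
      refine Set.compl_subset_compl.2 ?_
      simpa only [positions] using Set.subset_iUnion (fun i => (H i).positions) i
    · intro x hx
      obtain ⟨i, hi⟩ := Set.mem_iUnion.1 (by simpa only [positions] using hx)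
      rw [law_mix_apply]
      refine lt_of_lt_of_le ?_ (Finset.single_le_sum
        (f := fun j => ENNReal.ofReal (w j) * (H j).law {x})
        (fun _ _ => zero_le) (Finset.mem_univ i))
      exact ENNReal.mul_pos (by simpa using (hw i).1) ((ih' i).2.2 x hi).ne'

theorem IsLevel.finitelySupported {G : HSBM D} {ℓ : ℕ} (h : G.IsLevel ℓ) :
    FinitelySupported G.law G.atoms := by
  obtain ⟨h1, h2, -⟩ := G.isLevel_law ℓ h
  exact ⟨h1, by simpa [atoms] using h2⟩

theorem IsLevel.law_real_pos {G : HSBM D} {ℓ : ℕ} (h : G.IsLevel ℓ) {x : Euc D}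
    (hx : x ∈ G.positions) : 0 < G.law.real {x} := by
  obtain ⟨h1, -, h3⟩ := G.isLevel_law ℓ h
  exact ENNReal.toReal_pos (h3 x hx).ne' (measure_ne_top _ _)

theorem IsLevel.positions_nonempty {G : HSBM D} {ℓ : ℕ} (h : G.IsLevel ℓ) : G.positions.Nonempty := by
  by_contra hne
  have h1 := h.finitelySupported.sum_real
  have : G.atoms = ∅ := by
    simpa [atoms, Set.not_nonempty_iff_eq_empty] using hne
  simp [this] at h1

/-- The dimension of the model is the dimension of the span of the latent positions. -/
theorem IsLevel.dim_eq {G : HSBM D} {ℓ : ℕ} (h : G.IsLevel ℓ) :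
    G.dim = Module.finrank ℝ (Submodule.span ℝ G.positions) := by
  -- The second moment matrix is YᵀY and has the row rank of Y; rescaling the atoms by roots of
  -- positive masses does not change their span.
  let Y : Matrix G.atoms (Fin D) ℝ := fun x a => √(G.law.real {(x : Euc D)}) * (x : Euc D) a
  have hY : G.secondMoment = Y.transpose * Y := by
    ext a b
    rw [secondMoment, h.finitelySupported.integral_eq, Matrix.mul_apply,
      ← Finset.sum_coe_sort G.atoms]
    refine Finset.sum_congr rfl fun x _ => ?_
    have := Real.mul_self_sqrt (measureReal_nonneg (μ := G.law) (s := {(x : Euc D)}))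
    rw [Matrix.transpose_apply]
    simp only [Y]
    calc _ = (√(G.law.real {(x : Euc D)}) * √(G.law.real {(x : Euc D)}))
          * ((x : Euc D) a * (x : Euc D) b) := by rw [this]
      _ = _ := by ring
  rw [dim, hY, Matrix.rank_transpose_mul_self, Matrix.rank_eq_finrank_span_row]
  have hspan : Submodule.span ℝ (Set.range Y.row)
      = (Submodule.span ℝ G.positions).map (WithLp.linearEquiv 2 ℝ (Fin D → ℝ)).toLinearMap := by
    rw [Submodule.map_span]
    apply le_antisymm
    · rw [Submodule.span_le]
      rintro _ ⟨x, rfl⟩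
      have e : Y.row x = √(G.law.real {(x : Euc D)}) •
          (WithLp.linearEquiv 2 ℝ (Fin D → ℝ)).toLinearMap (x : Euc D) := by
        ext a; simp [Y, Matrix.row]
      rw [e]
      exact Submodule.smul_mem _ _ (Submodule.subset_span ⟨x, mem_atoms.1 x.2, rfl⟩)
    · rw [Submodule.span_le]
      rintro _ ⟨x, hx, rfl⟩
      have hpos : √(G.law.real {x}) ≠ 0 := (Real.sqrt_pos.2 (h.law_real_pos hx)).ne'
      have e : (WithLp.linearEquiv 2 ℝ (Fin D → ℝ)).toLinearMap x
          = (√(G.law.real {x}))⁻¹ • Y.row ⟨x, mem_atoms.2 hx⟩ := by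
        ext a; simp [Y, Matrix.row, hpos]
      rw [e]
      exact Submodule.smul_mem _ _ (Submodule.subset_span ⟨_, rfl⟩)
  rw [hspan]
  exact LinearEquiv.finrank_map_eq _ _

theorem dim_le (G : HSBM D) : G.dim ≤ D := by
  simpa [dim] using G.secondMoment.rank_le_width

/-- `G` is a sub-model of an affine hierarchical model with law `F` and atoms `S`. -/
structure IsNode (F : Measure (Euc D)) (S : Finset (Euc D)) (G : HSBM D) : Prop where
  level : ∃ ℓ, G.IsLevel ℓ
  affinity : G.Affinity
  subset : ∀ x ∈ G.positions, x ∈ S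
  inner_mem : ∀ x ∈ S, ∀ y ∈ S, inner ℝ x y ∈ Set.Icc (0 : ℝ) 1
  mass : ∃ β : ℝ, 0 < β ∧ ∀ x ∈ G.positions, F.real {x} = β * G.law.real {x}

variable {F : Measure (Euc D)} {S : Finset (Euc D)}

theorem positions_subset_mix {R : ℕ} (w : Fin R → ℝ) (H : Fin R → HSBM D) (r : Fin R) :
    (H r).positions ⊆ (mix R w H).positions := by
  simpa [positions] using Set.subset_iUnion (fun i => (H i).positions) r

/-- A position shared by two components would satisfy ⟪x, x⟫ < ⟪x, x⟫, so affinity makes the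
supports disjoint and membership readable from the position. -/
theorem eq_of_mem_positions {R : ℕ} {w : Fin R → ℝ} {H : Fin R → HSBM D}
    (hA : (mix R w H).Affinity) {x : Euc D} {i j : Fin R} (hi : x ∈ (H i).positions)
    (hj : x ∈ (H j).positions) : i = j := by
  by_contra hne
  exact lt_irrefl _ (hA.1 i j hne x hi x hj i x hi x hi)

/-- At an atom of one component the others have no mass, so the root law is still proportional to
the law of the component, with β multiplied by its weight. In this way counts controlled by the root
law are usable at every level. -/
theorem IsNode.child {R : ℕ} {w : Fin R → ℝ} {H : Fin R → HSBM D} (h : IsNode F S (mix R w H))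
    (r : Fin R) : IsNode F S (H r) := by
  obtain ⟨ℓ, hℓ⟩ := h.level
  obtain ⟨β, hβ, hmass⟩ := h.mass
  obtain ⟨-, hw, -, hH, -⟩ := hℓ
  refine ⟨?_, h.affinity.2 r, fun x hx => h.subset x (positions_subset_mix w H r hx), h.inner_mem,
    β * w r, mul_pos hβ (hw r).1, fun x hx => ?_⟩
  · obtain ⟨k, -, hk⟩ := hH r
    exact ⟨k, hk⟩
  · rw [hmass x (positions_subset_mix w H r hx), mul_assoc]
    congr 1
    rw [measureReal_def, law_mix_apply, Finset.sum_eq_single r, ENNReal.toReal_mul,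
      ENNReal.toReal_ofReal (hw r).1.le, measureReal_def]
    · intro j _ hj
      obtain ⟨k, -, hk⟩ := hH j
      obtain ⟨-, h0, -⟩ := (H j).isLevel_law k hk
      rw [measure_mono_null _ h0, mul_zero]
      rintro _ rfl hx'
      exact hj (eq_of_mem_positions h.affinity hx' hx)
    · simp

/-- The vertices whose positions belong to `G`. -/
def verts (G : HSBM D) {n : ℕ} (X : Fin n → Euc D) : Finset (Fin n) :=
  Finset.univ.filter fun v => X v ∈ G.positions

theorem mem_verts {G : HSBM D} {n : ℕ} {X : Fin n → Euc D} {v : Fin n} :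
    v ∈ G.verts X ↔ X v ∈ G.positions := by simp [verts]

theorem members_verts {R : ℕ} (w : Fin R → ℝ) (H : Fin R → HSBM D) (r : Fin R) {n : ℕ}
    (X : Fin n → Euc D) : (H r).members X ((mix R w H).verts X) = (H r).verts X := by
  ext v
  simp only [members, Finset.mem_filter, mem_verts]
  exact ⟨fun h => h.2, fun h => ⟨positions_subset_mix w H r h, h⟩⟩

end HSBM

/-! ### Properties of all large, sufficiently typical samples. -/

theorem IsTypical.mono {D : ℕ} {F : Measure (Euc D)} {S : Finset (Euc D)} {ε ε' : ℝ} (hε : ε ≤ ε')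
    {n : ℕ} {X : Fin n → Euc D} {a : SimpleGraph (Fin n)} (h : IsTypical F S ε X a) :
    IsTypical F S ε' X a := by
  have : ε * n ≤ ε' * n := mul_le_mul_of_nonneg_right hε (Nat.cast_nonneg n)
  exact ⟨h.mem, fun x hx => (h.count x hx).trans this, fun x hx i j hij =>
    (h.codegree x hx i j hij).trans this⟩

/-- The property `P` holds for all sufficiently large, sufficiently typical samples. -/
def EventuallyTypical {D : ℕ} (F : Measure (Euc D)) (S : Finset (Euc D))
    (P : ∀ n, (Fin n → Euc D) → SimpleGraph (Fin n) → Prop) : Prop :=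
  ∀ᶠ N : ℕ in Filter.atTop, ∀ n, N ≤ n → ∀ X a, IsTypical F S (1 / ((N : ℝ) + 1)) X a → P n X a

section EventuallyTypical

variable {D : ℕ} {F : Measure (Euc D)} {S : Finset (Euc D)}

/-- One index N governs both tolerance and size, so finite conjunctions reduce to those of a filter.
-/
theorem EventuallyTypical.intro {P : ∀ n, (Fin n → Euc D) → SimpleGraph (Fin n) → Prop}
    {ε : ℝ} (hε : 0 < ε) (r : ℝ)
    (h : ∀ (n : ℕ) X a, r ≤ n → IsTypical F S ε X a → P n X a) : EventuallyTypical F S P := by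
  have h1 := tendsto_one_div_add_atTop_nhds_zero_nat.eventually (gt_mem_nhds hε)
  have h2 := (tendsto_natCast_atTop_atTop (R := ℝ)).eventually (Filter.eventually_ge_atTop r)
  filter_upwards [h1, h2] with N hN1 hN2 n hn X a hX
  exact h n X a (hN2.trans (by exact_mod_cast hn)) (hX.mono hN1.le)

theorem EventuallyTypical.exists {P : ∀ n, (Fin n → Euc D) → SimpleGraph (Fin n) → Prop}
    (h : EventuallyTypical F S P) :
    ∃ ε : ℝ, 0 < ε ∧ ∃ N : ℕ, ∀ n, N ≤ n → ∀ X a, IsTypical F S ε X a → P n X a := by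
  obtain ⟨N, hN⟩ := Filter.Eventually.exists h
  exact ⟨1 / ((N : ℝ) + 1), by positivity, N, hN⟩

theorem EventuallyTypical.mono {P Q : ∀ n, (Fin n → Euc D) → SimpleGraph (Fin n) → Prop}
    (h : EventuallyTypical F S P) (hPQ : ∀ n X a, P n X a → Q n X a) : EventuallyTypical F S Q :=
  Filter.Eventually.mono h fun _ hN n hn X a hX => hPQ n X a (hN n hn X a hX)

theorem EventuallyTypical.and {P Q : ∀ n, (Fin n → Euc D) → SimpleGraph (Fin n) → Prop}
    (hP : EventuallyTypical F S P) (hQ : EventuallyTypical F S Q) :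
    EventuallyTypical F S fun n X a => P n X a ∧ Q n X a :=
  (Filter.Eventually.and hP hQ).mono fun _ hN n hn X a hX =>
    ⟨hN.1 n hn X a hX, hN.2 n hn X a hX⟩

theorem EventuallyTypical.all {ι : Type*} [Finite ι]
    {P : ι → ∀ n, (Fin n → Euc D) → SimpleGraph (Fin n) → Prop}
    (h : ∀ i, EventuallyTypical F S (P i)) :
    EventuallyTypical F S fun n X a => ∀ i, P i n X a :=
  (Filter.eventually_all.2 h).mono fun _ hN n hn X a hX i => hN i n hn X a hX

end EventuallyTypical

/-! ### One round on a sub-model, and the recursion. -/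

namespace HSBM

variable {D : ℕ} {F : Measure (Euc D)} {S : Finset (Euc D)} {G : HSBM D}

theorem verts_filter_eq {n : ℕ} (X : Fin n → Euc D) {x : Euc D} (hx : x ∈ G.positions) :
    (G.verts X).filter (fun v => X v = x) = Finset.univ.filter fun v => X v = x := by
  ext v
  simp only [Finset.mem_filter, mem_verts, Finset.mem_univ, true_and]
  exact ⟨fun h => h.2, fun h => ⟨h ▸ hx, h⟩⟩

theorem sum_verts_eq {n : ℕ} (X : Fin n → Euc D) (f : Euc D → ℝ) :
    ∑ v : G.verts X, f (X v)
      = ∑ x ∈ G.atoms, ((Finset.univ.filter fun v => X v = x).card : ℝ) * f x := by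
  rw [Finset.sum_coe_sort (G.verts X) fun v => f (X v),
    ← Finset.sum_fiberwise_of_maps_to (t := G.atoms) (g := X)
      fun v hv => mem_atoms.2 (mem_verts.1 hv)]
  refine Finset.sum_congr rfl fun x hx => ?_
  rw [verts_filter_eq X (mem_atoms.1 hx), Finset.sum_congr rfl (g := fun _ => f x)]
  · simp
  · intro v hv
    rw [(Finset.mem_filter.1 hv).2]

theorem IsNode.norm_le_one (h : IsNode F S G) {x : Euc D} (hx : x ∈ G.positions) : ‖x‖ ≤ 1 := by
  have h1 := (h.inner_mem x (h.subset x hx) x (h.subset x hx)).2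
  rw [real_inner_self_eq_norm_sq] at h1
  nlinarith [norm_nonneg x]

/-- All atoms of a sub-model occur with positive frequency. -/
theorem IsNode.exists_count (h : IsNode F S G) : ∃ κ : ℝ, 0 < κ ∧
    EventuallyTypical F S fun n X _ => 0 < n ∧ ∀ x ∈ G.positions,
      κ * n ≤ ((Finset.univ.filter fun v => X v = x).card : ℝ) := by
  obtain ⟨ℓ, hℓ⟩ := h.level
  obtain ⟨β, hβ, hmass⟩ := h.mass
  obtain ⟨m, hm, hmle⟩ := exists_pos_forall_le (ι := G.atoms) (f := fun x => F.real {(x : Euc D)})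
    fun x => by
      rw [hmass x (mem_atoms.1 x.2)]
      exact mul_pos hβ (hℓ.law_real_pos (mem_atoms.1 x.2))
  refine ⟨m / 2, half_pos hm, EventuallyTypical.intro (half_pos hm) 1 fun n X a hn hX => ?_⟩
  refine ⟨by exact_mod_cast lt_of_lt_of_le one_pos hn, fun x hx => ?_⟩
  have h1 := (abs_le.1 (hX.count x (h.subset x hx))).1
  have h2 : m ≤ F.real {x} := hmle ⟨x, mem_atoms.2 hx⟩
  nlinarith

/-- A vector of the span orthogonal to all positions is zero, and an injective linear map in finite
dimension is bounded below. Multiplied by the frequency of the atoms, c bounds the nonzero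
eigenvalues of the Gram matrix. -/
theorem exists_coercive (G : HSBM D) : ∃ c : ℝ, 0 < c ∧ ∀ y ∈ Submodule.span ℝ G.positions,
    c * ‖y‖ ^ 2 ≤ ∑ x ∈ G.atoms, inner ℝ x y ^ 2 := by
  let f : Submodule.span ℝ G.positions →ₗ[ℝ] EuclideanSpace ℝ G.atoms :=
    (WithLp.linearEquiv 2 ℝ (G.atoms → ℝ)).symm.toLinearMap.comp
      (LinearMap.pi fun x : G.atoms => (innerₛₗ ℝ (x : Euc D)).comp (Submodule.subtype _))
  have hf : ∀ y (x : G.atoms), f y x = inner ℝ (x : Euc D) (y : Euc D) := fun y x => rfl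
  have hker : LinearMap.ker f = ⊥ := by
    rw [LinearMap.ker_eq_bot']
    intro y hy
    have h1 : ∀ x ∈ G.positions, inner ℝ x (y : Euc D) = 0 := fun x hx => by
      have := hf y ⟨x, mem_atoms.2 hx⟩
      rw [hy] at this
      simpa using this.symm
    have h2 : (y : Euc D) ∈ (Submodule.span ℝ G.positions)ᗮ := by
      rw [Submodule.mem_orthogonal]
      intro u hu
      induction hu using Submodule.span_induction with
      | mem x hx => exact h1 x hx
      | zero => simp
      | add u v _ _ hu hv => rw [inner_add_left, hu, hv, add_zero]
      | smul r u _ hu => rw [inner_smul_left, hu, mul_zero]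
    have h3 : inner ℝ (y : Euc D) (y : Euc D) = 0 := Submodule.inner_right_of_mem_orthogonal y.2 h2
    ext1
    simpa using h3
  obtain ⟨K, hK, hanti⟩ := f.exists_antilipschitzWith hker
  have hK' : (0 : ℝ) < K := hK
  refine ⟨1 / (K : ℝ) ^ 2, by positivity, fun y hy => ?_⟩
  have h1 := hanti.le_mul_dist ⟨y, hy⟩ 0
  rw [map_zero, dist_zero_right, dist_zero_right] at h1
  have h2 : ‖f ⟨y, hy⟩‖ ^ 2 = ∑ x ∈ G.atoms, inner ℝ x y ^ 2 := by
    rw [EuclideanSpace.norm_sq_eq, ← Finset.sum_coe_sort G.atoms]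
    exact Finset.sum_congr rfl fun x _ => by rw [hf]; simp
  rw [← h2, div_mul_eq_mul_div, one_mul, div_le_iff₀ (by positivity), ← mul_pow]
  refine pow_le_pow_left₀ (norm_nonneg _) ?_ 2
  rw [mul_comm]
  exact h1

theorem transpose_mul_adjOn {n : ℕ} (a : SimpleGraph (Fin n)) (V : Finset (Fin n)) (u v : V) :
    ((adjOn a V).transpose * adjOn a V) u v
      = ∑ w ∈ V, if a.Adj u w ∧ a.Adj w v then (1 : ℝ) else 0 := by
  rw [Matrix.mul_apply, ← Finset.sum_coe_sort V]
  refine Finset.sum_congr rfl fun w _ => ?_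
  simp only [Matrix.transpose_apply, adjOn, a.adj_comm u w]
  by_cases h1 : a.Adj w u <;> by_cases h2 : a.Adj w v <;> simp [h1, h2]

/-- The codegrees of the subgraph of a sub-model. -/
theorem IsNode.abs_codegree_sub_le (h : IsNode F S G) {n : ℕ} {X : Fin n → Euc D}
    {a : SimpleGraph (Fin n)} {ε : ℝ} (hε : 0 ≤ ε) (hX : IsTypical F S ε X a) (u v : G.verts X)
    (huv : u ≠ v) :
    |((adjOn a (G.verts X)).transpose * adjOn a (G.verts X)) u v
      - ∑ w : G.verts X, inner ℝ (X u) (X w) * inner ℝ (X w) (X v)| ≤ S.card * (ε * n) + 2 := by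
  have huv' : (u : Fin n) ≠ v := fun e => huv (Subtype.ext e)
  have h01 : ∀ i j, inner ℝ (X i) (X j) ∈ Set.Icc (0 : ℝ) 1 := fun i j =>
    h.inner_mem _ (hX.mem i) _ (hX.mem j)
  rw [transpose_mul_adjOn,
    Finset.sum_coe_sort (G.verts X) fun w => inner ℝ (X u) (X w) * inner ℝ (X w) (X v),
    ← Finset.sum_sub_distrib,
    -- The endpoints u and v are excluded from the typical codegrees; they account for at most two
    -- terms of size 1, the summand 2 of the bound.
    ← Finset.sum_filter_add_sum_filter_not (G.verts X) fun k => k ≠ (u : Fin n) ∧ k ≠ (v : Fin n)]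
  refine (abs_add_le _ _).trans (add_le_add ?_ ?_)
  · rw [← Finset.sum_fiberwise_of_maps_to (t := G.atoms) (g := X)
      fun w hw => mem_atoms.2 (mem_verts.1 (Finset.mem_filter.1 hw).1)]
    refine (Finset.abs_sum_le_sum_abs _ _).trans ?_
    calc _ ≤ ∑ x ∈ G.atoms, ε * n := by
          refine Finset.sum_le_sum fun x hx => ?_
          have := hX.codegree x (h.subset x (mem_atoms.1 hx)) u v huv'
          rwa [← verts_filter_eq X (mem_atoms.1 hx), Finset.filter_comm] at this
      _ = G.atoms.card * (ε * n) := by simp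
      _ ≤ _ := by
          have : G.atoms.card ≤ S.card :=
            Finset.card_le_card fun x hx => h.subset x (mem_atoms.1 hx)
          have : (G.atoms.card : ℝ) ≤ S.card := by exact_mod_cast this
          exact mul_le_mul_of_nonneg_right this (by positivity)
  · have hsub : (G.verts X).filter (fun k => ¬ (k ≠ (u : Fin n) ∧ k ≠ (v : Fin n)))
        ⊆ {(u : Fin n), (v : Fin n)} := by
      intro k hk
      have := (Finset.mem_filter.1 hk).2
      simp only [Finset.mem_insert, Finset.mem_singleton]
      tauto
    refine (Finset.abs_sum_le_sum_abs _ _).trans ?_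
    refine (Finset.sum_le_card_nsmul _ _ 1 fun w _ => ?_).trans ?_
    · have b1 := mul_nonneg (h01 u w).1 (h01 w v).1
      have b2 := mul_le_one₀ (h01 u w).2 (h01 w v).1 (h01 w v).2
      rw [abs_le]
      split_ifs <;> constructor <;> linarith
    · rw [nsmul_eq_mul, mul_one]
      exact_mod_cast (Finset.card_le_card hsub).trans Finset.card_le_two

/-- Uniform consistency of the adjacency spectral embedding of a sub-model. -/
theorem IsNode.gram (h : IsNode F S G) {δ : ℝ} (hδ : 0 < δ) :
    EventuallyTypical F S fun _ X a => ∀ Xh : G.verts X → Euc G.dim,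
      IsASE (adjOn a (G.verts X)) Xh →
      ∀ u v, |inner ℝ (Xh u) (Xh v) - inner ℝ (X u) (X v)| ≤ δ := by
  obtain ⟨ℓ, hℓ⟩ := h.level
  obtain ⟨κ, hκ, hcount⟩ := h.exists_count
  obtain ⟨lam, hlam, hcoer⟩ := G.exists_coercive
  set c := min 1 (κ * lam) with hc
  have hc0 : 0 < c := lt_min one_pos (mul_pos hκ hlam)
  have hc1 : c ≤ 1 := min_le_left _ _
  set η := min (c / 2) (δ * (c / 2) ^ 7 / 600) with hη
  have hη0 : 0 < η := lt_min (by positivity) (by positivity)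
  have hηc : 2 * η ≤ c := by have := min_le_left (c / 2) (δ * (c / 2) ^ 7 / 600); linarith
  have hηδ : 600 * η / (c / 2) ^ 7 ≤ δ := by
    have := min_le_right (c / 2) (δ * (c / 2) ^ 7 / 600)
    rw [div_le_iff₀ (by positivity)]
    linarith
  -- Half of η² pays for the codegree errors of all atoms. The other half pays for 3 / n, namely 2 /
  -- n from the two endpoints and 1 / n from the diagonal, whence n ≥ 6 / η².
  set ε := η ^ 2 / (2 * (S.card + 1)) with hε
  have hε0 : 0 < ε := by positivity
  refine (hcount.and (EventuallyTypical.intro (P := fun n X a => 6 / η ^ 2 ≤ (n : ℝ) ∧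
    IsTypical F S ε X a) hε0 (6 / η ^ 2) fun n X a hn hX => ⟨hn, hX⟩)).mono ?_
  rintro n X a ⟨⟨hn, hcnt⟩, hn6, hX⟩ Xh hXh u v
  have hn' : (0 : ℝ) < n := by exact_mod_cast hn
  have hrange : Set.range (fun v : G.verts X => X v) = G.positions := by
    ext x
    constructor
    · rintro ⟨v, rfl⟩
      exact mem_verts.1 v.2
    · intro hx
      have h1 := hcnt x hx
      have h2 : 0 < ((Finset.univ.filter fun v => X v = x).card : ℝ) :=
        lt_of_lt_of_le (mul_pos hκ hn') h1
      obtain ⟨v, hv⟩ := Finset.card_pos.1 (by exact_mod_cast h2)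
      have hv' := (Finset.mem_filter.1 hv).2
      exact ⟨⟨v, mem_verts.2 (hv' ▸ hx)⟩, hv'⟩
  have h3n : 3 / (n : ℝ) ≤ η ^ 2 / 2 := by
    rw [div_le_iff₀ hn']
    rw [div_le_iff₀ (by positivity)] at hn6
    linarith
  have hSε : S.card * ε ≤ η ^ 2 / 2 := by
    rw [hε, mul_div_assoc', div_le_div_iff₀ (by positivity) (by positivity)]
    nlinarith [sq_nonneg η]
  have hη1 : η ^ 2 ≤ 1 := by
    have : η ≤ 1 := by linarith
    exact pow_le_one₀ hη0.le this
  refine le_trans (abs_inner_ase_sub_le hn (by simpa using (Finset.card_le_univ (G.verts X)))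
    (X := fun v : G.verts X => X v) hXh (fun u v => h.inner_mem _ (hX.mem _) _ (hX.mem _))
    (by rw [hrange]; exact hℓ.dim_eq) hc0 hc1 ?_ ?_ (ε := S.card * ε + 2 / n) (by positivity) ?_
    ?_ hη0.le ?_ hηc u v) hηδ
  · intro y hy
    rw [hrange] at hy
    rw [sum_verts_eq X fun x => inner ℝ x y ^ 2]
    have h1 := hcoer y hy
    calc c * n * ‖y‖ ^ 2 ≤ κ * lam * n * ‖y‖ ^ 2 := by
          gcongr
          exact min_le_right _ _
      _ = κ * n * (lam * ‖y‖ ^ 2) := by ring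
      _ ≤ κ * n * ∑ x ∈ G.atoms, inner ℝ x y ^ 2 := by gcongr
      _ = ∑ x ∈ G.atoms, κ * n * inner ℝ x y ^ 2 := by rw [Finset.mul_sum]
      _ ≤ _ := Finset.sum_le_sum fun x hx =>
          mul_le_mul_of_nonneg_right (hcnt x (mem_atoms.1 hx)) (sq_nonneg _)
  · intro u v
    rw [transpose_mul_adjOn]
    constructor
    · exact Finset.sum_nonneg fun w _ => by split_ifs <;> norm_num
    · calc _ ≤ ∑ w ∈ G.verts X, (1 : ℝ) := Finset.sum_le_sum fun w _ => by split_ifs <;> norm_num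
        _ ≤ n := by
            have : (G.verts X).card ≤ n := by simpa using Finset.card_le_univ (G.verts X)
            simpa using this
  · have : 2 / (n : ℝ) ≤ 3 / n := by gcongr; norm_num
    linarith
  · intro u v huv
    refine (h.abs_codegree_sub_le hε0.le hX u v huv).trans (le_of_eq ?_)
    field_simp
  · have : 2 / (n : ℝ) + 1 / n = 3 / n := by ring
    linarith

theorem IsNode.exists_vertex (h : IsNode F S G) :
    EventuallyTypical F S fun n X _ => ∀ x ∈ G.positions, ∃ v : Fin n, X v = x := by
  obtain ⟨κ, hκ, hcount⟩ := h.exists_count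
  refine hcount.mono ?_
  rintro n X a ⟨hn, hcnt⟩ x hx
  have hn' : (0 : ℝ) < n := by exact_mod_cast hn
  have h2 : 0 < ((Finset.univ.filter fun v => X v = x).card : ℝ) :=
    lt_of_lt_of_le (mul_pos hκ hn') (hcnt x hx)
  obtain ⟨v, hv⟩ := Finset.card_pos.1 (by exact_mod_cast h2)
  exact ⟨v, (Finset.mem_filter.1 hv).2⟩

/-- Affinity with a quantitative gap. -/
theorem exists_threshold {R : ℕ} {w : Fin R → ℝ} {H : Fin R → HSBM D}
    (hA : (mix R w H).Affinity) : ∃ θ γ : ℝ, 0 < γ ∧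
      (∀ j k, j ≠ k → ∀ x ∈ (H j).positions, ∀ y ∈ (H k).positions, inner ℝ x y < θ - γ) ∧
      ∀ i, ∀ x ∈ (H i).positions, ∀ y ∈ (H i).positions, θ + γ < inner ℝ x y := by
  let T : Finset (Euc D) := (mix R w H).atoms
  let B : Finset ℝ := ((T ×ˢ T).filter fun q => ∃ j k, j ≠ k ∧ q.1 ∈ (H j).positions ∧
    q.2 ∈ (H k).positions).image fun q => inner ℝ q.1 q.2
  let I : Finset ℝ := ((T ×ˢ T).filter fun q => ∃ i, q.1 ∈ (H i).positions ∧
    q.2 ∈ (H i).positions).image fun q => inner ℝ q.1 q.2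
  have hT : ∀ i, ∀ x ∈ (H i).positions, x ∈ T := fun i x hx =>
    mem_atoms.2 (positions_subset_mix w H i hx)
  have hBI : ∀ b ∈ B, ∀ c ∈ I, b < c := by
    intro b hb c hc
    obtain ⟨q, hq, rfl⟩ := Finset.mem_image.1 hb
    obtain ⟨q', hq', rfl⟩ := Finset.mem_image.1 hc
    obtain ⟨j, k, hjk, h1, h2⟩ := (Finset.mem_filter.1 hq).2
    obtain ⟨i, h3, h4⟩ := (Finset.mem_filter.1 hq').2
    exact hA.1 j k hjk _ h1 _ h2 i _ h3 _ h4
  -- Interpolation between finite sets also covers an empty B or I; the next two interpolations open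
  -- the gap on either side of θ.
  obtain ⟨θ, hθB, hθI⟩ := Order.exists_between_finsets B I hBI
  obtain ⟨θ₁, h1B, h1θ⟩ := Order.exists_between_finsets B {θ} (by simpa using hθB)
  obtain ⟨θ₂, h2θ, h2I⟩ := Order.exists_between_finsets {θ} I (by simpa using hθI)
  have h1θ' : θ₁ < θ := h1θ θ (by simp)
  have h2θ' : θ < θ₂ := h2θ θ (by simp)
  refine ⟨θ, min (θ - θ₁) (θ₂ - θ), lt_min (by linarith) (by linarith), ?_, ?_⟩
  · intro j k hjk x hx y hy
    have := h1B (inner ℝ x y) (Finset.mem_image.2 ⟨(x, y), Finset.mem_filter.2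
      ⟨Finset.mem_product.2 ⟨hT j x hx, hT k y hy⟩, j, k, hjk, hx, hy⟩, rfl⟩)
    linarith [min_le_left (θ - θ₁) (θ₂ - θ)]
  · intro i x hx y hy
    have := h2I (inner ℝ x y) (Finset.mem_image.2 ⟨(x, y), Finset.mem_filter.2
      ⟨Finset.mem_product.2 ⟨hT i x hx, hT i y hy⟩, i, hx, hy⟩, rfl⟩)
    linarith [min_le_right (θ - θ₁) (θ₂ - θ)]

/-- One round of the procedure recovers the components. -/
theorem IsNode.recovery {R : ℕ} {w : Fin R → ℝ} {H : Fin R → HSBM D}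
    (h : IsNode F S (mix R w H)) :
    EventuallyTypical F S fun _ X a => ∀ C, EmbedAndCluster a ((mix R w H).verts X)
      (mix R w H).dim C → ∃ e : Equiv.Perm (Fin R), ∀ r, C (e r) = (H r).verts X := by
  obtain ⟨θ, γ, hγ, hout, hin⟩ := exists_threshold h.affinity
  -- The embedding is asked to be accurate up to the gap γ, so θ still separates the embedded inner
  -- products.
  refine ((h.gram hγ).and h.exists_vertex).mono ?_
  rintro n X a ⟨hgram, hvert⟩ Hh ⟨Xh, C, hASE, hC, hHh⟩
  have hcl := hgram Xh hASE
  have hex : ∀ v : (mix R w H).verts X, ∃ r, X v ∈ (H r).positions := fun v => by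
    have := mem_verts.1 v.2
    simpa only [positions, Set.mem_iUnion] using this
  choose comp hcomp using hex
  have hcomp_iff : ∀ v r, comp v = r ↔ X v ∈ (H r).positions := fun v r =>
    ⟨fun e => e ▸ hcomp v, fun hv => eq_of_mem_positions h.affinity (hcomp v) hv⟩
  have h_in : ∀ u v, comp u = comp v → θ < inner ℝ (Xh u) (Xh v) := by
    intro u v huv
    have h1 := hin (comp v) (X u) (huv ▸ hcomp u) (X v) (hcomp v)
    linarith [(abs_le.1 (hcl u v)).1]
  have h_out : ∀ u v, comp u ≠ comp v → inner ℝ (Xh u) (Xh v) < θ := by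
    intro u v huv
    have h1 := hout _ _ huv (X u) (hcomp u) (X v) (hcomp v)
    linarith [(abs_le.1 (hcl u v)).2]
  have hsurj : Function.Surjective comp := by
    intro r
    obtain ⟨k, hk⟩ := (h.child r).level
    obtain ⟨x, hx⟩ := hk.positions_nonempty
    have hx' := positions_subset_mix w H r hx
    obtain ⟨v, hv⟩ := hvert x hx'
    exact ⟨⟨v, mem_verts.2 (hv ▸ hx')⟩, (hcomp_iff _ _).2 (by rw [hv]; exact hx)⟩
  obtain ⟨e, he⟩ := hC.exact_recovery h_in h_out hsurj
  refine ⟨e, fun r => ?_⟩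
  rw [hHh, he]
  ext v
  simp only [Finset.mem_map, Finset.mem_filter, Finset.mem_univ, true_and, mem_verts,
    Function.Embedding.subtype_apply]
  constructor
  · rintro ⟨u, hu, rfl⟩
    exact (hcomp_iff u r).1 hu
  · intro hv
    exact ⟨⟨v, mem_verts.2 (positions_subset_mix w H r hv)⟩, (hcomp_iff _ r).2 hv, rfl⟩

/-- The embedding of a sub-model is close to an orthogonal image of the latent positions. -/
theorem IsNode.alignment (h : IsNode F S G) {ε : ℝ} (hε : 0 < ε) :
    EventuallyTypical F S fun _ X a => ∀ Xh : G.verts X → Euc G.dim,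
      IsASE (adjOn a (G.verts X)) Xh →
      ∃ O : Euc D ≃ₗᵢ[ℝ] Euc D, ∀ v : G.verts X, ‖pad D (Xh v) - O (X v)‖ ≤ ε := by
  obtain ⟨δ, hδ, hpad⟩ := exists_delta_isometry_pad (fun x : G.atoms => (x : Euc D)) hε
  refine ((h.gram hδ).and h.exists_vertex).mono ?_
  rintro n X a ⟨hgram, hvert⟩ Xh hXh
  refine hpad (fun v : G.verts X => (⟨X v, mem_atoms.2 (mem_verts.1 v.2)⟩ : G.atoms)) ?_ G.dim_le Xh
    (hgram Xh hXh)
  rintro ⟨x, hx⟩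
  obtain ⟨v, hv⟩ := hvert x (mem_atoms.1 hx)
  exact ⟨⟨v, mem_verts.2 (hv ▸ mem_atoms.1 hx)⟩, Subtype.ext hv⟩

theorem IsNode.consistent {R : ℕ} {w : Fin R → ℝ} {H : Fin R → HSBM D}
    (h : IsNode F S (mix R w H)) {σ ε : ℝ} (hσ : 0 < σ) (hε : 0 < ε) :
    EventuallyTypical F S fun _ X a => Consistent σ ε X a R H fun r => (H r).verts X := by
  set ε₁ := min 1 (ε * σ ^ 2 / 64) with hε₁
  have hε₁0 : 0 < ε₁ := lt_min one_pos (by positivity)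
  have hle : 64 / σ ^ 2 * ε₁ ≤ ε := by
    have := min_le_right 1 (ε * σ ^ 2 / 64)
    rw [div_mul_eq_mul_div, div_le_iff₀ (by positivity)]
    linarith
  refine (EventuallyTypical.all fun r => (h.child r).alignment hε₁0).mono ?_
  intro n X a hal Xh hXh
  choose O hO using fun r => hal r (Xh r) (hXh r)
  have hnorm : ∀ r (v : (H r).verts X), ‖X v‖ ≤ 1 := fun r v =>
    (h.child r).norm_le_one (mem_verts.1 v.2)
  have key := fun i j => testT_stable hσ hε₁0.le (min_le_left _ _) (hnorm i) (hnorm j) (hO i) (hO j)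
  exact ⟨⟨O, fun i j => (key i j).1.trans hle⟩, fun i j => (key i j).2.trans hle⟩

/-- The latent positions of a sub-model are distributed approximately as they should. -/
theorem IsNode.approxSample (h : IsNode F S G) {e : ℝ} (he : 0 < e) :
    EventuallyTypical F S fun _ X _ => ApproxSample G.law G.atoms (fun v : G.verts X => X v) e ∧
      2 ≤ Fintype.card (G.verts X) ∧ 1 / ((Fintype.card (G.verts X) : ℝ) - 1) ≤ e := by
  obtain ⟨ℓ, hℓ⟩ := h.level
  obtain ⟨β, hβ, hmass⟩ := h.mass
  set s : ℝ := ((G.atoms.card : ℕ) : ℝ) with hs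
  have hs0 : 0 ≤ s := Nat.cast_nonneg _
  -- The first bound keeps at least n β / 2 vertices in the sub-model; the second makes the
  -- frequency errors add up to at most e.
  set ε := min (β / (2 * (s + 1))) (e * β / (2 * (s + 1) ^ 2)) with hε
  have hε0 : 0 < ε := lt_min (by positivity) (by positivity)
  have hε1 : s * ε ≤ β / 2 := by
    have h1 := min_le_left (β / (2 * (s + 1))) (e * β / (2 * (s + 1) ^ 2))
    rw [← hε, le_div_iff₀ (by positivity)] at h1
    nlinarith
  have hε2 : s * (2 * (1 + s) * ε / β) ≤ e := by
    have h1 := min_le_right (β / (2 * (s + 1))) (e * β / (2 * (s + 1) ^ 2))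
    rw [← hε, le_div_iff₀ (by positivity)] at h1
    rw [mul_div_assoc', div_le_iff₀ hβ]
    nlinarith [mul_nonneg hs0 hε0.le]
  refine EventuallyTypical.intro hε0 (2 / β * (2 + 1 / e)) fun n X a hn hX => ?_
  have hn' : (0 : ℝ) < n := lt_of_lt_of_le (by positivity) hn
  have hbig : 2 + 1 / e ≤ n * β / 2 := by
    rw [div_mul_eq_mul_div, div_le_iff₀ hβ] at hn
    linarith
  set cnt : Euc D → ℝ := fun x => ((Finset.univ.filter fun v => X v = x).card : ℝ) with hcnt
  have hdev : ∀ x ∈ G.atoms, |cnt x - n * β * G.law.real {x}| ≤ ε * n := by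
    intro x hx
    have := hX.count x (h.subset x (mem_atoms.1 hx))
    rw [hmass x (mem_atoms.1 hx)] at this
    rwa [mul_assoc]
  set N : ℝ := ((Fintype.card (G.verts X) : ℕ) : ℝ) with hN
  have hNsum : N = ∑ x ∈ G.atoms, cnt x := by
    have := sum_verts_eq (G := G) X fun _ => 1
    simpa [hN] using this
  have hNdev : |N - n * β| ≤ s * ε * n := by
    have e1 : N - n * β = ∑ x ∈ G.atoms, (cnt x - n * β * G.law.real {x}) := by
      rw [Finset.sum_sub_distrib, ← hNsum, ← Finset.mul_sum, hℓ.finitelySupported.sum_real, mul_one]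
    rw [e1]
    refine (Finset.abs_sum_le_sum_abs _ _).trans ((Finset.sum_le_sum hdev).trans (le_of_eq ?_))
    simp [hs, mul_assoc]
  have hNlow : n * β / 2 ≤ N := by
    have := (abs_le.1 hNdev).1
    nlinarith
  have hN0 : 0 < N := lt_of_lt_of_le (by positivity) hNlow
  refine ⟨⟨fun v => mem_atoms.2 (mem_verts.1 v.2), ?_⟩, ?_, ?_⟩
  · refine le_trans (Finset.sum_le_card_nsmul _ _ (2 * (1 + s) * ε / β) fun x hx => ?_)
      (by rw [nsmul_eq_mul]; exact hε2)
    have hmean : sampleMean (fun v : G.verts X => if X v = x then (1 : ℝ) else 0) = cnt x / N := by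
      rw [sampleMean, ← hN]
      congr 1
      rw [sum_verts_eq (G := G) X fun y => if y = x then (1 : ℝ) else 0]
      simp [hx, hcnt]
    have hp0 : 0 ≤ G.law.real {x} := measureReal_nonneg
    have hp1 : G.law.real {x} ≤ 1 := by
      have := hℓ.finitelySupported.prob
      exact measureReal_le_one
    rw [hmean]
    have e1 : cnt x / N - G.law.real {x}
        = ((cnt x - n * β * G.law.real {x}) - G.law.real {x} * (N - n * β)) / N := by
      field_simp
      ring
    rw [e1, abs_div, abs_of_pos hN0, div_le_div_iff₀ hN0 hβ]
    have b1 : |(cnt x - n * β * G.law.real {x}) - G.law.real {x} * (N - n * β)|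
        ≤ ε * n + s * ε * n := by
      refine (abs_sub _ _).trans (add_le_add (hdev x hx) ?_)
      rw [abs_mul, abs_of_nonneg hp0]
      exact (mul_le_of_le_one_left (abs_nonneg _) hp1).trans hNdev
    calc _ ≤ (ε * n + s * ε * n) * β := mul_le_mul_of_nonneg_right b1 hβ.le
      _ = 2 * (1 + s) * ε * (n * β / 2) := by ring
      _ ≤ _ := mul_le_mul_of_nonneg_left hNlow (by positivity)
  · have : (2 : ℝ) ≤ N := by
      have : 0 < 1 / e := by positivity
      linarith
    rw [hN] at this
    exact_mod_cast this
  · have : 1 / e ≤ N - 1 := by linarith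
    exact (one_div_le (lt_of_lt_of_le (by positivity) this) he).2 this

/-- Thresholding detects the motifs. -/
theorem IsNode.motifsDetected {R : ℕ} {w : Fin R → ℝ} {H : Fin R → HSBM D}
    (h : IsNode F S (mix R w H)) {σ : ℝ} (hσ : 0 < σ) : ∃ t₀ : ℝ, 0 < t₀ ∧ ∀ t, 0 < t → t < t₀ →
    EventuallyTypical F S fun _ X a => MotifsDetected σ t a R H fun r => (H r).verts X := by
  have hfs : ∀ r, FinitelySupported (H r).law (H r).atoms := fun r => by
    obtain ⟨k, hk⟩ := (h.child r).level
    exact hk.finitelySupported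
  have hsep : ∀ q : Fin R × Fin R, ∃ t : ℝ, 0 < t ∧ (¬ SameMotif (H q.1).law (H q.2).law →
      ∀ W : Euc D ≃ₗᵢ[ℝ] Euc D, t ≤ populationT σ (H q.1).law (H q.2).law W) := by
    intro q
    by_cases hq : SameMotif (H q.1).law (H q.2).law
    · exact ⟨1, one_pos, fun hn => absurd hq hn⟩
    · obtain ⟨t, ht, hW⟩ := exists_pos_le_populationT hσ (hfs q.1) (hfs q.2) hq
      exact ⟨t, ht, fun _ => hW⟩
  choose T hT0 hT using hsep
  obtain ⟨t₁, ht₁, hle⟩ := exists_pos_forall_le hT0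
  refine ⟨t₁ / 2, half_pos ht₁, fun t ht htlt => ?_⟩
  -- Embedding error t / 4 and sampling error 10 · t / 40 = t / 4: equal motifs give at most t / 2,
  -- different ones at least t₁ - t / 2 > t because t < t₁ / 2.
  refine ((h.consistent hσ (show 0 < t / 4 by positivity)).and (EventuallyTypical.all fun r =>
    (h.child r).approxSample (show 0 < t / 40 by positivity))).mono ?_
  rintro n X a ⟨hcons, happ⟩ Xh hXh i j
  have h1 := abs_le.1 ((hcons Xh hXh).2 i j)
  obtain ⟨ai, bi, ci⟩ := happ i
  obtain ⟨aj, bj, cj⟩ := happ j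
  constructor
  · intro hlt
    by_contra hno
    have h2 := le_alignedT (σ := σ) ai aj (hfs i) (hfs j) bi bj ci cj (hT (i, j) hno)
    linarith [hle (i, j), h1.1]
  · intro hsame
    have h2 := alignedT_le_of_sameMotif (σ := σ) ai aj (hfs i) (hfs j) bi bj ci cj hsame
    linarith [h1.2]

/-- The recursive procedure succeeds if each round does. -/
theorem IsNode.perfectRun (Q : ℝ → ∀ n, (Fin n → Euc D) → SimpleGraph (Fin n) → RoundProp D n)
    (hQ : ∀ (R : ℕ) (w : Fin R → ℝ) (H : Fin R → HSBM D), IsNode F S (mix R w H) →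
      ∃ t₀ : ℝ, 0 < t₀ ∧ ∀ t, 0 < t → t < t₀ →
        EventuallyTypical F S fun n X a => Q t n X a R H fun r => (H r).verts X)
    (G : HSBM D) : IsNode F S G → ∃ t₀ : ℝ, 0 < t₀ ∧ ∀ t, 0 < t → t < t₀ →
      EventuallyTypical F S fun n X a => PerfectRun (Q t n X a) X a G (G.verts X) := by
  induction G with
  | sbm K w ξ =>
    exact fun _ => ⟨1, one_pos, fun t _ _ => EventuallyTypical.intro one_pos 0
      fun n X a _ _ => by simp [PerfectRun]⟩
  | mix R w H ih =>
    intro h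
    obtain ⟨t₁, ht₁, h1⟩ := hQ R w H h
    choose t₂ ht₂ h2 using fun r => ih r (h.child r)
    -- A minimum over the finitely many components, so that one threshold serves the whole subtree.
    obtain ⟨t₃, ht₃, hle⟩ := exists_pos_forall_le ht₂
    refine ⟨min t₁ t₃, lt_min ht₁ ht₃, fun t ht htlt => ?_⟩
    refine ((h.recovery.and (h1 t ht (htlt.trans_le (min_le_left _ _)))).and
      (EventuallyTypical.all fun r =>
        h2 r t ht (htlt.trans_le ((min_le_right _ _).trans (hle r))))).mono ?_
    rintro n X a ⟨⟨hrec, hq⟩, hrun⟩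
    rw [PerfectRun]
    intro C hC
    obtain ⟨e, he⟩ := hrec C hC
    -- Recovery being exact, the clusters are the vertex sets to which the induction hypothesis
    -- applies; no error is passed on.
    refine ⟨e, fun r => by rw [he, members_verts], ?_, fun r => by rw [he]; exact hrun r⟩
    have : (fun r => C (e r)) = fun r => (H r).verts X := funext he
    rw [this]
    exact hq

/-- A hierarchical model is a sub-model of itself. -/
theorem isNode_self {ℓ : ℕ} (hG : G.IsLevel ℓ) (hA : G.Affinity)
    (h01 : ∃ B : Set (Euc D), G.law Bᶜ = 0 ∧ ∀ x ∈ B, ∀ y ∈ B, inner ℝ x y ∈ Set.Icc (0 : ℝ) 1) :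
    IsNode G.law G.atoms G := by
  obtain ⟨B, hB, h01⟩ := h01
  have hsub : ∀ x ∈ G.atoms, x ∈ B := by
    intro x hx
    by_contra hxB
    have h0 : G.law {x} = 0 := measure_mono_null (by simpa using hxB) hB
    exact ((G.isLevel_law ℓ hG).2.2 x (mem_atoms.1 hx)).ne' h0
  exact ⟨⟨ℓ, hG⟩, hA, fun x hx => mem_atoms.2 hx, fun x hx y hy => h01 x (hsub x hx) y (hsub y hy),
    1, one_pos, fun x _ => (one_mul _).symm⟩

end HSBM

end

theorem mainTheorem8 {D ℓ : ℕ} (hℓ : 2 ≤ ℓ) (G : HSBM D) (hG : G.IsLevel ℓ) (hA : G.Affinity)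
    (σ : ℝ) (hσ : 0 < σ)
    {Ω : ℕ → Type*} [∀ n, MeasurableSpace (Ω n)] (μ : ∀ n, Measure (Ω n))
    [∀ n, IsProbabilityMeasure (μ n)]
    (X : ∀ n, Ω n → Fin n → Euc D) (A : ∀ n, Ω n → SimpleGraph (Fin n))
    (hXA : ∀ n, IsRDPG (μ n) G.law (X n) (A n)) :
    -- perfect recovery of all subgraphs of all levels simultaneously
    AAS μ (fun n => {ω |
      HSBM.PerfectRun (fun _ _ _ => True) (X n ω) (A n ω) G Finset.univ}) ∧
    -- consistency of all dissimilarity matrices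
    (∀ ε : ℝ, 0 < ε → AAS μ (fun n => {ω |
      HSBM.PerfectRun (HSBM.Consistent σ ε (X n ω) (A n ω)) (X n ω) (A n ω) G Finset.univ})) ∧
    -- perfect detection of the motifs
    (∃ t₀ : ℝ, 0 < t₀ ∧ ∀ t : ℝ, 0 < t → t < t₀ → AAS μ (fun n => {ω |
      HSBM.PerfectRun (HSBM.MotifsDetected σ t (A n ω)) (X n ω) (A n ω) G Finset.univ})) := by
  have hnode := HSBM.isNode_self hG hA (hXA 0).inner_mem
  -- All three claims are instances; the first two take a Q that does not depend on t and evaluate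
  -- at t₀ / 2.
  have key : ∀ Q : ℝ → ∀ n, (Fin n → Euc D) → SimpleGraph (Fin n) → HSBM.RoundProp D n,
      (∀ (R : ℕ) (w : Fin R → ℝ) (H : Fin R → HSBM D), HSBM.IsNode G.law G.atoms (.mix R w H) →
        ∃ t₀ : ℝ, 0 < t₀ ∧ ∀ t, 0 < t → t < t₀ →
          EventuallyTypical G.law G.atoms fun n X a => Q t n X a R H fun r => (H r).verts X) →
      ∃ t₀ : ℝ, 0 < t₀ ∧ ∀ t : ℝ, 0 < t → t < t₀ → AAS μ (fun n => {ω |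
        HSBM.PerfectRun (Q t n (X n ω) (A n ω)) (X n ω) (A n ω) G Finset.univ}) := by
    intro Q hQ
    obtain ⟨t₀, ht₀, h⟩ := HSBM.IsNode.perfectRun Q hQ G hnode
    refine ⟨t₀, ht₀, fun t ht htlt => ?_⟩
    obtain ⟨ε, hε, N, hN⟩ := (h t ht htlt).exists
    refine aas_of_isTypical hG.finitelySupported hnode.inner_mem hXA hε N fun n hn ω hω => ?_
    have h1 := hN n hn (X n ω) (A n ω) hω
    have h2 : G.verts (X n ω) = Finset.univ := by
      ext v
      simpa [HSBM.mem_verts] using HSBM.mem_atoms.1 (hω.mem v)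
    rw [h2] at h1
    exact h1
  refine ⟨?_, fun ε hε => ?_, ?_⟩
  · obtain ⟨t₀, ht₀, h⟩ := key (fun _ _ _ _ _ _ _ => True) fun R w H _ =>
      ⟨1, one_pos, fun t _ _ => EventuallyTypical.intro one_pos 0 fun _ _ _ _ _ => trivial⟩
    exact h (t₀ / 2) (half_pos ht₀) (half_lt_self ht₀)
  · obtain ⟨t₀, ht₀, h⟩ := key (fun _ _ X a => HSBM.Consistent σ ε X a) fun R w H hH =>
      ⟨1, one_pos, fun t _ _ => hH.consistent hσ hε⟩
    exact h (t₀ / 2) (half_pos ht₀) (half_lt_self ht₀)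
  · exact key (fun t _ _ a => HSBM.MotifsDetected σ t a) fun R w H hH => hH.motifsDetected hσ
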